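/- **Setting.** Everything is on $\mathbb R^3$ with values in $\mathbb R^3$; $L^2_\sigma$ is the space of $\mathbf u_0\in L^2(\mathbb R^3;\mathbb R^3)$ with $\nabla\cdot\mathbf u_0=0$ in the sense of distributions. For $\nu>0$ and $\mathbf u_0\in L^2_\sigma$, let $\mathcal W_\nu(\mathbf u_0)$ be the set of weak solutions of the Navier–Stokes equations, that is, of all $\mathbf u\in L^\infty(0,\infty;L^2_\sigma)\cap L^2(0,\infty;\dot H^1)$ with $$\int_0^\infty\!\!\int_{\mathbb R^3}\big[\mathbf u\cdot(\partial_t\varphi+\nu\Delta\varphi)+\mathbf u\otimes\mathbf u:\nabla\varphi\big]\,dx\,dt=-\int_{\mathbb R^3}\mathbf u_0\cdot\varphi(\cdot,0)\,dx$$ for all $\varphi\in C_c^\infty([0,\infty)\times\mathbb R^3;\mathbb R^3)$ with $\nabla\cdot\varphi=0$. A Banach space $\{0\}\ne X\hookrightarrow\mathcal S'(\mathbb R^3;\mathbb R^3)$ (continuously embedded) is *$p$-homogeneous* if $\mathbf v(\lambda^{-1}\cdot)\in X$ and $\|\mathbf v(\lambda^{-1}\cdot)\|_X\approx\lambda^{3/p}\|\mathbf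 v\|_X$ for all $\mathbf v\in X$ and $\lambda>0$, with constants depending only on $X$ (and $3/\infty=0$); it is *isometrically translation invariant* if $\mathbf v(\cdot-x_0)\in X$ and $\|\mathbf v(\cdot-x_0)\|_X=\|\mathbf v\|_X$ for all $\mathbf v\in X$, $x_0\in\mathbb R^3$. The norm of $L^r(0,\infty;X)$ is $\big\|\,\|\mathbf u(t)\|_X\,\big\|_{L^r(0,\infty)}$. A space $Y$ has the *Fatou property* with respect to a dual Banach space $W$ if $\|\mathbf v_j\|_Y\le C<\infty$ for all $j\in\mathbb N$ and $\mathbf v_j\overset{*}{\rightharpoonup}\mathbf v$ in $W$ imply $\mathbf v\in Y$ and $\|\mathbf v\|_Y\le C$. The space $L^2_\sigma\cap Z$ carries the norm $\max\{\|\mathbf u_0\|_{L^2},\|\mathbf u_0\|_Z\}$, and "non-meagre" refers to its topology. **Theorem.** Let $r,s\in(4/3,\infty]$ with $1<\frac2r+\frac3s<\frac32$. Let $X,Z\hookrightarrow\mathcal S'$ be isometrically translation invariant Banach spaces, $X\ne\{0\}$ $s$-homogeneous and $Z$ $2$-homogeneous, with $L^2_\sigma\cap Z\neq\{0\}$. Suppose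 that $L^r(0,\infty;X)$ and $Z$ have the Fatou property with respect to $L^\infty(0,\infty;L^2)$ and $L^2_\sigma$, respectively. Consider the following claims. (i) For some $\nu>0$, there exists $\mathbf u^\nu\in\mathcal W_\nu(\mathbf u_0)\cap L^r(0,\infty;X)$ for a non-meagre set of data $\mathbf u_0\in L^2_\sigma\cap Z$. (ii) There exists $C>0$ such that for every $\nu>0$ and $\mathbf u_0\in L^2_\sigma\cap Z$ there exists $\mathbf u^\nu\in\mathcal W_\nu(\mathbf u_0)$ with $$\|\mathbf u^\nu\|_{L^\infty(0,\infty;L^2)}+\sqrt\nu\,\|\nabla\mathbf u^\nu\|_{L^2(0,\infty;L^2)}\le C\max\{\|\mathbf u_0\|_{L^2},\|\mathbf u_0\|_Z\},$$ $$\|\mathbf u^\nu\|_{L^r(0,\infty;X)}\le C\,\nu^{-3\left(\frac5{3r}+\frac2s-1\right)}\max\Big\{\|\mathbf u_0\|_{L^2}^{2\left(\frac2r+\frac3s-1\right)},\|\mathbf u_0\|_Z^{2\left(\frac2r+\frac3s-1\right)}\Big\}.$$ (iii) $\frac5{3r}+\frac2s\ge1$. (iv) For a non-meagre set of data $\mathbf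 u_0\in L^2_\sigma\cap Z$, $$\limsup_{\nu\to0}\inf_{\mathbf u^\nu\in\mathcal W_\nu(\mathbf u_0)}\Big(\|\mathbf u^\nu\|_{L^\infty(0,\infty;L^2)}+\sqrt\nu\,\|\nabla\mathbf u^\nu\|_{L^2(0,\infty;L^2)}+\|\mathbf u^\nu\|_{L^r(0,\infty;X)}\Big)<\infty.$$ (v) There exist $\nu_0,C>0$ such that for all $\nu>0$, $\tilde\nu\in(0,\nu_0]$ and $\mathbf u_0\in L^2_\sigma\cap Z$ there exists $\mathbf u^\nu\in\mathcal W_\nu(\mathbf u_0)$ with $$\|\mathbf u^\nu\|_{L^\infty(0,\infty;L^2)}+\sqrt\nu\,\|\nabla\mathbf u^\nu\|_{L^2(0,\infty;L^2)}\le C\max\{\|\mathbf u_0\|_{L^2},\|\mathbf u_0\|_Z\},$$ $$\|\mathbf u^\nu\|_{L^r(0,\infty;X)}\le C\Big(\frac{\tilde\nu}{\nu}\Big)^{3\left(\frac5{3r}+\frac2s-1\right)}\max\Big\{\|\mathbf u_0\|_{L^2}^{2\left(\frac2r+\frac3s-1\right)},\|\mathbf u_0\|_Z^{2\left(\frac2r+\frac3s-1\right)}\Big\}.$$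 (vi) $\frac5{3r}+\frac2s=1$. Then (iii) $\Leftarrow$ (i) $\Leftrightarrow$ (ii) $\Leftarrow$ (iv) $\Leftrightarrow$ (v) $\Rightarrow$ (vi). -/

import Mathlib

open MeasureTheory Filter Topology Set
open scoped ENNReal NNReal ContDiff SchwartzMap Laplacian

noncomputable section

namespace NavierStokes

/-- Physical space `ℝ³` with the Euclidean norm; also the space of values of velocity fields. -/
abbrev R3 : Type := EuclideanSpace ℝ (Fin 3)

/-! ### Vector-valued tempered distributions and Banach spaces of them -/

/-- `𝒮'(ℝ³; ℝ³)`: real vector-valued tempered distributions, with the topology of pointwise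
convergence on test functions. (For linear maps from a Banach space, continuity into this
topology is the same as continuity into the strong topology.) -/
abbrev VecDist : Type := 𝓢(R3, ℝ) →Lₚₜ[ℝ] R3

/-- The translate `T(· - a)`, that is `⟨T(· - a), φ⟩ = ⟨T, φ(· + a)⟩`. -/
def translate (a : R3) (T : VecDist) : VecDist :=
  PointwiseConvergenceCLM.precomp R3 (SchwartzMap.compSubConstCLM ℝ (-a)) T

/-- The dilate `T(c⁻¹ ·)`, that is `⟨T(c⁻¹ ·), φ⟩ = c³ ⟨T, φ(c ·)⟩`, for `c > 0`. -/
def dilate (c : ℝ) (hc : 0 < c) (T : VecDist) : VecDist :=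
  c ^ 3 • PointwiseConvergenceCLM.precomp R3
    (SchwartzMap.compCLMOfContinuousLinearEquiv ℝ
      (ContinuousLinearEquiv.smulLeft (M₁ := R3) (R₁ := ℝ) (Units.mk0 c hc.ne'))) T

/-- The tempered distribution `T` is the one given by the function `f`. -/
def Represents (T : VecDist) (f : R3 → R3) : Prop :=
  ∀ φ : 𝓢(R3, ℝ), Integrable (fun x => φ x • f x) ∧ T φ = ∫ x, φ x • f x

section DistributionSpaces

/-! A Banach space `X ↪ 𝒮'` is a Banach space `X` with an injective continuous linear map
`ι : X → 𝒮'`. -/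

variable {X : Type*} [NormedAddCommGroup X] [NormedSpace ℝ X]

/-- `X` is isometrically translation invariant. -/
def IsTranslationInvariant (ι : X →L[ℝ] VecDist) : Prop :=
  ∀ (v : X) (a : R3), ∃ w : X, ι w = translate a (ι v) ∧ ‖w‖ = ‖v‖

/-- `X` is `p`-homogeneous: `‖v(c⁻¹ ·)‖_X ≈ c ^ (3 / p) ‖v‖_X`, with constants that depend only
on the space. Here `3 / ∞ = 0`. -/
def IsHomogeneousSpace (ι : X →L[ℝ] VecDist) (p : ℝ≥0∞) : Prop :=
  ∃ A B : ℝ, 0 < A ∧ 0 < B ∧ ∀ (v : X) (c : ℝ) (hc : 0 < c), ∃ w : X,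
    ι w = dilate c hc (ι v) ∧
    A * (c ^ (3 * p⁻¹.toReal) * ‖v‖) ≤ ‖w‖ ∧ ‖w‖ ≤ B * (c ^ (3 * p⁻¹.toReal) * ‖v‖)

/-- The norm `‖f‖_X` of a function `f`, equal to `∞` if `f` does not belong to `X`. -/
def spaceNorm (ι : X →L[ℝ] VecDist) (f : R3 → R3) : ℝ≥0∞ :=
  ⨅ (x : X) (_ : Represents (ι x) f), ‖x‖ₑ

end DistributionSpaces

/-! ### Mixed space-time norms on `(0, ∞) × ℝ³` -/

/-- Lebesgue measure on the time interval `(0, ∞)`. -/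
def timeMeasure : Measure ℝ := volume.restrict (Ioi 0)

/-- Lebesgue measure on space-time `(0, ∞) × ℝ³`. -/
def spaceTimeMeasure : Measure (ℝ × R3) := timeMeasure.prod volume

/-- The norm of `u` in `L^p(0, ∞; L²)`. -/
def timeL2Norm (p : ℝ≥0∞) (u : ℝ → R3 → R3) : ℝ≥0∞ :=
  eLpNorm (fun t => eLpNorm (u t) 2 volume) p timeMeasure

/-- `u ∈ L^p(0, ∞; L²)`. -/
def MemTimeL2 (p : ℝ≥0∞) (u : ℝ → R3 → R3) : Prop :=
  AEStronglyMeasurable (Function.uncurry u) spaceTimeMeasure ∧ timeL2Norm p u < ⊤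

/-- The norm of `u` in `L^r(0, ∞; X)`, that is the `L^r(0, ∞)` norm of `t ↦ ‖u(t)‖_X`,
equal to `∞` if `u` does not belong to that space. Functions `t ↦ ‖u(t)‖_X` that are not known to
be measurable are treated by means of measurable majorants; for a measurable one the infimum is
attained by the function itself. -/
def lrNorm {X : Type*} [NormedAddCommGroup X] [NormedSpace ℝ X] (ι : X →L[ℝ] VecDist)
    (r : ℝ≥0∞) (u : ℝ → R3 → R3) : ℝ≥0∞ :=
  ⨅ (g : ℝ → ℝ≥0∞) (_ : AEMeasurable g timeMeasure)
    (_ : ∀ᵐ t ∂timeMeasure, spaceNorm ι (u t) ≤ g t), eLpNorm g r timeMeasure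

/-- `G ∈ L²((0, ∞) × ℝ³)` is the weak spatial gradient of `u`; here `G t x k = ∂_k u (t, x)`, and
`G t x` carries the Frobenius norm. -/
def IsWeakGradient (u : ℝ → R3 → R3) (G : ℝ → R3 → PiLp 2 (fun _ : Fin 3 => R3)) : Prop :=
  MemLp (Function.uncurry G) 2 spaceTimeMeasure ∧
  ∀ φ : ℝ → R3 → ℝ, ContDiff ℝ ∞ (Function.uncurry φ) →
    HasCompactSupport (Function.uncurry φ) → tsupport (Function.uncurry φ) ⊆ Ioi 0 ×ˢ univ →
    ∀ k : Fin 3,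
      ∫ t in Ioi (0 : ℝ), ∫ x, (fderiv ℝ (φ t) x (EuclideanSpace.single k 1)) • u t x =
        - ∫ t in Ioi (0 : ℝ), ∫ x, φ t x • G t x k

/-- `‖∇u‖_{L²(0, ∞; L²)}`, equal to `∞` if `u` has no weak gradient in that space. -/
def gradNorm (u : ℝ → R3 → R3) : ℝ≥0∞ :=
  ⨅ (G : ℝ → R3 → PiLp 2 (fun _ : Fin 3 => R3)) (_ : IsWeakGradient u G),
    eLpNorm (Function.uncurry G) 2 spaceTimeMeasure

/-- `‖u‖_{L^∞(0, ∞; L²)} + √ν ‖∇u‖_{L²(0, ∞; L²)}`. -/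
def energyNorm (ν : ℝ) (u : ℝ → R3 → R3) : ℝ≥0∞ :=
  timeL2Norm ⊤ u + ENNReal.ofReal (Real.sqrt ν) * gradNorm u

/-! ### Weak solutions -/

/-- `∇ · f = 0` in the sense of distributions. -/
def IsDivFree (f : R3 → R3) : Prop :=
  ∀ ψ : R3 → ℝ, ContDiff ℝ ∞ ψ → HasCompactSupport ψ → ∫ x, fderiv ℝ ψ x (f x) = 0

/-- The classical divergence of a smooth vector field. -/
def divergence (f : R3 → R3) (x : R3) : ℝ :=
  ∑ i : Fin 3, fderiv ℝ f x (EuclideanSpace.single i 1) i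

/-- Test fields: restrictions to `[0, ∞) × ℝ³` of smooth compactly supported fields, solenoidal at
every time `t ≥ 0`. They need not vanish at `t = 0`. -/
def IsTestField (φ : ℝ → R3 → R3) : Prop :=
  ContDiff ℝ ∞ (Function.uncurry φ) ∧ HasCompactSupport (Function.uncurry φ) ∧
    ∀ t : ℝ, 0 ≤ t → ∀ x, divergence (φ t) x = 0

/-- `u ∈ 𝒲_ν(u₀)`: `u ∈ L^∞(0, ∞; L²_σ) ∩ L²(0, ∞; Ḣ¹)` is a weak solution on `[0, ∞)` of the
Navier-Stokes equations with viscosity `ν` and initial datum `u₀`. -/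
structure IsWeakSolution (ν : ℝ) (u₀ : R3 → R3) (u : ℝ → R3 → R3) : Prop where
  memL2 : MemTimeL2 ⊤ u
  memH1 : gradNorm u < ⊤
  divFree : ∀ᵐ t ∂timeMeasure, IsDivFree (u t)
  weakForm : ∀ φ : ℝ → R3 → R3, IsTestField φ →
    ∫ t in Ioi (0 : ℝ), ∫ x,
      (inner ℝ (u t x) (deriv (fun τ => φ τ x) t + ν • Δ (φ t) x)
        + inner ℝ (u t x) (fderiv ℝ (φ t) x (u t x))) =
      - ∫ x, inner ℝ (u₀ x) (φ 0 x)

/-! ### Spaces of initial data -/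

/-- A test gradient paired with an `L²` field is integrable. -/
theorem integrable_fderiv_apply (f : Lp R3 2 (volume : Measure R3)) {ψ : R3 → ℝ}
    (h : ContDiff ℝ ∞ ψ) (hc : HasCompactSupport ψ) :
    Integrable (fun x => fderiv ℝ ψ x (f x)) := by
  have h1 : MemLp (fderiv ℝ ψ) 2 (volume : Measure R3) :=
    (h.continuous_fderiv (by simp)).memLp_of_hasCompactSupport (hc.fderiv ℝ)
  exact memLp_one_iff_integrable.1
    ((ContinuousLinearMap.id ℝ (R3 →L[ℝ] ℝ)).memLp_of_bilin 1 h1 (Lp.memLp f))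

/-- `L²_σ`: the solenoidal fields in `L²(ℝ³; ℝ³)`. -/
def L2sigma : Submodule ℝ (Lp R3 2 (volume : Measure R3)) where
  carrier := {f | IsDivFree f}
  zero_mem' := by
    intro ψ _ _
    rw [integral_eq_zero_of_ae]
    filter_upwards [Lp.coeFn_zero R3 2 (volume : Measure R3)] with x hx
    rw [hx]
    simp
  add_mem' := by
    intro f g hf hg ψ h hc
    have : (fun x => fderiv ℝ ψ x ((f + g : Lp R3 2 (volume : Measure R3)) x)) =ᵐ[volume]
        fun x => fderiv ℝ ψ x (f x) + fderiv ℝ ψ x (g x) := by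
      filter_upwards [Lp.coeFn_add f g] with x hx
      rw [hx]
      simp
    rw [integral_congr_ae this, integral_add (integrable_fderiv_apply f h hc)
      (integrable_fderiv_apply g h hc), hf ψ h hc, hg ψ h hc, add_zero]
  smul_mem' := by
    intro c f hf ψ h hc
    have : (fun x => fderiv ℝ ψ x ((c • f : Lp R3 2 (volume : Measure R3)) x)) =ᵐ[volume]
        fun x => c * fderiv ℝ ψ x (f x) := by
      filter_upwards [Lp.coeFn_smul c f] with x hx
      rw [hx]
      simp
    rw [integral_congr_ae this, integral_const_mul, hf ψ h hc, mul_zero]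

section DataSpace

variable {Z : Type*} [NormedAddCommGroup Z] [NormedSpace ℝ Z]

/-- The normed space `L²_σ ∩ Z` with norm `max {‖u₀‖_{L²}, ‖u₀‖_Z}`: its elements are the pairs of
`f ∈ L²_σ` and `z ∈ Z` that are equal as tempered distributions. -/
def dataSpace (ι : Z →L[ℝ] VecDist) : Submodule ℝ (Lp R3 2 (volume : Measure R3) × Z) where
  carrier := {q | q.1 ∈ L2sigma ∧ Represents (ι q.2) q.1}
  zero_mem' := by
    refine ⟨L2sigma.zero_mem, fun φ => ?_⟩
    have : (fun x => φ x • (0 : Lp R3 2 (volume : Measure R3)) x) =ᵐ[volume] fun _ => 0 := by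
      filter_upwards [Lp.coeFn_zero R3 2 (volume : Measure R3)] with x hx
      rw [hx]
      simp
    refine ⟨(integrable_congr this).2 (integrable_zero _ _ _), ?_⟩
    rw [Prod.fst_zero, integral_congr_ae this]
    simp
  add_mem' := by
    rintro a b ⟨ha, ha'⟩ ⟨hb, hb'⟩
    refine ⟨L2sigma.add_mem ha hb, fun φ => ?_⟩
    have : (fun x => φ x • (a.1 + b.1 : Lp R3 2 (volume : Measure R3)) x) =ᵐ[volume]
        fun x => φ x • a.1 x + φ x • b.1 x := by
      filter_upwards [Lp.coeFn_add a.1 b.1] with x hx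
      rw [hx]
      simp
    refine ⟨(integrable_congr this).2 ((ha' φ).1.add (hb' φ).1), ?_⟩
    calc ι (a + b).2 φ = ι a.2 φ + ι b.2 φ := by simp
      _ = _ := by
        rw [(ha' φ).2, (hb' φ).2, ← integral_add (ha' φ).1 (hb' φ).1]
        exact (integral_congr_ae this).symm
  smul_mem' := by
    rintro c a ⟨ha, ha'⟩
    refine ⟨L2sigma.smul_mem c ha, fun φ => ?_⟩
    have : (fun x => φ x • (c • a.1 : Lp R3 2 (volume : Measure R3)) x) =ᵐ[volume]
        fun x => c • (φ x • a.1 x) := by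
      filter_upwards [Lp.coeFn_smul c a.1] with x hx
      rw [hx, Pi.smul_apply, smul_comm]
    refine ⟨(integrable_congr this).2 ((ha' φ).1.smul c), ?_⟩
    calc ι (c • a).2 φ = c • ι a.2 φ := by simp
      _ = _ := by
        rw [(ha' φ).2, ← integral_smul]
        exact (integral_congr_ae this).symm

/-! ### Fatou properties -/

/-- `Z` has the Fatou property with respect to the Hilbert space `L²_σ`: if `f_j ⇀ f` in `L²_σ` and
the `f_j` are bounded by `C` in `Z`, then `f ∈ Z` and `‖f‖_Z ≤ C`. -/
def HasFatouL2sigma (ι : Z →L[ℝ] VecDist) : Prop :=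
  ∀ (f : ℕ → Lp R3 2 (volume : Measure R3)) (f' : Lp R3 2 (volume : Measure R3)) (z : ℕ → Z)
    (C : ℝ), (∀ j, f j ∈ L2sigma) → f' ∈ L2sigma →
    (∀ g ∈ L2sigma, Tendsto (fun j => inner ℝ (f j) g) atTop (𝓝 (inner ℝ f' g))) →
    (∀ j, Represents (ι (z j)) (f j)) → (∀ j, ‖z j‖ ≤ C) →
    ∃ z' : Z, Represents (ι z') f' ∧ ‖z'‖ ≤ C

end DataSpace

/-- Weak* convergence `v_j ⇀* v` in `L^∞(0, ∞; L²)`, the dual of `L¹(0, ∞; L²)`. -/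
def WeakStarTendsto (v : ℕ → ℝ → R3 → R3) (v' : ℝ → R3 → R3) : Prop :=
  ∀ φ : ℝ → R3 → R3, MemTimeL2 1 φ →
    Tendsto (fun j => ∫ t in Ioi (0 : ℝ), ∫ x, inner ℝ (v j t x) (φ t x)) atTop
      (𝓝 (∫ t in Ioi (0 : ℝ), ∫ x, inner ℝ (v' t x) (φ t x)))

/-- `L^r(0, ∞; X)` has the Fatou property with respect to `L^∞(0, ∞; L²)`. -/
def HasFatouTime {X : Type*} [NormedAddCommGroup X] [NormedSpace ℝ X] (ι : X →L[ℝ] VecDist)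
    (r : ℝ≥0∞) : Prop :=
  ∀ (v : ℕ → ℝ → R3 → R3) (v' : ℝ → R3 → R3) (C : ℝ≥0),
    (∀ j, MemTimeL2 ⊤ (v j)) → MemTimeL2 ⊤ v' → WeakStarTendsto v v' →
    (∀ j, lrNorm ι r (v j) ≤ C) → lrNorm ι r v' ≤ C

/-! ### The claims -/

section Claims

variable {X Z : Type*} [NormedAddCommGroup X] [NormedSpace ℝ X]
  [NormedAddCommGroup Z] [NormedSpace ℝ Z]

/-- For some `ν > 0`, the set of data in `L²_σ ∩ Z` that have a weak solution in `L^r(0, ∞; X)` is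
non-meagre in `L²_σ ∩ Z`. -/
def SolvableNonMeagre (ιX : X →L[ℝ] VecDist) (ιZ : Z →L[ℝ] VecDist) (r : ℝ≥0∞) : Prop :=
  ∃ ν : ℝ, 0 < ν ∧
    ¬ IsMeagre {u₀ : dataSpace ιZ | ∃ u, IsWeakSolution ν u₀.1.1 u ∧ lrNorm ιX r u < ⊤}

/-- The a priori estimate for all viscosities and all data. -/
def AprioriEstimate (ιX : X →L[ℝ] VecDist) (ιZ : Z →L[ℝ] VecDist) (r s : ℝ≥0∞) : Prop :=
  ∃ C : ℝ, 0 < C ∧ ∀ ν : ℝ, 0 < ν → ∀ u₀ : dataSpace ιZ, ∃ u, IsWeakSolution ν u₀.1.1 u ∧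
    energyNorm ν u ≤ ENNReal.ofReal (C * max ‖u₀.1.1‖ ‖u₀.1.2‖) ∧
    lrNorm ιX r u ≤ ENNReal.ofReal
      (C * ν ^ (-3 * (5 / 3 * r⁻¹.toReal + 2 * s⁻¹.toReal - 1)) *
        max (‖u₀.1.1‖ ^ (2 * (2 * r⁻¹.toReal + 3 * s⁻¹.toReal - 1)))
          (‖u₀.1.2‖ ^ (2 * (2 * r⁻¹.toReal + 3 * s⁻¹.toReal - 1))))

/-- For a non-meagre set of data in `L²_σ ∩ Z`,
`limsup_{ν → 0} inf_{u ∈ 𝒲_ν(u₀)} (‖u‖_{L^∞ L²} + √ν ‖∇u‖_{L² L²} + ‖u‖_{L^r X}) < ∞`. -/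
def UniformNonMeagre (ιX : X →L[ℝ] VecDist) (ιZ : Z →L[ℝ] VecDist) (r : ℝ≥0∞) : Prop :=
  ¬ IsMeagre {u₀ : dataSpace ιZ |
    limsup (fun ν : ℝ => ⨅ (u : ℝ → R3 → R3) (_ : IsWeakSolution ν u₀.1.1 u),
      (energyNorm ν u + lrNorm ιX r u)) (𝓝[>] 0) < ⊤}

/-- The a priori estimate with the extra parameter `ν' ∈ (0, ν₀]`. -/
def UniformAprioriEstimate (ιX : X →L[ℝ] VecDist) (ιZ : Z →L[ℝ] VecDist) (r s : ℝ≥0∞) : Prop :=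
  ∃ ν₀ C : ℝ, 0 < ν₀ ∧ 0 < C ∧ ∀ ν : ℝ, 0 < ν → ∀ ν' : ℝ, 0 < ν' → ν' ≤ ν₀ →
    ∀ u₀ : dataSpace ιZ, ∃ u, IsWeakSolution ν u₀.1.1 u ∧
      energyNorm ν u ≤ ENNReal.ofReal (C * max ‖u₀.1.1‖ ‖u₀.1.2‖) ∧
      lrNorm ιX r u ≤ ENNReal.ofReal
        (C * (ν' / ν) ^ (3 * (5 / 3 * r⁻¹.toReal + 2 * s⁻¹.toReal - 1)) *
          max (‖u₀.1.1‖ ^ (2 * (2 * r⁻¹.toReal + 3 * s⁻¹.toReal - 1)))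
            (‖u₀.1.2‖ ^ (2 * (2 * r⁻¹.toReal + 3 * s⁻¹.toReal - 1))))

end Claims

end NavierStokes

end

/-!
The proof combines a weak compactness theorem for solutions with the Baire category theorem and with
the symmetries of the Navier-Stokes equations.

*Compactness.* Weak solutions with fixed viscosity that are bounded in `L^∞(0, ∞; L²)`, in
`L²(0, ∞; Ḣ¹)` and in `L^r(0, ∞; X)` are stable under weak convergence of their data
(`exists_solution_of_weak_limit`). Weak limits in space-time exist by Banach-Alaoglu. The moments
`∫ u(t) · φ` against solenoidal test fields start from those of the datum and are equi-Lipschitz in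
time (`IsWeakSolution.pairing_eq`, `exists_flux_bound`), so weak convergence in space-time improves
to weak convergence in `L²` at almost every time (`ae_weak_tendsto`); that solenoidal test fields
are total in `L²_σ` follows from Liouville's theorem, as the double curls of scalar functions test
for harmonicity (`ae_eq_zero_of_orthogonal_solenoidal`). Together with the bound for the gradients
this gives strong convergence on bounded sets (`tendsto_lintegral_sq_of_weak`), hence convergence of
the quadratic term, and the Fatou property preserves the bound in `L^r(0, ∞; X)`.

*Uniform boundedness.* Consequently the set of data having solutions with given bounds, for all
viscosities in a given set, is closed in `L²_σ ∩ Z` (`isClosed_boundedData`). If countably many such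
sets cover a non-meagre set, then one of them contains a ball. Its centre `u₁` can be replaced by
the translate `u₁(· + y)` because solutions can be translated, and the translates tend weakly to
zero as `|y| → ∞`; by the compactness theorem the ball may be centred at the origin
(`exists_ball_subset_boundedData`). Finally `a u(a c t, c x)` solves the equations with viscosity
`ν a / c` (`IsWeakSolution.rescale`), and the two scaling parameters suffice to pass from one
viscosity `ν'` and small data to all viscosities and all data, with the powers of `ν' / ν` and of
the norm of the datum that appear in the estimates (`exists_estimate_of_ball`).

*Restrictions on the exponents.* Data with solutions of bounded viscosity and energy that are
arbitrarily small in `L^r(0, ∞; X)` vanish, since their moments cannot drop to zero at once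
(`ae_eq_zero_of_small_solutions`). The a priori estimate would produce such solutions for every
datum as `ν → 0` if `5 / (3 r) + 2 / s < 1`; the one with the additional parameter `ν'` would do so
at fixed viscosity, as `ν' → 0`, if `5 / (3 r) + 2 / s > 1`. The converse implications hold as the
estimates apply to all data and the Banach space `L²_σ ∩ Z` is not meagre in itself.
-/


open scoped FourierTransform

noncomputable section

namespace NavierStokes

/-! ### Harmonic square integrable functions -/

theorem contDiff_two {E F : Type*} [NormedAddCommGroup E] [NormedSpace ℝ E] [NormedAddCommGroup F]
    [NormedSpace ℝ F] {f : E → F} (hf : ContDiff ℝ ∞ f) : ContDiff ℝ 2 f :=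
  mod_cast contDiff_infty.1 hf 2

theorem laplacian_eq_sum_fderiv {F : Type*} [NormedAddCommGroup F] [NormedSpace ℝ F]
    {f : R3 → F} (hf : ContDiff ℝ 2 f) (x : R3) :
    Δ f x = ∑ i : Fin 3, fderiv ℝ (fun y => fderiv ℝ f y (EuclideanSpace.single i 1)) x
      (EuclideanSpace.single i 1) := by
  rw [InnerProductSpace.laplacian_eq_iteratedFDeriv_orthonormalBasis f
    (EuclideanSpace.basisFun (Fin 3) ℝ)]
  refine Finset.sum_congr rfl fun i _ => ?_
  have hd : DifferentiableAt ℝ (fderiv ℝ f) x :=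
    ((hf.fderiv_right (m := 1) (by norm_num)).differentiable (by norm_num)).differentiableAt
  rw [iteratedFDeriv_two_apply, fderiv_clm_apply hd (differentiableAt_const _)]
  simp

/-- A harmonic tempered distribution in `L²` vanishes: its Fourier transform is a square integrable
function annihilated by `|ξ|²`. -/
theorem ae_eq_zero_of_integral_laplacian_schwartz (f : Lp ℂ 2 (volume : Measure R3))
    (h : ∀ η : 𝓢(R3, ℂ), ∫ x, (Δ η) x • f x = 0) : f = 0 := by
  set T : 𝓢'(R3, ℂ) := Lp.toTemperedDistribution f with hTdef
  have hT : Δ T = 0 := by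
    ext η
    rw [TemperedDistribution.laplacian_apply_apply, Lp.toTemperedDistribution_apply]
    exact h η
  rw [TemperedDistribution.laplacian_eq_fourierMultiplierCLM] at hT
  have hT2 : TemperedDistribution.fourierMultiplierCLM ℂ
      (fun x : R3 => Complex.ofReal (‖x‖ ^ 2)) T = 0 := by
    have : (-(2 * Real.pi) ^ 2 : ℝ) ≠ 0 := by
      have := Real.pi_pos
      simp
    exact (smul_eq_zero.1 hT).resolve_left this
  rw [TemperedDistribution.fourierMultiplierCLM_apply] at hT2
  have hT3 := congrArg (fun S => 𝓕 S) hT2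
  simp only [FourierTransform.fourier_fourierInv_eq] at hT3
  rw [Lp.fourier_toTemperedDistribution_eq] at hT3
  set g := 𝓕 f
  have hloc : LocallyIntegrable g volume := (Lp.memLp g).locallyIntegrable (by norm_num)
  have hg : ∀ᵐ x, (((‖x‖ ^ 2 : ℝ) : ℂ) • g x) = 0 := by
    apply ae_eq_zero_of_integral_contDiff_smul_eq_zero
    · exact hloc.continuous_smul (by fun_prop)
    · intro ψ h1 h2
      have h1' : ContDiff ℝ ∞ (fun x => (ψ x : ℂ)) := Complex.ofRealCLM.contDiff.comp h1
      have h2' : HasCompactSupport (fun x => (ψ x : ℂ)) := h2.comp_left (g := Complex.ofReal) rfl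
      have h3 := congrArg (fun S => S (h2'.toSchwartzMap h1')) hT3
      simp only [TemperedDistribution.smulLeftCLM_apply_apply] at h3
      rw [Lp.toTemperedDistribution_apply] at h3
      have hF0 : (𝓕 (0 : 𝓢'(R3, ℂ))) = 0 := (FourierTransform.fourierCLM ℂ 𝓢'(R3, ℂ)).map_zero
      rw [hF0] at h3
      refine (integral_congr_ae (ae_of_all _ fun x => ?_)).trans h3
      have htg : (fun x : R3 => Complex.ofReal (‖x‖ ^ 2)).HasTemperateGrowth := by fun_prop
      rw [SchwartzMap.smulLeftCLM_apply_apply htg]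
      simp [mul_left_comm, mul_assoc]
  have : g = 0 := by
    rw [Lp.eq_zero_iff_ae_eq_zero]
    have h0 : ∀ᵐ x : R3, x ≠ 0 := by
      simp [ae_iff]
    filter_upwards [hg, h0] with x hx hx0
    simpa [hx0] using hx
  have h2 := Lp.norm_fourier_eq f
  have h3 : ‖𝓕 f‖ = 0 := by rw [show 𝓕 f = 0 from this]; simp
  rw [h3] at h2
  exact norm_eq_zero.1 h2.symm

theorem fderiv_comp_affine {F : Type*} [NormedAddCommGroup F] [NormedSpace ℝ F]
    {f : R3 → F} (hf : Differentiable ℝ f) (c : ℝ) (y x : R3) :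
    fderiv ℝ (fun x => f (c • x + y)) x = c • fderiv ℝ f (c • x + y) := by
  have h1 : HasFDerivAt (fun x : R3 => c • x + y) (c • ContinuousLinearMap.id ℝ R3) x :=
    ((hasFDerivAt_id x).const_smul c).add_const y
  have h2 := (hf (c • x + y)).hasFDerivAt.comp x h1
  exact h2.fderiv.trans (by ext v; simp)

theorem laplacian_comp_affine {F : Type*} [NormedAddCommGroup F] [NormedSpace ℝ F]
    {f : R3 → F} (hf : ContDiff ℝ 2 f) (c : ℝ) (y x : R3) :
    Δ (fun x => f (c • x + y)) x = c ^ 2 • Δ f (c • x + y) := by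
  have hd : Differentiable ℝ f := hf.differentiable (by norm_num)
  have hd' : Differentiable ℝ (fderiv ℝ f) :=
    (hf.fderiv_right (m := 1) (by norm_num)).differentiable (by norm_num)
  rw [laplacian_eq_sum_fderiv hf, laplacian_eq_sum_fderiv (by fun_prop), Finset.smul_sum]
  refine Finset.sum_congr rfl fun i _ => ?_
  simp_rw [fderiv_comp_affine hd, smul_apply]
  have h3 : Differentiable ℝ fun y => fderiv ℝ f y (EuclideanSpace.single i 1) := by fun_prop
  have h4 : Differentiable ℝ fun x : R3 =>
    fderiv ℝ f (c • x + y) (EuclideanSpace.single i 1) := by fun_prop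
  rw [fderiv_fun_const_smul h4.differentiableAt, smul_apply,
    fderiv_comp_affine h3, smul_apply, smul_smul, sq]

theorem laplacian_mul_smul {F : Type*} [NormedAddCommGroup F] [NormedSpace ℝ F]
    {a : R3 → ℝ} {f : R3 → F} (ha : ContDiff ℝ 2 a) (hf : ContDiff ℝ 2 f) (x : R3) :
    Δ (fun x => a x • f x) x = a x • Δ f x + (2 : ℝ) • ∑ i : Fin 3,
      fderiv ℝ a x (EuclideanSpace.single i 1) • fderiv ℝ f x (EuclideanSpace.single i 1)
      + Δ a x • f x := by
  have hd : Differentiable ℝ f := hf.differentiable (by norm_num)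
  have hd' : Differentiable ℝ (fderiv ℝ f) :=
    (hf.fderiv_right (m := 1) (by norm_num)).differentiable (by norm_num)
  have had : Differentiable ℝ a := ha.differentiable (by norm_num)
  have had' : Differentiable ℝ (fderiv ℝ a) :=
    (ha.fderiv_right (m := 1) (by norm_num)).differentiable (by norm_num)
  rw [laplacian_eq_sum_fderiv hf, laplacian_eq_sum_fderiv (by fun_prop),
    laplacian_eq_sum_fderiv ha, Finset.smul_sum, Finset.smul_sum, Finset.sum_smul,
    ← Finset.sum_add_distrib, ← Finset.sum_add_distrib]
  refine Finset.sum_congr rfl fun i _ => ?_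
  have h1 : (fun y => fderiv ℝ (fun x => a x • f x) y (EuclideanSpace.single i 1)) =
      fun y => a y • fderiv ℝ f y (EuclideanSpace.single i 1)
        + fderiv ℝ a y (EuclideanSpace.single i 1) • f y := by
    ext1 y
    rw [fderiv_fun_smul had.differentiableAt hd.differentiableAt]
    simp
  rw [h1, fderiv_fun_add (by fun_prop) (by fun_prop), fderiv_fun_smul (by fun_prop) (by fun_prop),
    fderiv_fun_smul (by fun_prop) (by fun_prop)]
  simp [two_smul]
  abel

theorem HasCompactSupport.comp_affine {F : Type*} [Zero F] {f : R3 → F} (hf : HasCompactSupport f)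
    {c : ℝ} (hc : c ≠ 0) (y : R3) : HasCompactSupport fun x => f (c • x + y) :=
  hf.comp_homeomorph ((Homeomorph.smulOfNeZero c hc).trans (Homeomorph.addRight y))

/-- A compactly supported smooth function and its derivatives of order at most two are bounded. -/
theorem exists_bound_of_hasCompactSupport {a : R3 → ℝ} (ha : ContDiff ℝ ∞ a)
    (hc : HasCompactSupport a) :
    ∃ C, 0 ≤ C ∧ ∀ x, |a x| ≤ C ∧ (∀ i, |fderiv ℝ a x (EuclideanSpace.single i 1)| ≤ C) ∧
      |Δ a x| ≤ C := by
  set η := hc.toSchwartzMap ha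
  obtain ⟨C0, h0⟩ := (hc.toSchwartzMap ha).continuous.bounded_above_of_compact_support hc
  obtain ⟨C1, h1⟩ := (ha.continuous_fderiv (by simp)).bounded_above_of_compact_support
    (hc.fderiv ℝ)
  obtain ⟨C2, hC2⟩ := (Δ (hc.toSchwartzMap ha)).decay 0 0
  refine ⟨max C0 (max C1 C2), le_max_of_le_right (le_max_of_le_right hC2.1.le), fun x =>
    ⟨(h0 x).trans (le_max_left _ _), fun i => ?_, ?_⟩⟩
  · refine le_trans ?_ (le_max_of_le_right (le_max_left _ _))
    refine le_trans ?_ (h1 x)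
    simpa using (fderiv ℝ a x).le_opNorm (EuclideanSpace.single i 1)
  · refine le_trans ?_ (le_max_of_le_right (le_max_right _ _))
    have := hC2.2 x
    rw [norm_iteratedFDeriv_zero, SchwartzMap.laplacian_apply, pow_zero, one_mul] at this
    exact this

/-- A square integrable function that is harmonic when tested with compactly supported functions is
harmonic as a tempered distribution: the Schwartz function `η` is approximated by `χ(ε_n ·) η` with
a cut-off function `χ`. -/
theorem integral_laplacian_schwartz_eq_zero {f : R3 → ℂ} (hf : MemLp f 2)
    (h : ∀ ψ : R3 → ℂ, ContDiff ℝ ∞ ψ → HasCompactSupport ψ → ∫ x, Δ ψ x • f x = 0)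
    (η : 𝓢(R3, ℂ)) : ∫ x, (Δ η) x • f x = 0 := by
  let χ : ContDiffBump (0 : R3) := ⟨1, 2, by norm_num, by norm_num⟩
  have hχ : ContDiff ℝ ∞ (fun x => χ x) := χ.contDiff
  obtain ⟨C, hC0, hC⟩ := exists_bound_of_hasCompactSupport hχ χ.hasCompactSupport
  let ε : ℕ → ℝ := fun n => 1 / ((n : ℝ) + 1)
  have hε : ∀ n, 0 < ε n := fun n => Nat.one_div_pos_of_nat
  have hε1 : ∀ n, ε n ≤ 1 := fun n => by
    rw [div_le_one (by positivity)]; simp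
  have hη : ContDiff ℝ ∞ η := η.smooth ⊤
  let a : ℕ → R3 → ℝ := fun n x => χ (ε n • x + 0)
  have ha : ∀ n, ContDiff ℝ ∞ (a n) := fun n => hχ.comp (by fun_prop)
  have hcs : ∀ n, HasCompactSupport (fun x => a n x • η x) := fun n =>
    HasCompactSupport.smul_right (f := a n) (f' := η)
      (HasCompactSupport.comp_affine χ.hasCompactSupport (hε n).ne' 0)
  have hint : ∀ n, ∫ x, Δ (fun x => a n x • η x) x • f x = 0 := fun n =>
    h _ ((ha n).smul hη) (hcs n)
  have hlap : ∀ x, (Δ η) x = Δ (η : R3 → ℂ) x := fun x => η.laplacian_apply x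
  let D : Fin 3 → 𝓢(R3, ℂ) := fun i =>
    LineDeriv.lineDerivOp (EuclideanSpace.single i (1:ℝ)) η
  have hD : ∀ i x, D i x = fderiv ℝ η x (EuclideanSpace.single i 1) := fun i x =>
    SchwartzMap.lineDerivOp_apply_eq_fderiv _ _ _
  -- an integrable bound for `|Δ(χ(ε_n ·) η) f|` that does not depend on `n`
  let b : R3 → ℝ := fun x => (C * ‖(Δ η) x‖ + 2 * ∑ i, C * ‖D i x‖ + C * ‖η x‖) * ‖f x‖
  have hb : Integrable b := by
    have hmul : ∀ ζ : 𝓢(R3, ℂ), Integrable (fun x => ‖ζ x‖ * ‖f x‖) := fun ζ =>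
      MemLp.integrable_mul (ζ.memLp 2).norm hf.norm
    have : b = fun x => C * (‖(Δ η) x‖ * ‖f x‖) + 2 * ∑ i, C * (‖D i x‖ * ‖f x‖)
        + C * (‖η x‖ * ‖f x‖) := by
      ext x
      simp only [b, Finset.mul_sum, Finset.sum_mul, add_mul]
      simp only [mul_assoc]
    rw [this]
    exact (((hmul _).const_mul C).add ((integrable_finsetSum _ fun i _ =>
      (hmul _).const_mul C).const_mul 2)).add ((hmul _).const_mul C)
  have hlim : Tendsto (fun n => ∫ x, Δ (fun x => a n x • η x) x • f x) atTop
      (𝓝 (∫ x, (Δ η) x • f x)) := by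
    refine tendsto_integral_of_dominated_convergence b ?_ hb ?_ ?_
    · intro n
      refine AEStronglyMeasurable.smul (𝕜 := ℂ) ?_ hf.1
      have := (Δ ((hcs n).toSchwartzMap ((ha n).smul hη))).continuous.aestronglyMeasurable
        (μ := (volume : Measure R3))
      refine this.congr (ae_of_all _ fun x => ?_)
      exact SchwartzMap.laplacian_apply _ x
    · intro n
      refine ae_of_all _ fun x => ?_
      rw [norm_smul]
      refine mul_le_mul_of_nonneg_right ?_ (norm_nonneg _)
      rw [laplacian_mul_smul (contDiff_two (ha n)) (contDiff_two hη),
        laplacian_comp_affine (contDiff_two hχ)]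
      have hs : |ε n| ≤ 1 := by rw [abs_of_pos (hε n)]; exact hε1 n
      refine (norm_add_le _ _).trans (add_le_add ((norm_add_le _ _).trans (add_le_add ?_ ?_)) ?_)
      · rw [norm_smul, hlap]
        exact mul_le_mul_of_nonneg_right (hC _).1 (norm_nonneg _)
      · rw [norm_smul, Real.norm_two]
        refine mul_le_mul_of_nonneg_left ((norm_sum_le _ _).trans
          (Finset.sum_le_sum fun i _ => ?_)) zero_le_two
        rw [norm_smul, hD, fderiv_comp_affine (hχ.differentiable (by simp)),
          smul_apply, norm_smul]
        refine mul_le_mul_of_nonneg_right ?_ (norm_nonneg _)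
        calc ‖ε n‖ * _ ≤ 1 * C := mul_le_mul hs ((hC _).2.1 i) (abs_nonneg _) zero_le_one
          _ = C := one_mul C
      · rw [norm_smul, norm_smul]
        refine mul_le_mul_of_nonneg_right ?_ (norm_nonneg _)
        calc ‖ε n ^ 2‖ * _ ≤ 1 * C := by
              refine mul_le_mul ?_ (hC _).2.2 (abs_nonneg _) zero_le_one
              rw [norm_pow]
              exact pow_le_one₀ (norm_nonneg _) hs
          _ = C := one_mul C
    · refine ae_of_all _ fun x => ?_
      refine tendsto_const_nhds.congr' ?_
      have ht : Tendsto (fun n => ε n • x) atTop (𝓝 0) := by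
        have : Tendsto (fun n => ε n • x) atTop (𝓝 ((0 : ℝ) • x)) :=
          (tendsto_one_div_add_atTop_nhds_zero_nat (𝕜 := ℝ)).smul_const x
        simpa using this
      -- `χ(ε_n ·) = 1` near `x` for large `n`
      filter_upwards [ht.eventually (Metric.ball_mem_nhds 0 one_pos)] with n hn
      rw [hlap]
      congr 1
      refine (InnerProductSpace.laplacian_congr_nhds ?_).eq_of_nhds
      have hc : ContinuousAt (fun y : R3 => ε n • y) x := by fun_prop
      filter_upwards [hc.eventually (Metric.isOpen_ball.mem_nhds hn)] with y hy
      have : a n y = 1 := by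
        simp only [a, add_zero]
        exact χ.one_of_mem_closedBall (Metric.ball_subset_closedBall hy)
      rw [this, one_smul]
  exact tendsto_nhds_unique hlim (by simp only [hint]; exact tendsto_const_nhds)

/-- Liouville's theorem for square integrable functions: such a function which is harmonic in the
sense of distributions vanishes. Real and imaginary parts of complex test functions are treated
separately. -/
theorem ae_eq_zero_of_integral_laplacian {f : R3 → ℝ} (hf : MemLp f 2)
    (h : ∀ ψ : R3 → ℝ, ContDiff ℝ ∞ ψ → HasCompactSupport ψ → ∫ x, Δ ψ x * f x = 0) :
    f =ᵐ[volume] 0 := by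
  have hfC : MemLp (fun x => (f x : ℂ)) 2 := hf.ofReal
  have key : hfC.toLp = 0 := by
    refine ae_eq_zero_of_integral_laplacian_schwartz _ fun η => ?_
    rw [← integral_laplacian_schwartz_eq_zero hfC ?_ η]
    · refine integral_congr_ae ?_
      filter_upwards [hfC.coeFn_toLp] with x hx
      rw [hx]
    · intro ψ h1 h2
      have hcont : Continuous (Δ ψ) := by
        have := (Δ (h2.toSchwartzMap h1)).continuous
        refine this.congr fun x => ?_
        exact SchwartzMap.laplacian_apply _ x
      have hmem : MemLp (Δ ψ) 2 (volume : Measure R3) := by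
        refine ((Δ (h2.toSchwartzMap h1)).memLp 2).ae_eq (ae_of_all _ fun x => ?_)
        exact SchwartzMap.laplacian_apply _ x
      have hi : Integrable (fun x => Δ ψ x • (f x : ℂ)) := hmem.integrable_mul hfC
      have hre := h (fun x => (ψ x).re) (Complex.reCLM.contDiff.comp h1)
        (h2.comp_left (g := Complex.re) rfl)
      have him := h (fun x => (ψ x).im) (Complex.imCLM.contDiff.comp h1)
        (h2.comp_left (g := Complex.im) rfl)
      have hre' : ∀ x, Δ (fun x => (ψ x).re) x = (Δ ψ x).re := fun x =>
        (contDiff_two h1).contDiffAt.laplacian_CLM_comp_left (l := Complex.reCLM)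
      have him' : ∀ x, Δ (fun x => (ψ x).im) x = (Δ ψ x).im := fun x =>
        (contDiff_two h1).contDiffAt.laplacian_CLM_comp_left (l := Complex.imCLM)
      apply Complex.ext
      · rw [← Complex.reCLM_apply, ← ContinuousLinearMap.integral_comp_comm _ hi, Complex.zero_re,
          ← hre]
        refine integral_congr_ae (ae_of_all _ fun x => ?_)
        beta_reduce
        rw [hre', Complex.reCLM_apply, smul_eq_mul, Complex.re_mul_ofReal]
      · rw [← Complex.imCLM_apply, ← ContinuousLinearMap.integral_comp_comm _ hi, Complex.zero_im,
          ← him]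
        refine integral_congr_ae (ae_of_all _ fun x => ?_)
        beta_reduce
        rw [him', Complex.imCLM_apply, smul_eq_mul, Complex.im_mul_ofReal]
  have h1 := hfC.coeFn_toLp
  rw [key] at h1
  filter_upwards [h1, Lp.coeFn_zero ℂ 2 (volume : Measure R3)] with x hx hx0
  rw [hx0] at hx
  simpa using hx.symm

/-! ### Solenoidal test fields -/

/-- The partial derivative `∂_i f`. -/
def pderiv {F : Type*} [NormedAddCommGroup F] [NormedSpace ℝ F] (i : Fin 3) (f : R3 → F) : R3 → F :=
  fun x => fderiv ℝ f x (EuclideanSpace.single i 1)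

section PartialDerivatives

variable {F : Type*} [NormedAddCommGroup F] [NormedSpace ℝ F] {f g : R3 → F}

theorem contDiff_pderiv (hf : ContDiff ℝ ∞ f) (i : Fin 3) : ContDiff ℝ ∞ (pderiv i f) :=
  (hf.fderiv_right (m := ∞) (by simp)).clm_apply contDiff_const

theorem hasCompactSupport_pderiv (hf : HasCompactSupport f) (i : Fin 3) :
    HasCompactSupport (pderiv i f) := hf.fderiv_apply ℝ _

theorem pderiv_comm (hf : ContDiff ℝ ∞ f) (i j : Fin 3) :
    pderiv i (pderiv j f) = pderiv j (pderiv i f) := by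
  ext1 x
  have hd : DifferentiableAt ℝ (fderiv ℝ f) x :=
    ((hf.fderiv_right (m := ∞) (by simp)).differentiable (by simp)).differentiableAt
  have h : ∀ k l, pderiv k (pderiv l f) x =
      fderiv ℝ (fderiv ℝ f) x (EuclideanSpace.single k 1) (EuclideanSpace.single l 1) := by
    intro k l
    change fderiv ℝ (fun y => fderiv ℝ f y (EuclideanSpace.single l 1)) x _ = _
    rw [fderiv_clm_apply hd (differentiableAt_const _)]
    simp
  rw [h, h]
  exact ((contDiff_two hf).contDiffAt.isSymmSndFDerivAt (by simp)).eq _ _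

theorem laplacian_eq_sum_pderiv (hf : ContDiff ℝ ∞ f) :
    Δ f = fun x => ∑ i, pderiv i (pderiv i f) x :=
  funext fun x => laplacian_eq_sum_fderiv (contDiff_two hf) x

theorem contDiff_laplacian (hf : ContDiff ℝ ∞ f) : ContDiff ℝ ∞ (Δ f) := by
  rw [laplacian_eq_sum_pderiv hf]
  exact ContDiff.sum fun i _ => contDiff_pderiv (contDiff_pderiv hf i) i

theorem hasCompactSupport_laplacian (hf : HasCompactSupport f) : HasCompactSupport (Δ f) := by
  refine hf.mono' fun x hx => ?_
  by_contra h
  refine hx ?_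
  have h0 : f =ᶠ[𝓝 x] fun _ => 0 := notMem_tsupport_iff_eventuallyEq.1 h
  rw [(InnerProductSpace.laplacian_congr_nhds h0).eq_of_nhds]
  simp

theorem fderiv_apply_eq_sum_pderiv (f : R3 → F) (x v : R3) :
    fderiv ℝ f x v = ∑ i, v i • pderiv i f x := by
  conv_lhs => rw [← (EuclideanSpace.basisFun (Fin 3) ℝ).sum_repr v]
  rw [map_sum]
  simp [pderiv]

end PartialDerivatives

/-- The double curl `∇ ∂_i ψ - Δψ e_i` of the field `ψ e_i`. -/
def doubleCurl (i : Fin 3) (ψ : R3 → ℝ) (x : R3) : R3 :=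
  (∑ k, pderiv k (pderiv i ψ) x • EuclideanSpace.single k (1 : ℝ)) -
    Δ ψ x • EuclideanSpace.single i (1 : ℝ)

theorem contDiff_doubleCurl {ψ : R3 → ℝ} (hψ : ContDiff ℝ ∞ ψ) (i : Fin 3) :
    ContDiff ℝ ∞ (doubleCurl i ψ) :=
  (ContDiff.sum fun k _ => (contDiff_pderiv (contDiff_pderiv hψ i) k).smul contDiff_const).sub
    ((contDiff_laplacian hψ).smul contDiff_const)

theorem hasCompactSupport_doubleCurl {ψ : R3 → ℝ} (hψ : HasCompactSupport ψ) (i : Fin 3) :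
    HasCompactSupport (doubleCurl i ψ) := by
  refine hψ.mono' fun x hx => ?_
  by_contra h
  refine hx ?_
  have h1 : ∀ k, pderiv k (pderiv i ψ) x = 0 := fun k => by
    by_contra h2
    refine h ?_
    refine (tsupport_fderiv_apply_subset ℝ _) ((tsupport_fderiv_apply_subset ℝ
      (EuclideanSpace.single k (1 : ℝ))) (subset_tsupport _ h2))
  have h0 : ψ =ᶠ[𝓝 x] fun _ => 0 := notMem_tsupport_iff_eventuallyEq.1 h
  have h3 : Δ ψ x = 0 := by
    rw [(InnerProductSpace.laplacian_congr_nhds h0).eq_of_nhds]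
    simp
  simp [doubleCurl, h1, h3]

theorem divergence_eq_sum_pderiv {f : R3 → R3} (hf : ContDiff ℝ ∞ f) (x : R3) :
    divergence f x = ∑ i, pderiv i (fun y => f y i) x := by
  refine Finset.sum_congr rfl fun i _ => ?_
  have hd : DifferentiableAt ℝ f x := (hf.differentiable (by simp)).differentiableAt
  have := ((EuclideanSpace.proj i : R3 →L[ℝ] ℝ).hasFDerivAt.comp x hd.hasFDerivAt).fderiv
  have h2 : (fun y => f y i) = (EuclideanSpace.proj i : R3 →L[ℝ] ℝ) ∘ f := rfl
  rw [pderiv, h2, this]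
  rfl

theorem doubleCurl_apply (i : Fin 3) (ψ : R3 → ℝ) (x : R3) (k : Fin 3) :
    doubleCurl i ψ x k = pderiv k (pderiv i ψ) x - if k = i then Δ ψ x else 0 := by
  simp [doubleCurl, Finset.sum_apply, Pi.single_apply]

theorem divergence_doubleCurl {ψ : R3 → ℝ} (hψ : ContDiff ℝ ∞ ψ) (i : Fin 3) (x : R3) :
    divergence (doubleCurl i ψ) x = 0 := by
  rw [divergence_eq_sum_pderiv (contDiff_doubleCurl hψ i)]
  have hc : ∀ k, ContDiff ℝ ∞ (pderiv k ψ) := contDiff_pderiv hψ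
  have h1 : ∀ k, pderiv k (fun y => doubleCurl i ψ y k) x =
      pderiv k (pderiv k (pderiv i ψ)) x - if k = i then pderiv i (Δ ψ) x else 0 := by
    intro k
    simp only [doubleCurl_apply]
    have hd : DifferentiableAt ℝ (pderiv k (pderiv i ψ)) x :=
      ((contDiff_pderiv (hc i) k).differentiable (by simp)).differentiableAt
    by_cases h : k = i
    · subst h
      simp only [if_true]
      have hd' : DifferentiableAt ℝ (Δ ψ) x :=
        ((contDiff_laplacian hψ).differentiable (by simp)).differentiableAt
      rw [pderiv, fderiv_fun_sub hd hd']
      rfl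
    · simp [h]
  have h2 : pderiv i (Δ ψ) x = ∑ k, pderiv k (pderiv k (pderiv i ψ)) x := by
    rw [laplacian_eq_sum_pderiv hψ, pderiv, fderiv_fun_sum fun k _ =>
      ((contDiff_pderiv (hc k) k).differentiable (by simp)).differentiableAt,
      sum_apply]
    refine Finset.sum_congr rfl fun k _ => ?_
    change pderiv i (pderiv k (pderiv k ψ)) x = _
    rw [pderiv_comm (hc k), pderiv_comm hψ i k]
  simp only [h1, Finset.sum_sub_distrib, Finset.sum_ite_eq', Finset.mem_univ, if_true]
  rw [h2, sub_self]

theorem inner_doubleCurl (i : Fin 3) (ψ : R3 → ℝ) (x v : R3) :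
    inner ℝ v (doubleCurl i ψ x) = fderiv ℝ (pderiv i ψ) x v - Δ ψ x * v i := by
  rw [PiLp.inner_apply, fderiv_apply_eq_sum_pderiv]
  simp [doubleCurl_apply, sub_mul, Finset.sum_sub_distrib]
  exact Finset.sum_congr rfl fun _ _ => mul_comm _ _

/-- A smooth compactly supported solenoidal field on `ℝ³`. -/
structure IsSolenoidalTest (φ : R3 → R3) : Prop where
  smooth : ContDiff ℝ ∞ φ
  compact : HasCompactSupport φ
  div : ∀ x, divergence φ x = 0

/-- A field in `L²_σ` that is orthogonal to all solenoidal test fields vanishes: testing with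
double curls shows that its components are harmonic. -/
theorem ae_eq_zero_of_orthogonal_solenoidal {f : R3 → R3} (hf : MemLp f 2) (hdiv : IsDivFree f)
    (h : ∀ φ, IsSolenoidalTest φ → ∫ x, inner ℝ (f x) (φ x) = 0) : f =ᵐ[volume] 0 := by
  have hcomp : ∀ i, MemLp (fun x => f x i) 2 := fun i =>
    (EuclideanSpace.proj i : R3 →L[ℝ] ℝ).comp_memLp' hf
  have hi : ∀ i, (fun x => f x i) =ᵐ[volume] 0 := by
    intro i
    refine ae_eq_zero_of_integral_laplacian (hcomp i) fun ψ h1 h2 => ?_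
    have h3 := h _ ⟨contDiff_doubleCurl h1 i, hasCompactSupport_doubleCurl h2 i,
      divergence_doubleCurl h1 i⟩
    simp only [inner_doubleCurl] at h3
    have hp := contDiff_pderiv h1 i
    have hpc := hasCompactSupport_pderiv h2 i
    have hm : MemLp (fderiv ℝ (pderiv i ψ)) 2 (volume : Measure R3) :=
      (hp.continuous_fderiv (by simp)).memLp_of_hasCompactSupport (hpc.fderiv ℝ)
    have hi1 : Integrable (fun x => fderiv ℝ (pderiv i ψ) x (f x)) :=
      memLp_one_iff_integrable.1
        ((ContinuousLinearMap.id ℝ (R3 →L[ℝ] ℝ)).memLp_of_bilin 1 hm hf)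
    have hi2 : Integrable (fun x => Δ ψ x * f x i) :=
      ((contDiff_laplacian h1).continuous.memLp_of_hasCompactSupport (p := 2)
        (hasCompactSupport_laplacian h2)).integrable_mul (hcomp i)
    rw [integral_sub hi1 hi2, hdiv _ hp hpc, zero_sub, neg_eq_zero] at h3
    exact h3
  filter_upwards [ae_all_iff.2 hi] with x hx
  ext i
  exact hx i

/-! ### Evolution of the moments of a weak solution -/

instance : SigmaFinite timeMeasure := by unfold timeMeasure; infer_instance

instance : IsLocallyFiniteMeasure timeMeasure := by unfold timeMeasure; infer_instance

instance : SigmaFinite spaceTimeMeasure := by unfold spaceTimeMeasure; infer_instance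

instance : IsLocallyFiniteMeasure spaceTimeMeasure := by unfold spaceTimeMeasure; infer_instance

/-- Exchange of the order of integration behind an integration by parts against the primitive
`s ↦ ∫₀ˢ H`. -/
theorem integral_mul_primitive {η H : ℝ → ℝ} (hη : Continuous η) (hηc : HasCompactSupport η)
    (hH : LocallyIntegrable H timeMeasure) {b : ℝ} (hb : ∀ t, b ≤ t → η t = 0) :
    ∫ s in Ioi (0 : ℝ), η s * ∫ τ in (0 : ℝ)..s, H τ =
      ∫ τ in Ioi (0 : ℝ), (∫ s in Ioi τ, η s) * H τ := by
  have hηi : Integrable η timeMeasure :=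
    (hη.integrable_of_hasCompactSupport hηc).mono_measure Measure.restrict_le_self
  have hHi : Integrable ((Icc 0 b).indicator H) timeMeasure :=
    (hH.integrableOn_isCompact isCompact_Icc).integrable_indicator measurableSet_Icc
  let G : ℝ × ℝ → ℝ := {p : ℝ × ℝ | p.2 < p.1}.indicator
    fun p => η p.1 * (Icc 0 b).indicator H p.2
  have hG : Integrable G (timeMeasure.prod timeMeasure) :=
    (hηi.mul_prod hHi).indicator (measurableSet_lt measurable_snd measurable_fst)
  have hswap := integral_integral_swap (f := fun s τ => G (s, τ)) hG
  have hmem : ∀ᵐ s ∂timeMeasure, s ∈ Ioi (0 : ℝ) := ae_restrict_mem measurableSet_Ioi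
  have h1 : ∫ s, ∫ τ, G (s, τ) ∂timeMeasure ∂timeMeasure =
      ∫ s in Ioi (0 : ℝ), η s * ∫ τ in (0 : ℝ)..s, H τ := by
    refine integral_congr_ae ?_
    filter_upwards [hmem] with s hs
    have hs0 : (0 : ℝ) < s := hs
    by_cases hsb : b ≤ s
    · simp [G, indicator, hb s hsb]
    push Not at hsb
    rw [intervalIntegral.integral_of_le hs0.le, ← integral_const_mul, integral_Ioc_eq_integral_Ioo,
      timeMeasure, ← integral_indicator measurableSet_Ioi, ← integral_indicator measurableSet_Ioo]
    refine integral_congr_ae (ae_of_all _ fun τ => ?_)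
    by_cases h0 : 0 < τ <;> by_cases h1 : τ < s
    · simp [G, indicator, h0, h1, h0.le, (h1.trans hsb).le]
    · simp [G, indicator, h1]
    · simp [indicator, h0]
    · simp [indicator, h0]
  have h2 : ∫ τ, ∫ s, G (s, τ) ∂timeMeasure ∂timeMeasure =
      ∫ τ in Ioi (0 : ℝ), (∫ s in Ioi τ, η s) * H τ := by
    refine integral_congr_ae ?_
    filter_upwards [hmem] with τ hτ
    have hτ0 : (0 : ℝ) < τ := hτ
    rw [← integral_mul_const, timeMeasure, ← integral_indicator measurableSet_Ioi,
      ← integral_indicator measurableSet_Ioi]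
    refine integral_congr_ae (ae_of_all _ fun s => ?_)
    by_cases h1 : τ < s
    · by_cases hsb : b ≤ s
      · simp [G, indicator, hb s hsb]
      · push Not at hsb
        simp [G, indicator, h1, hτ0.trans h1, hτ0.le, (h1.trans hsb).le]
    · simp [G, indicator, h1]
  rw [← h1, ← h2, hswap]

theorem intervalIntegrable_indicator {H : ℝ → ℝ} (hH : LocallyIntegrable H timeMeasure) (a b : ℝ) :
    IntervalIntegrable ((Ioi 0).indicator H) volume a b := by
  rw [intervalIntegrable_iff]
  have h1 := hH.integrableOn_isCompact (isCompact_uIcc (a := a) (b := b))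
  refine IntegrableOn.mono_set ?_ uIoc_subset_uIcc
  rw [IntegrableOn, integrable_indicator_iff measurableSet_Ioi, IntegrableOn,
    Measure.restrict_restrict measurableSet_Ioi]
  rwa [IntegrableOn, timeMeasure, Measure.restrict_restrict measurableSet_uIcc, inter_comm] at h1

theorem integral_indicator_Ioi_eq {H : ℝ → ℝ} {a b : ℝ} (ha : 0 ≤ a) (hb : 0 ≤ b) :
    ∫ τ in a..b, (Ioi 0).indicator H τ = ∫ τ in a..b, H τ := by
  refine intervalIntegral.integral_congr_ae (ae_of_all _ fun τ hτ => ?_)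
  have : 0 < τ := (le_min ha hb).trans_lt hτ.1
  simp [indicator, this]

theorem locallyIntegrable_primitive {H : ℝ → ℝ} (hH : LocallyIntegrable H timeMeasure) :
    LocallyIntegrable (fun s => ∫ τ in (0 : ℝ)..s, H τ) timeMeasure := by
  have hc : Continuous fun s => ∫ τ in (0 : ℝ)..s, (Ioi 0).indicator H τ :=
    intervalIntegral.continuous_primitive (fun a b => intervalIntegrable_indicator hH a b) 0
  intro x
  obtain ⟨s, hs, hi⟩ := hc.locallyIntegrable (μ := timeMeasure) x
  refine ⟨s, hs, hi.congr_fun_ae (ae_restrict_of_ae ?_)⟩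
  filter_upwards [ae_restrict_mem measurableSet_Ioi] with t ht
  exact integral_indicator_Ioi_eq le_rfl (le_of_lt ht)

/-- If `F' = H` on `(0, ∞)` and `F(0) = c` in the sense of distributions, then `F` is almost
everywhere equal to the primitive of `H` with initial value `c`. A test function `η` of the
conclusion is the derivative of the function `θ(t) = -∫ₜ^∞ η`, which is admissible in the hypothesis
after a cut-off at negative times. -/
theorem ae_eq_add_integral_of_weak_ode {F H : ℝ → ℝ} {c : ℝ}
    (hF : LocallyIntegrable F timeMeasure) (hH : LocallyIntegrable H timeMeasure)
    (h : ∀ θ : ℝ → ℝ, ContDiff ℝ ∞ θ → HasCompactSupport θ →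
      ∫ t in Ioi (0 : ℝ), (deriv θ t * F t + θ t * H t) = -(θ 0 * c)) :
    ∀ᵐ s ∂timeMeasure, F s = c + ∫ τ in (0 : ℝ)..s, H τ := by
  have hL : LocallyIntegrable (fun s => ∫ τ in (0 : ℝ)..s, H τ) timeMeasure :=
    locallyIntegrable_primitive hH
  have key : ∀ᵐ s ∂timeMeasure, F s - c - ∫ τ in (0 : ℝ)..s, H τ = 0 := by
    refine ae_eq_zero_of_integral_contDiff_smul_eq_zero
      ((hF.sub (locallyIntegrable_const c)).sub hL) fun η hη hηc => ?_
    obtain ⟨b, hb0, hb⟩ : ∃ b : ℝ, 0 < b ∧ ∀ t, b ≤ |t| → η t = 0 := by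
      obtain ⟨R, hR⟩ := hηc.isCompact.isBounded.subset_ball 0
      refine ⟨max R 1, by positivity, fun t ht => ?_⟩
      by_contra hne
      have := hR (subset_tsupport _ hne)
      rw [Metric.mem_ball, dist_zero_right, Real.norm_eq_abs] at this
      exact absurd this (not_lt.2 ((le_max_left _ _).trans ht))
    have hηcont := hη.continuous
    have hηint : Integrable η := hηcont.integrable_of_hasCompactSupport hηc
    have hηi : Integrable η timeMeasure := hηint.mono_measure Measure.restrict_le_self
    set I := ∫ s in Ioi (0 : ℝ), η s with hI
    let P : ℝ → ℝ := fun t => ∫ s in (0 : ℝ)..t, η s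
    have hPd : ∀ t, HasDerivAt P (η t) t :=
      fun t => hηcont.integral_hasStrictDerivAt 0 t |>.hasDerivAt
    have hP : ContDiff ℝ ∞ P := by
      rw [contDiff_infty_iff_deriv]
      refine ⟨fun t => (hPd t).differentiableAt, ?_⟩
      rwa [show deriv P = η from funext fun t => (hPd t).deriv]
    have hPI : ∀ t, ∫ s in Ioi t, η s = I - P t := by
      intro t
      rw [hI, eq_sub_iff_add_eq, add_comm]
      exact intervalIntegral.integral_interval_add_Ioi hηint.integrableOn hηint.integrableOn
    have hPb : ∀ t, b ≤ t → P t - I = 0 := by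
      intro t ht
      rw [← neg_sub, ← hPI, neg_eq_zero]
      refine setIntegral_eq_zero_of_forall_eq_zero fun s hs => hb s ?_
      exact (ht.trans (le_of_lt hs)).trans (le_abs_self s)
    -- `χ = 1` where `P - I` does not vanish on `(0, ∞)`, so that `θ = P - I` there
    let χ : ContDiffBump (0 : ℝ) := ⟨b + 1, b + 2, by positivity, by linarith⟩
    let θ : ℝ → ℝ := fun t => χ t * (P t - I)
    have hθ : ContDiff ℝ ∞ θ := χ.contDiff.mul (hP.sub contDiff_const)
    have hθc : HasCompactSupport θ := χ.hasCompactSupport.mul_right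
    have hθpos : ∀ t, 0 < t → θ t = P t - I := by
      intro t ht
      by_cases htb : b ≤ t
      · simp only [θ]; rw [hPb t htb, mul_zero]
      · have : χ t = 1 := χ.one_of_mem_closedBall (by
          rw [Metric.mem_closedBall, dist_zero_right, Real.norm_eq_abs, abs_of_pos ht]
          change t ≤ b + 1
          linarith)
        simp only [θ]; rw [this, one_mul]
    have hθ0 : θ 0 = -I := by
      have : χ 0 = 1 := χ.one_of_mem_closedBall (by
          rw [Metric.mem_closedBall, dist_self]
          exact χ.rIn_pos.le)
      simp only [θ]; rw [this, one_mul]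
      simp [P]
    have hθd : ∀ t, 0 < t → deriv θ t = η t := by
      intro t ht
      have : θ =ᶠ[𝓝 t] fun t => P t - I := by
        filter_upwards [lt_mem_nhds ht] with s hs using hθpos s hs
      rw [this.deriv_eq]
      exact ((hPd t).sub_const I).deriv
    have hmain := h θ hθ hθc
    have hmem : ∀ᵐ s ∂timeMeasure, s ∈ Ioi (0 : ℝ) := ae_restrict_mem measurableSet_Ioi
    have iF : Integrable (fun t => η t * F t) timeMeasure :=
      hF.integrable_smul_left_of_hasCompactSupport hηcont hηc
    have iH : Integrable (fun t => θ t * H t) timeMeasure :=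
      hH.integrable_smul_left_of_hasCompactSupport hθ.continuous hθc
    have iL : Integrable (fun s => η s * ∫ τ in (0 : ℝ)..s, H τ) timeMeasure :=
      hL.integrable_smul_left_of_hasCompactSupport hηcont hηc
    have e1 : ∫ t in Ioi (0 : ℝ), (deriv θ t * F t + θ t * H t) =
        (∫ t, η t * F t ∂timeMeasure) + ∫ t, θ t * H t ∂timeMeasure := by
      rw [← integral_add iF iH]
      refine integral_congr_ae ?_
      filter_upwards [hmem] with t ht
      rw [hθd t ht]
    have e2 := integral_mul_primitive hηcont hηc hH (b := b)
      fun t ht => hb t (ht.trans (le_abs_self t))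
    have e3 : ∫ τ in Ioi (0 : ℝ), (∫ s in Ioi τ, η s) * H τ = -∫ t, θ t * H t ∂timeMeasure := by
      rw [← integral_neg]
      refine integral_congr_ae ?_
      filter_upwards [hmem] with t ht
      rw [hθpos t ht, hPI]
      ring
    have e4 : ∀ s, η s • (F s - c - ∫ τ in (0 : ℝ)..s, H τ) =
        (η s * F s - η s * c) - η s * ∫ τ in (0 : ℝ)..s, H τ := fun s => by
      simp only [smul_eq_mul]; ring
    simp only [e4]
    have iFc : Integrable (fun t => η t * F t - η t * c) timeMeasure := iF.sub (hηi.mul_const c)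
    rw [integral_sub iFc iL, integral_sub iF (hηi.mul_const c),
      integral_mul_const]
    change _ - _ * c - ∫ s in Ioi (0 : ℝ), _ = 0
    rw [e2, e3]
    rw [e1, hθ0] at hmain
    change _ - I * c - _ = 0
    linarith
  filter_upwards [key] with s hs
  linarith

/-- The `L²` pairing of two vector fields. -/
def pairing (v φ : R3 → R3) : ℝ := ∫ x, inner ℝ (v x) (φ x)

/-- The rate of change `∫ (v · νΔφ + v ⊗ v : ∇φ)` of `∫ v · φ` in the Navier-Stokes flow. -/
def flux (ν : ℝ) (φ v : R3 → R3) : ℝ :=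
  ∫ x, (inner ℝ (v x) (ν • Δ φ x) + inner ℝ (v x) (fderiv ℝ φ x (v x)))

section L2Bounds

variable {α : Type*} [MeasurableSpace α] {μ : Measure α}

theorem integrable_inner_of_memLp {v w : α → R3} (hv : MemLp v 2 μ) (hw : MemLp w 2 μ) :
    Integrable (fun x => inner ℝ (v x) (w x)) μ := by
  refine (L2.integrable_inner (𝕜 := ℝ) hv.toLp hw.toLp).congr ?_
  filter_upwards [hv.coeFn_toLp, hw.coeFn_toLp] with x h1 h2
  rw [h1, h2]

theorem integral_inner_eq_inner_toLp {E : Type*} [NormedAddCommGroup E] [InnerProductSpace ℝ E]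
    {v w : α → E} (hv : MemLp v 2 μ) (hw : MemLp w 2 μ) :
    ∫ x, inner ℝ (v x) (w x) ∂μ = inner ℝ (hv.toLp v) (hw.toLp w) := by
  rw [L2.inner_def]
  refine integral_congr_ae ?_
  filter_upwards [hv.coeFn_toLp, hw.coeFn_toLp] with x h1 h2
  rw [h1, h2]

theorem abs_integral_inner_le {v w : α → R3} {a b : ℝ≥0} (hv : MemLp v 2 μ) (hw : MemLp w 2 μ)
    (ha : eLpNorm v 2 μ ≤ a) (hb : eLpNorm w 2 μ ≤ b) :
    |∫ x, inner ℝ (v x) (w x) ∂μ| ≤ a * b := by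
  rw [integral_inner_eq_inner_toLp hv hw]
  refine (abs_real_inner_le_norm _ _).trans ?_
  rw [Lp.norm_toLp, Lp.norm_toLp]
  refine mul_le_mul ?_ ?_ ENNReal.toReal_nonneg a.2
  · exact ENNReal.toReal_le_coe_of_le_coe ha
  · exact ENNReal.toReal_le_coe_of_le_coe hb

theorem memLp_clm_apply [TopologicalSpace α] [OpensMeasurableSpace α] {A : α → R3 →L[ℝ] R3}
    (hA : AEStronglyMeasurable A μ) {C : ℝ≥0}
    (hC : ∀ x, ‖A x‖ ≤ C) {w : α → R3} (hw : MemLp w 2 μ) :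
    MemLp (fun x => A x (w x)) 2 μ ∧ eLpNorm (fun x => A x (w x)) 2 μ ≤ C * eLpNorm w 2 μ := by
  have hle : ∀ x, ‖A x (w x)‖ ≤ C * ‖w x‖ := fun x =>
    (A x).le_of_opNorm_le (hC x) _
  refine ⟨hw.of_le_mul (c := C) ?_ (ae_of_all _ hle), ?_⟩
  · exact (ContinuousLinearMap.id ℝ (R3 →L[ℝ] R3)).aestronglyMeasurable_comp₂ hA hw.1
  · have := eLpNorm_le_nnreal_smul_eLpNorm_of_ae_le_mul (p := 2) (c := C) (f := fun x => A x (w x))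
      (g := w) (μ := μ) (ae_of_all _ fun x => by exact_mod_cast hle x)
    simpa [ENNReal.smul_def] using this

end L2Bounds

theorem MemTimeL2.ae_memLp {u : ℝ → R3 → R3} (hu : MemTimeL2 ⊤ u) {M : ℝ≥0}
    (hM : timeL2Norm ⊤ u ≤ M) :
    ∀ᵐ t ∂timeMeasure, MemLp (u t) 2 ∧ eLpNorm (u t) 2 volume ≤ M := by
  have h1 := hu.1.prodMk_left
  have h2 : ∀ᵐ t ∂timeMeasure, eLpNorm (u t) 2 volume ≤ timeL2Norm ⊤ u := by
    have := ae_le_essSup (f := fun t => eLpNorm (u t) 2 volume) (μ := timeMeasure)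
    rw [timeL2Norm, eLpNorm_exponent_top]
    exact this
  filter_upwards [h1, h2] with t ht1 ht2
  exact ⟨⟨ht1, (ht2.trans hM).trans_lt ENNReal.coe_lt_top⟩, ht2.trans hM⟩

/-- The bound of the flux in terms of the viscosity, the test field and the `L²` norm. -/
theorem exists_flux_bound {φ : R3 → R3} (hφ : IsSolenoidalTest φ) (V : ℝ≥0) (M : ℝ≥0) :
    ∃ K : ℝ, 0 ≤ K ∧ ∀ ν : ℝ, 0 ≤ ν → ν ≤ V → ∀ v : R3 → R3, MemLp v 2 → eLpNorm v 2 volume ≤ M →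
      |flux ν φ v| ≤ K := by
  have hΔ : MemLp (Δ φ) 2 := (contDiff_laplacian hφ.smooth).continuous.memLp_of_hasCompactSupport
    (hasCompactSupport_laplacian hφ.compact)
  obtain ⟨C, hC⟩ := (hφ.smooth.continuous_fderiv (by simp)).bounded_above_of_compact_support
    (hφ.compact.fderiv ℝ)
  have hC' : ∀ x, ‖fderiv ℝ φ x‖ ≤ C.toNNReal := fun x => (hC x).trans (Real.le_coe_toNNReal C)
  set L : ℝ≥0 := (eLpNorm (Δ φ) 2 volume).toNNReal
  have hL : eLpNorm (Δ φ) 2 volume = L := (ENNReal.coe_toNNReal hΔ.2.ne).symm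
  refine ⟨V * (M * L) + M * (C.toNNReal * M), by positivity, fun ν hν hνV v hv hM => ?_⟩
  have hA := memLp_clm_apply (hφ.smooth.continuous_fderiv (by simp)).aestronglyMeasurable hC' hv
  have i1 : Integrable fun x => inner ℝ (v x) (Δ φ x) := integrable_inner_of_memLp hv hΔ
  have i2 : Integrable fun x => inner ℝ (v x) (fderiv ℝ φ x (v x)) :=
    integrable_inner_of_memLp hv hA.1
  have e : flux ν φ v = ν * (∫ x, inner ℝ (v x) (Δ φ x)) +
      ∫ x, inner ℝ (v x) (fderiv ℝ φ x (v x)) := by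
    rw [flux, ← integral_const_mul, ← integral_add (i1.const_mul ν) i2]
    simp only [inner_smul_right]
  rw [e]
  refine (abs_add_le _ _).trans (add_le_add ?_ ?_)
  · rw [abs_mul, abs_of_nonneg hν]
    exact mul_le_mul hνV (abs_integral_inner_le hv hΔ hM hL.le) (abs_nonneg _) V.2
  · have := abs_integral_inner_le (b := C.toNNReal * M) hv hA.1 hM (hA.2.trans (by
      rw [ENNReal.coe_mul]; gcongr))
    simpa using this

theorem locallyIntegrable_of_ae_bound {F : ℝ → ℝ} (hF : AEStronglyMeasurable F timeMeasure) {K : ℝ}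
    (hK : ∀ᵐ t ∂timeMeasure, |F t| ≤ K) : LocallyIntegrable F timeMeasure :=
  (locallyIntegrable_const K).mono hF (by
    filter_upwards [hK] with t ht
    exact (ht.trans (le_abs_self K)))

theorem aestronglyMeasurable_pairing {u : ℝ → R3 → R3}
    (hu : AEStronglyMeasurable (Function.uncurry u) spaceTimeMeasure) {φ : ℝ × R3 → R3}
    (hφ : AEStronglyMeasurable φ spaceTimeMeasure) :
    AEStronglyMeasurable (fun t => ∫ x, inner ℝ (u t x) (φ (t, x))) timeMeasure :=
  AEStronglyMeasurable.integral_prod_right' (f := fun p => inner ℝ (Function.uncurry u p) (φ p))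
    (hu.inner hφ)

theorem aestronglyMeasurable_flux {u : ℝ → R3 → R3}
    (hu : AEStronglyMeasurable (Function.uncurry u) spaceTimeMeasure) {φ : R3 → R3}
    (hφ : ContDiff ℝ ∞ φ) (ν : ℝ) :
    AEStronglyMeasurable (fun t => flux ν φ (u t)) timeMeasure := by
  have h1 : Continuous fun p : ℝ × R3 => ν • Δ φ p.2 :=
    ((contDiff_laplacian hφ).continuous.comp continuous_snd).const_smul ν
  have h2 : Continuous fun p : ℝ × R3 => fderiv ℝ φ p.2 :=
    (hφ.continuous_fderiv (by simp)).comp continuous_snd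
  exact AEStronglyMeasurable.integral_prod_right' (f := fun p : ℝ × R3 =>
    inner ℝ (Function.uncurry u p) (ν • Δ φ p.2)
      + inner ℝ (Function.uncurry u p) (fderiv ℝ φ p.2 (Function.uncurry u p)))
    ((hu.inner h1.aestronglyMeasurable).add (hu.inner
      ((ContinuousLinearMap.id ℝ (R3 →L[ℝ] R3)).aestronglyMeasurable_comp₂
        h2.aestronglyMeasurable hu)))

/-- The weak form of the equations gives the evolution of the moments `∫ u(t) · φ` against
stationary solenoidal test fields. -/
theorem IsWeakSolution.pairing_eq {ν : ℝ} {f : R3 → R3} {u : ℝ → R3 → R3} (hν : 0 ≤ ν)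
    (hu : IsWeakSolution ν f u) {φ : R3 → R3} (hφ : IsSolenoidalTest φ) :
    ∀ᵐ s ∂timeMeasure, pairing (u s) φ = pairing f φ + ∫ τ in (0 : ℝ)..s, flux ν φ (u τ) := by
  set M := (timeL2Norm ⊤ u).toNNReal
  have hM : timeL2Norm ⊤ u = M := (ENNReal.coe_toNNReal hu.memL2.2.ne).symm
  have hae := hu.memL2.ae_memLp hM.le
  have hφ2 : MemLp φ 2 := hφ.smooth.continuous.memLp_of_hasCompactSupport hφ.compact
  have hΔ : MemLp (Δ φ) 2 := (contDiff_laplacian hφ.smooth).continuous.memLp_of_hasCompactSupport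
    (hasCompactSupport_laplacian hφ.compact)
  obtain ⟨C, hC⟩ := (hφ.smooth.continuous_fderiv (by simp)).bounded_above_of_compact_support
    (hφ.compact.fderiv ℝ)
  have hC' : ∀ x, ‖fderiv ℝ φ x‖ ≤ C.toNNReal := fun x => (hC x).trans (Real.le_coe_toNNReal C)
  obtain ⟨K, -, hK⟩ := exists_flux_bound hφ ν.toNNReal M
  refine ae_eq_add_integral_of_weak_ode ?_ ?_ fun θ hθ hθc => ?_
  · refine locallyIntegrable_of_ae_bound (K := M * (eLpNorm φ 2 volume).toNNReal)
      (aestronglyMeasurable_pairing hu.memL2.1 (φ := fun p => φ p.2)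
        (hφ.smooth.continuous.comp continuous_snd).aestronglyMeasurable) ?_
    filter_upwards [hae] with t ht
    exact abs_integral_inner_le ht.1 hφ2 ht.2 (ENNReal.coe_toNNReal hφ2.2.ne).ge
  · refine locallyIntegrable_of_ae_bound (K := K)
      (aestronglyMeasurable_flux hu.memL2.1 hφ.smooth ν) ?_
    filter_upwards [hae] with t ht
    exact hK ν hν (Real.le_coe_toNNReal ν) _ ht.1 ht.2
  · -- the weak form is tested with `θ(t) φ(x)`
    have htest : IsTestField fun t x => θ t • φ x := by
      refine ⟨?_, ?_, fun t _ x => ?_⟩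
      · exact (hθ.comp contDiff_fst).smul (hφ.smooth.comp contDiff_snd)
      · refine HasCompactSupport.intro (hθc.isCompact.prod hφ.compact.isCompact) fun p hp => ?_
        by_cases h1 : p.1 ∈ tsupport θ
        · have h2 : p.2 ∉ tsupport φ := fun h => hp ⟨h1, h⟩
          simp [Function.uncurry, image_eq_zero_of_notMem_tsupport h2]
        · simp [Function.uncurry, image_eq_zero_of_notMem_tsupport h1]
      · have : divergence (fun x => θ t • φ x) x = θ t * divergence φ x := by
          simp only [divergence]
          rw [fderiv_fun_const_smul (hφ.smooth.differentiable (by simp)).differentiableAt,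
            Finset.mul_sum]
          simp
        rw [this, hφ.div, mul_zero]
    have hw := hu.weakForm _ htest
    have hr : ∫ x, inner ℝ (f x) (θ 0 • φ x) = θ 0 * pairing f φ := by
      simp only [inner_smul_right, pairing, integral_const_mul]
    rw [hr] at hw
    rw [← hw]
    refine integral_congr_ae ?_
    filter_upwards [hae] with t ht
    have hA := memLp_clm_apply (hφ.smooth.continuous_fderiv (by simp)).aestronglyMeasurable hC' ht.1
    have i1 : Integrable fun x => inner ℝ (u t x) (φ x) := integrable_inner_of_memLp ht.1 hφ2
    have i2 : Integrable fun x => inner ℝ (u t x) (ν • Δ φ x) := by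
      simp only [inner_smul_right]
      exact (integrable_inner_of_memLp ht.1 hΔ).const_mul ν
    have i3 : Integrable fun x => inner ℝ (u t x) (fderiv ℝ φ x (u t x)) :=
      integrable_inner_of_memLp ht.1 hA.1
    have i4 : Integrable fun x => θ t * (inner ℝ (u t x) (ν • Δ φ x) +
        inner ℝ (u t x) (fderiv ℝ φ x (u t x))) := (i2.add i3).const_mul _
    rw [pairing, flux, ← integral_const_mul, ← integral_const_mul,
      ← integral_add (i1.const_mul _) i4]
    refine integral_congr_ae (ae_of_all _ fun x => ?_)
    have e1 : deriv (fun τ => θ τ • φ x) t = deriv θ t • φ x :=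
      deriv_smul_const (hθ.differentiable (by simp)).differentiableAt _
    have e2 : Δ (fun x => θ t • φ x) x = θ t • Δ φ x := by
      have h1 := InnerProductSpace.laplacian_smul (f := φ) (x := x) (θ t)
        (contDiff_two hφ.smooth).contDiffAt
      exact h1
    have e3 : fderiv ℝ (fun x => θ t • φ x) x = θ t • fderiv ℝ φ x :=
      fderiv_fun_const_smul (hφ.smooth.differentiable (by simp)).differentiableAt _
    have e4 : ∀ (v a b : R3) (A : R3 →L[ℝ] R3) (p q : ℝ),
        p * inner ℝ v a + q * (inner ℝ v (ν • b) + inner ℝ v (A v)) =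
          inner ℝ v (p • a + ν • q • b) + inner ℝ v ((q • A) v) := by
      intro v a b A p q
      rw [smul_apply, inner_add_right, inner_smul_right, inner_smul_right, inner_smul_right,
        inner_smul_right, inner_smul_right]
      ring
    beta_reduce
    rw [e1, e2, e3]
    exact e4 _ _ _ _ _ _

/-! ### Solutions that are small in `L^r(0, ∞; X)` -/

section SpaceNorm

variable {X : Type*} [NormedAddCommGroup X] [NormedSpace ℝ X]

/-- The moments of `v` are controlled by its norm in `X`, as `X` embeds continuously into the
tempered distributions. -/
theorem exists_enorm_pairing_le (ι : X →L[ℝ] VecDist) {φ : R3 → R3} (hφ : IsSolenoidalTest φ) :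
    ∃ C : ℝ≥0, 0 < C ∧ ∀ v : R3 → R3, ‖pairing v φ‖ₑ ≤ C * spaceNorm ι v := by
  have hs : ∀ i, ContDiff ℝ ∞ fun x => φ x i := fun i =>
    (EuclideanSpace.proj i : R3 →L[ℝ] ℝ).contDiff.comp hφ.smooth
  have hc : ∀ i, HasCompactSupport fun x => φ x i := fun i =>
    hφ.compact.comp_left (g := (EuclideanSpace.proj i : R3 →L[ℝ] ℝ)) (map_zero _)
  let ζ : Fin 3 → 𝓢(R3, ℝ) := fun i => (hc i).toSchwartzMap (hs i)
  let L : X →L[ℝ] ℝ := ∑ i, (EuclideanSpace.proj i : R3 →L[ℝ] ℝ) ∘L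
    (PointwiseConvergenceCLM.evalCLM (RingHom.id ℝ) R3 (ζ i)) ∘L ι
  have hL : ∀ x v, Represents (ι x) v → L x = pairing v φ := by
    intro x v h
    have h1 : ∀ i, (ι x (ζ i)) i = ∫ y, φ y i * v y i := by
      intro i
      rw [(h (ζ i)).2]
      exact ((EuclideanSpace.proj i : R3 →L[ℝ] ℝ).integral_comp_comm (h (ζ i)).1).symm
    have h2 : ∀ i, Integrable fun y => φ y i * v y i := fun i =>
      (EuclideanSpace.proj i : R3 →L[ℝ] ℝ).integrable_comp (h (ζ i)).1
    rw [pairing]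
    simp only [PiLp.inner_apply]
    have h3 : L x = ∑ i, (ι x (ζ i)) i := by
      simp [L]
      rfl
    rw [h3]
    simp only [h1]
    rw [← integral_finsetSum _ fun i _ => h2 i]
    rfl
  refine ⟨‖L‖₊ + 1, by positivity, fun v => ?_⟩
  rw [spaceNorm, ENNReal.mul_iInf_of_ne (by simp) (by simp)]
  refine le_iInf fun x => ?_
  rw [ENNReal.mul_iInf_of_ne (by simp) (by simp)]
  refine le_iInf fun hx => ?_
  rw [← hL x v hx]
  calc ‖L x‖ₑ ≤ ‖L‖ₑ * ‖x‖ₑ := L.le_opENorm x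
    _ ≤ _ := by
      gcongr
      simp [enorm]

/-- If a datum has solutions, with bounded viscosities and bounded energy, that are arbitrarily
small in `L^r(0, ∞; X)`, then it vanishes: the moments of the solutions start from those of the
datum and change at a bounded rate. -/
theorem ae_eq_zero_of_small_solutions (ι : X →L[ℝ] VecDist) {r : ℝ≥0∞} (hr : r ≠ 0)
    {f : R3 → R3} (hf : MemLp f 2) (hdiv : IsDivFree f) {M V : ℝ≥0}
    (h : ∀ ε : ℝ≥0∞, 0 < ε → ∃ (ν : ℝ) (u : ℝ → R3 → R3), 0 ≤ ν ∧ ν ≤ V ∧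
      IsWeakSolution ν f u ∧ timeL2Norm ⊤ u ≤ M ∧ lrNorm ι r u < ε) : f =ᵐ[volume] 0 := by
  refine ae_eq_zero_of_orthogonal_solenoidal hf hdiv fun φ hφ => ?_
  change pairing f φ = 0
  by_contra hP
  obtain ⟨C, hC0, hC⟩ := exists_enorm_pairing_le ι hφ
  obtain ⟨K, hK0, hK⟩ := exists_flux_bound hφ V M
  set P := |pairing f φ| with hPdef
  have hPpos : 0 < P := abs_pos.2 hP
  -- the moment stays above `P / 2` on `(0, δ)`, hence the norm in `X` stays above `c`
  let δ : ℝ := P / (2 * (K + 1))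
  have hδ : 0 < δ := by positivity
  have hKδ : K * δ ≤ P / 2 := by
    have : (K + 1) * δ = P / 2 := by simp only [δ]; field_simp
    nlinarith
  let c : ℝ≥0∞ := ENNReal.ofReal (P / 2) / C
  have hc : c ≠ 0 := by
    have : 0 < P / 2 := by positivity
    simp [c, ENNReal.div_eq_zero_iff, this]
  have hctop : c ≠ ⊤ := ENNReal.div_ne_top ENNReal.ofReal_ne_top (by simpa using hC0.ne')
  have hvol : timeMeasure (Ioo 0 δ) = ENNReal.ofReal δ := by
    rw [timeMeasure, Measure.restrict_apply measurableSet_Ioo,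
      inter_eq_left.2 Ioo_subset_Ioi_self, Real.volume_Ioo, sub_zero]
  have hμ0 : timeMeasure.restrict (Ioo 0 δ) ≠ 0 := by
    rw [Ne, Measure.restrict_eq_zero, hvol]
    simpa using hδ
  obtain ⟨ν, u, hν, hνV, hu, hM, hlr⟩ := h
    (eLpNorm (fun _ : ℝ => c) r (timeMeasure.restrict (Ioo 0 δ))) (by
      rw [eLpNorm_const _ hr hμ0]
      refine ENNReal.mul_pos (by simpa using hc) ?_
      rw [Measure.restrict_apply_univ, hvol]
      refine (ENNReal.rpow_pos (by simpa using hδ) (by simp)).ne')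
  rw [lrNorm] at hlr
  simp only [iInf_lt_iff] at hlr
  obtain ⟨g, hg, hgle, hglt⟩ := hlr
  refine absurd hglt (not_lt.2 ?_)
  refine le_trans ?_ (eLpNorm_mono_measure g (Measure.restrict_le_self (s := Ioo 0 δ)))
  refine eLpNorm_mono_enorm_ae ?_
  have hae := hu.memL2.ae_memLp hM
  have hmem : ∀ᵐ t ∂timeMeasure.restrict (Ioo 0 δ), t ∈ Ioo 0 δ := ae_restrict_mem measurableSet_Ioo
  filter_upwards [hmem, ae_restrict_of_ae hgle, ae_restrict_of_ae (hu.pairing_eq hν hφ)]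
    with s hs hsg hsP
  simp only [enorm_eq_self]
  have hint : |∫ τ in (0 : ℝ)..s, flux ν φ (u τ)| ≤ K * δ := by
    have h1 : ∀ᵐ τ, τ ∈ uIoc 0 s → ‖flux ν φ (u τ)‖ ≤ K := by
      have := (ae_restrict_iff' measurableSet_Ioi).1 hae
      filter_upwards [this] with τ hτ hτs
      rw [uIoc_of_le hs.1.le] at hτs
      have := hτ hτs.1
      exact hK ν hν hνV _ this.1 this.2
    have h2 := intervalIntegral.norm_integral_le_of_norm_le_const_ae h1
    rw [sub_zero, abs_of_pos hs.1] at h2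
    exact h2.trans (mul_le_mul_of_nonneg_left hs.2.le hK0)
  have hlow : P / 2 ≤ |pairing (u s) φ| := by
    have h3 : pairing f φ = pairing (u s) φ - ∫ τ in (0 : ℝ)..s, flux ν φ (u τ) := by
      rw [hsP, add_sub_cancel_right]
    have h4 := abs_sub (pairing (u s) φ) (∫ τ in (0 : ℝ)..s, flux ν φ (u τ))
    rw [← h3] at h4
    linarith
  refine ENNReal.div_le_of_le_mul ?_
  calc ENNReal.ofReal (P / 2) ≤ ENNReal.ofReal |pairing (u s) φ| := ENNReal.ofReal_le_ofReal hlow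
    _ = ‖pairing (u s) φ‖ₑ := by rw [← Real.enorm_eq_ofReal_abs]
    _ ≤ C * spaceNorm ι (u s) := hC _
    _ ≤ g s * C := by rw [mul_comm]; gcongr

end SpaceNorm

/-! ### Spatial translates and the weak gradient -/

/-- Translation by `h` in space. -/
def shift (h : R3) (p : ℝ × R3) : ℝ × R3 := (p.1, p.2 + h)

theorem measurePreserving_shift (h : R3) :
    MeasurePreserving (shift h) spaceTimeMeasure spaceTimeMeasure :=
  (MeasurePreserving.id timeMeasure).prod (measurePreserving_add_right volume h)

theorem measurableEmbedding_shift (h : R3) : MeasurableEmbedding (shift h) :=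
  (MeasurableEquiv.prodCongr (MeasurableEquiv.refl ℝ)
    (MeasurableEquiv.addRight h)).measurableEmbedding

theorem measurePreserving_shear {A : Type*} [MeasurableSpace A] (β : Measure A) [SFinite β]
    {a : A → R3} (ha : Measurable a) :
    MeasurePreserving (fun q : A × (ℝ × R3) => (q.1, shift (a q.1) q.2))
      (β.prod spaceTimeMeasure) (β.prod spaceTimeMeasure) := by
  refine (MeasurePreserving.id β).skew_product (g := fun s => shift (a s)) ?_
    (ae_of_all _ fun s => (measurePreserving_shift (a s)).map_eq)
  unfold shift Function.uncurry
  fun_prop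

/-- The translates of a square integrable function are jointly square integrable over a
probability space of translations. -/
theorem memLp_comp_shift {A F : Type*} [MeasurableSpace A] [NormedAddCommGroup F] {β : Measure A}
    [IsProbabilityMeasure β] {a : A → R3} (ha : Measurable a) {v : ℝ × R3 → F}
    (hv : MemLp v 2 spaceTimeMeasure) :
    MemLp (fun q : A × (ℝ × R3) => v (shift (a q.1) q.2)) 2 (β.prod spaceTimeMeasure) :=
  (hv.comp_measurePreserving (measurePreserving_snd (μ := β))).comp_measurePreserving
    (measurePreserving_shear β ha)

theorem aestronglyMeasurable_comp_shift {A F : Type*} [MeasurableSpace A] [NormedAddCommGroup F]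
    {β : Measure A} [SFinite β] {a : A → R3} (ha : Measurable a) {v : ℝ × R3 → F}
    (hv : AEStronglyMeasurable v spaceTimeMeasure) :
    AEStronglyMeasurable (fun q : A × (ℝ × R3) => v (shift (a q.1) q.2))
      (β.prod spaceTimeMeasure) :=
  (hv.comp_quasiMeasurePreserving Measure.quasiMeasurePreserving_snd).comp_measurePreserving
    (measurePreserving_shear β ha)

/-- Jensen's inequality for the square of the norm. -/
theorem enorm_integral_sq_le {A F : Type*} [MeasurableSpace A] [NormedAddCommGroup F]
    [NormedSpace ℝ F] {β : Measure A} [IsProbabilityMeasure β] {f : A → F}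
    (hf : AEStronglyMeasurable f β) : ‖∫ s, f s ∂β‖ₑ ^ 2 ≤ ∫⁻ s, ‖f s‖ₑ ^ 2 ∂β := by
  have h1 : eLpNorm f 1 β ≤ eLpNorm f 2 β :=
    eLpNorm_le_eLpNorm_of_exponent_le (by norm_num) hf
  have h2 : ‖∫ s, f s ∂β‖ₑ ≤ eLpNorm f 1 β := by
    rw [eLpNorm_one_eq_lintegral_enorm]
    exact enorm_integral_le_lintegral_enorm _
  have h3 : eLpNorm f 2 β ^ 2 = ∫⁻ s, ‖f s‖ₑ ^ 2 ∂β := by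
    have := eLpNorm_nnreal_pow_eq_lintegral (f := f) (μ := β) (p := 2) (by norm_num)
    simpa using this
  rw [← h3]
  gcongr
  exact h2.trans h1

theorem lintegral_enorm_sq_eq {α F : Type*} [MeasurableSpace α] [NormedAddCommGroup F]
    {μ : Measure α} (f : α → F) : ∫⁻ s, ‖f s‖ₑ ^ 2 ∂μ = eLpNorm f 2 μ ^ 2 := by
  have := eLpNorm_nnreal_pow_eq_lintegral (f := f) (μ := μ) (p := 2) (by norm_num)
  simpa using this.symm

/-- The mean of a square integrable function over a probability space of translations is square
integrable with no larger norm. -/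
theorem memLp_integral_shift {A F : Type*} [MeasurableSpace A] [NormedAddCommGroup F]
    [NormedSpace ℝ F] {β : Measure A} [IsProbabilityMeasure β] {a : A → R3} (ha : Measurable a)
    {v : ℝ × R3 → F} (hv : MemLp v 2 spaceTimeMeasure) :
    MemLp (fun p => ∫ s, v (shift (a s) p) ∂β) 2 spaceTimeMeasure ∧
      eLpNorm (fun p => ∫ s, v (shift (a s) p) ∂β) 2 spaceTimeMeasure ≤
        eLpNorm v 2 spaceTimeMeasure := by
  have hm := aestronglyMeasurable_comp_shift (β := β) ha hv.1
  have hm' : AEStronglyMeasurable (fun q : (ℝ × R3) × A => v (shift (a q.2) q.1))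
      (spaceTimeMeasure.prod β) := hm.prod_swap
  have hle : eLpNorm (fun p => ∫ s, v (shift (a s) p) ∂β) 2 spaceTimeMeasure ≤
      eLpNorm v 2 spaceTimeMeasure := by
    rw [← ENNReal.pow_le_pow_left_iff (two_ne_zero), ← lintegral_enorm_sq_eq,
      ← lintegral_enorm_sq_eq]
    calc ∫⁻ p, ‖∫ s, v (shift (a s) p) ∂β‖ₑ ^ 2 ∂spaceTimeMeasure
        ≤ ∫⁻ p, ∫⁻ s, ‖v (shift (a s) p)‖ₑ ^ 2 ∂β ∂spaceTimeMeasure := by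
          refine lintegral_mono_ae ?_
          filter_upwards [hm'.prodMk_left] with p hp
          exact enorm_integral_sq_le hp
      _ = ∫⁻ s, ∫⁻ p, ‖v (shift (a s) p)‖ₑ ^ 2 ∂spaceTimeMeasure ∂β :=
          lintegral_lintegral_swap (hm'.enorm.pow_const 2)
      _ = ∫⁻ s, ∫⁻ p, ‖v p‖ₑ ^ 2 ∂spaceTimeMeasure ∂β := by
          refine lintegral_congr fun s => ?_
          exact (measurePreserving_shift (a s)).lintegral_comp_emb (measurableEmbedding_shift _)
            (fun p => ‖v p‖ₑ ^ 2)
      _ = _ := by simp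
  exact ⟨⟨hm'.integral_prod_right', hle.trans_lt hv.2⟩, hle⟩

/-- `u` is square integrable on `(0, T) × ℝ³` for every `T`. -/
def IsLocalInTimeL2 (u : ℝ × R3 → R3) : Prop :=
  ∀ T : ℝ, MemLp ((Iio T ×ˢ univ).indicator u) 2 spaceTimeMeasure

theorem IsLocalInTimeL2.comp_shift {u : ℝ × R3 → R3} (hu : IsLocalInTimeL2 u) (h : R3) :
    IsLocalInTimeL2 fun p => u (shift h p) := fun T =>
  (hu T).comp_measurePreserving (measurePreserving_shift h)

theorem IsLocalInTimeL2.sub {u v : ℝ × R3 → R3} (hu : IsLocalInTimeL2 u) (hv : IsLocalInTimeL2 v) :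
    IsLocalInTimeL2 fun p => u p - v p := fun T => by
  have := (hu T).sub (hv T)
  have e : ((Iio T ×ˢ univ).indicator fun p => u p - v p) =
      (Iio T ×ˢ univ).indicator u - (Iio T ×ˢ univ).indicator v := indicator_sub _ u v
  rwa [e]

theorem IsLocalInTimeL2.locallyIntegrable {u : ℝ × R3 → R3} (hu : IsLocalInTimeL2 u) :
    LocallyIntegrable u spaceTimeMeasure := by
  intro p
  obtain ⟨s, hs, hi⟩ := ((hu (p.1 + 1)).locallyIntegrable (by norm_num)) p
  have hV : (Iio (p.1 + 1) ×ˢ univ : Set (ℝ × R3)) ∈ 𝓝 p :=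
    (isOpen_Iio.prod isOpen_univ).mem_nhds ⟨by simp, trivial⟩
  refine ⟨s ∩ Iio (p.1 + 1) ×ˢ univ, inter_mem hs hV, ?_⟩
  have h2 := hi.mono_set (inter_subset_left (t := Iio (p.1 + 1) ×ˢ univ))
  have hmeas : MeasurableSet (Iio (p.1 + 1) ×ˢ univ : Set (ℝ × R3)) :=
    measurableSet_Iio.prod MeasurableSet.univ
  rw [IntegrableOn, integrable_indicator_iff hmeas, IntegrableOn,
    Measure.restrict_restrict hmeas] at h2
  rwa [← inter_assoc, inter_comm _ s, inter_assoc, inter_self] at h2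

/-- The directional derivative `∑ h_k G_k` belonging to the gradient `G`. -/
def directional (G : ℝ → R3 → PiLp 2 (fun _ : Fin 3 => R3)) (h : R3) (p : ℝ × R3) : R3 :=
  ∑ k, h k • Function.uncurry G p k

theorem norm_directional_le (G : ℝ → R3 → PiLp 2 (fun _ : Fin 3 => R3)) (h : R3) (p : ℝ × R3) :
    ‖directional G h p‖ ≤ (3 * ‖h‖) * ‖Function.uncurry G p‖ := by
  calc ‖directional G h p‖ ≤ ∑ k : Fin 3, ‖h‖ * ‖Function.uncurry G p‖ := by
        refine (norm_sum_le _ _).trans (Finset.sum_le_sum fun k _ => ?_)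
        rw [norm_smul]
        exact mul_le_mul (PiLp.norm_apply_le h k) (PiLp.norm_apply_le _ k) (norm_nonneg _)
          (norm_nonneg _)
    _ = _ := by simp; ring

theorem memLp_component {G : ℝ → R3 → PiLp 2 (fun _ : Fin 3 => R3)}
    (hG : MemLp (Function.uncurry G) 2 spaceTimeMeasure) (k : Fin 3) :
    MemLp (fun p => Function.uncurry G p k) 2 spaceTimeMeasure :=
  (PiLp.proj 2 (𝕜 := ℝ) (fun _ : Fin 3 => R3) k).comp_memLp' hG

theorem memLp_directional {G : ℝ → R3 → PiLp 2 (fun _ : Fin 3 => R3)}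
    (hG : MemLp (Function.uncurry G) 2 spaceTimeMeasure) (h : R3) :
    MemLp (directional G h) 2 spaceTimeMeasure ∧
      eLpNorm (directional G h) 2 spaceTimeMeasure ≤
        ENNReal.ofReal (3 * ‖h‖) * eLpNorm (Function.uncurry G) 2 spaceTimeMeasure := by
  refine ⟨memLp_finsetSum _ fun k _ => (memLp_component hG k).const_smul (h k), ?_⟩
  exact eLpNorm_le_mul_eLpNorm_of_ae_le_mul (ae_of_all _ (norm_directional_le G h)) 2

theorem fderiv_slice {F : Type*} [NormedAddCommGroup F] [NormedSpace ℝ F] {ψ : ℝ × R3 → F}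
    (hψ : Differentiable ℝ ψ) (t : ℝ) (x v : R3) :
    fderiv ℝ (fun x => ψ (t, x)) x v = fderiv ℝ ψ (t, x) (0, v) := by
  have h1 : HasFDerivAt (fun x : R3 => (t, x)) (ContinuousLinearMap.inr ℝ ℝ R3) x :=
    (hasFDerivAt_const t x).prodMk (hasFDerivAt_id x)
  have h2 := ((hψ (t, x)).hasFDerivAt.comp x h1).fderiv
  change fderiv ℝ (ψ ∘ Prod.mk t) x v = _
  rw [h2]
  simp

/-- The definition of the weak gradient, for directional derivatives and in terms of integrals over
space-time. -/
theorem IsWeakGradient.integral_directional {u : ℝ → R3 → R3}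
    {G : ℝ → R3 → PiLp 2 (fun _ : Fin 3 => R3)} (hG : IsWeakGradient u G)
    (hu : LocallyIntegrable (Function.uncurry u) spaceTimeMeasure) (h : R3) {ψ : ℝ × R3 → ℝ}
    (hψ : ContDiff ℝ ∞ ψ) (hc : HasCompactSupport ψ) (hsupp : tsupport ψ ⊆ Ioi 0 ×ˢ univ) :
    ∫ p, fderiv ℝ ψ p (0, h) • Function.uncurry u p ∂spaceTimeMeasure =
      -∫ p, ψ p • directional G h p ∂spaceTimeMeasure := by
  have hd := hψ.differentiable (by simp)
  have hk : ∀ k, ∫ p, fderiv ℝ ψ p (0, EuclideanSpace.single k 1) • Function.uncurry u p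
      ∂spaceTimeMeasure = -∫ p, ψ p • Function.uncurry G p k ∂spaceTimeMeasure ∧
      Integrable (fun p => fderiv ℝ ψ p (0, EuclideanSpace.single k 1) • Function.uncurry u p)
        spaceTimeMeasure ∧
      Integrable (fun p => ψ p • Function.uncurry G p k) spaceTimeMeasure := by
    intro k
    have i1 : Integrable (fun p => fderiv ℝ ψ p (0, EuclideanSpace.single k 1) •
        Function.uncurry u p) spaceTimeMeasure :=
      hu.integrable_smul_left_of_hasCompactSupport
        ((hψ.continuous_fderiv (by simp)).clm_apply continuous_const) (hc.fderiv_apply ℝ _)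
    have i2 : Integrable (fun p => ψ p • Function.uncurry G p k) spaceTimeMeasure :=
      ((memLp_component hG.1 k).locallyIntegrable
        (by norm_num)).integrable_smul_left_of_hasCompactSupport hψ.continuous hc
    refine ⟨?_, i1, i2⟩
    have e := hG.2 (fun t x => ψ (t, x)) hψ hc hsupp k
    rw [spaceTimeMeasure] at i1 i2 ⊢
    rw [integral_prod _ i1, integral_prod _ i2]
    simp only [fderiv_slice hd] at e
    exact e
  have e0 : ((0 : ℝ), h) = ∑ k, h k • ((0 : ℝ), EuclideanSpace.single k (1 : ℝ)) := by
    have := (EuclideanSpace.basisFun (Fin 3) ℝ).sum_repr h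
    simp only [EuclideanSpace.basisFun_repr, EuclideanSpace.basisFun_apply] at this
    ext1
    · simp [Prod.fst_sum]
    · simp only [Prod.snd_sum, Prod.smul_snd]
      exact this.symm
  have e1 : ∀ p, fderiv ℝ ψ p (0, h) • Function.uncurry u p = ∑ k, h k •
      (fderiv ℝ ψ p (0, EuclideanSpace.single k 1) • Function.uncurry u p) := by
    intro p
    rw [e0, map_sum, Finset.sum_smul]
    simp only [map_smul, smul_smul, smul_eq_mul]
  have e2 : ∀ p, ψ p • directional G h p = ∑ k, h k • (ψ p • Function.uncurry G p k) := by
    intro p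
    rw [directional, Finset.smul_sum]
    simp only [smul_smul, mul_comm]
  simp only [e1, e2]
  have j1 : ∀ k ∈ Finset.univ, Integrable (fun p => h k •
      (fderiv ℝ ψ p (0, EuclideanSpace.single k 1) • Function.uncurry u p)) spaceTimeMeasure :=
    fun k _ => (hk k).2.1.smul (h k)
  have j2 : ∀ k ∈ Finset.univ, Integrable (fun p => h k • (ψ p • Function.uncurry G p k))
      spaceTimeMeasure := fun k _ => (hk k).2.2.smul (h k)
  rw [integral_finsetSum _ j1, integral_finsetSum _ j2, ← Finset.sum_neg_distrib]
  refine Finset.sum_congr rfl fun k _ => ?_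
  rw [integral_smul, integral_smul, (hk k).1, smul_neg]

theorem spaceTimeMeasure_eq :
    spaceTimeMeasure = (volume : Measure (ℝ × R3)).restrict (Ioi 0 ×ˢ univ) := by
  rw [spaceTimeMeasure, timeMeasure, Measure.volume_eq_prod, ← Measure.prod_restrict,
    Measure.restrict_univ]

/-- Fundamental theorem of calculus for the spatial translates of a function with a weak
gradient: `u(· + h) - u = ∫₀¹ h · ∇u(· + s h) ds`, obtained by duality from the classical theorem
for test functions. -/
theorem IsWeakGradient.shift_sub_ae_eq {u : ℝ → R3 → R3}
    {G : ℝ → R3 → PiLp 2 (fun _ : Fin 3 => R3)} (hG : IsWeakGradient u G)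
    (hu : IsLocalInTimeL2 (Function.uncurry u)) (h : R3) :
    ∀ᵐ p ∂spaceTimeMeasure, Function.uncurry u (shift h p) - Function.uncurry u p =
      ∫ s in Ioc (0 : ℝ) 1, directional G h (shift (s • h) p) := by
  set β : Measure ℝ := volume.restrict (Ioc 0 1) with hβ
  have : IsProbabilityMeasure β := ⟨by simp [β]⟩
  set U := Function.uncurry u
  set D := directional G h
  have hD := (memLp_directional hG.1 h).1
  have ha : Measurable fun s : ℝ => s • h := by fun_prop
  have hR := (memLp_integral_shift (β := β) ha hD).1
  set R : ℝ × R3 → R3 := fun p => ∫ s, D (shift (s • h) p) ∂β with hRdef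
  have hUloc := hu.locallyIntegrable
  have hUh := (hu.comp_shift h).locallyIntegrable
  have hRloc := hR.locallyIntegrable (by norm_num)
  have hfloc : LocallyIntegrable (fun p => U (shift h p) - U p - R p) spaceTimeMeasure :=
    (hUh.sub hUloc).sub hRloc
  have hopen : IsOpen (Ioi (0 : ℝ) ×ˢ (univ : Set R3)) := isOpen_Ioi.prod isOpen_univ
  have key : ∀ᵐ p ∂(volume : Measure (ℝ × R3)), p ∈ Ioi (0 : ℝ) ×ˢ (univ : Set R3) →
      U (shift h p) - U p - R p = 0 := by
    rw [spaceTimeMeasure_eq] at hfloc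
    refine hopen.ae_eq_zero_of_integral_contDiff_smul_eq_zero
      (locallyIntegrableOn_of_locallyIntegrable_restrict hfloc) fun ψ hψ hc hsupp => ?_
    have e0 : ∫ p, ψ p • (U (shift h p) - U p - R p) =
        ∫ p, ψ p • (U (shift h p) - U p - R p) ∂spaceTimeMeasure := by
      rw [spaceTimeMeasure_eq]
      refine (setIntegral_eq_integral_of_forall_compl_eq_zero fun p hp => ?_).symm
      have : p ∉ tsupport ψ := fun h => hp (hsupp h)
      rw [image_eq_zero_of_notMem_tsupport this, zero_smul]
    rw [e0]
    have i1 : Integrable (fun p => ψ p • U (shift h p)) spaceTimeMeasure :=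
      hUh.integrable_smul_left_of_hasCompactSupport hψ.continuous hc
    have i2 : Integrable (fun p => ψ p • U p) spaceTimeMeasure :=
      hUloc.integrable_smul_left_of_hasCompactSupport hψ.continuous hc
    have i3 : Integrable (fun p => ψ p • R p) spaceTimeMeasure :=
      hRloc.integrable_smul_left_of_hasCompactSupport hψ.continuous hc
    have hsmoothShift : ∀ v : R3, ContDiff ℝ ∞ (shift v) := fun v => by
      unfold shift; fun_prop
    have hshiftshift : ∀ (v : R3) p, shift (-v) (shift v p) = p := fun v p => by
      simp [shift]
    have hcs : ∀ v : R3, HasCompactSupport fun p => ψ (shift v p) := fun v =>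
      hc.comp_homeomorph ((Homeomorph.refl ℝ).prodCongr (Homeomorph.addRight v))
    have hψ2 : MemLp ψ 2 spaceTimeMeasure := hψ.continuous.memLp_of_hasCompactSupport hc
    let a : ℝ × R3 → ℝ := fun p => fderiv ℝ ψ p (0, h)
    have hac : Continuous a := (hψ.continuous_fderiv (by simp)).clm_apply continuous_const
    have hacs : HasCompactSupport a := hc.fderiv_apply ℝ _
    have ha2 : MemLp a 2 spaceTimeMeasure := hac.memLp_of_hasCompactSupport hacs
    obtain ⟨T, hT⟩ : ∃ T : ℝ, ∀ p, a p ≠ 0 → p.1 < T := by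
      obtain ⟨B, hB⟩ := hacs.isCompact.isBounded.subset_ball 0
      refine ⟨B, fun p hp => ?_⟩
      have := hB (subset_tsupport _ hp)
      rw [Metric.mem_ball, dist_zero_right] at this
      exact (le_abs_self p.1).trans_lt ((norm_fst_le p).trans_lt this)
    -- the derivative of the translates of `ψ`
    have hder : ∀ p, ∫ s, a (shift (-(s • h)) p) ∂β = ψ p - ψ (shift (-h) p) := by
      intro p
      have hd : ∀ s : ℝ, HasDerivAt (fun s : ℝ => -ψ (shift (-(s • h)) p))
          (a (shift (-(s • h)) p)) s := by
        intro s
        have h1 : HasDerivAt (fun s : ℝ => shift (-(s • h)) p) (0, -h) s := by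
          have h2 : HasDerivAt (fun s : ℝ => p.2 + -(s • h)) (-h) s := by
            have := (((hasDerivAt_id s).smul_const h).neg).const_add p.2
            simpa using this
          exact (hasDerivAt_const s p.1).prodMk h2
        have h3 := ((hψ.differentiable (by simp) (shift (-(s • h)) p)).hasFDerivAt.comp_hasDerivAt s
          h1).neg
        have h4 : a (shift (-(s • h)) p) = -fderiv ℝ ψ (shift (-(s • h)) p) (0, -h) := by
          rw [← map_neg, Prod.neg_mk, neg_zero, neg_neg]
        rw [h4]
        exact h3
      have := intervalIntegral.integral_eq_sub_of_hasDerivAt (a := 0) (b := 1)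
        (fun s _ => hd s) (Continuous.intervalIntegrable (by
          unfold shift; fun_prop) _ _)
      rw [intervalIntegral.integral_of_le zero_le_one] at this
      rw [hβ, this]
      simp [shift]
      ring
    -- the identity defining the weak gradient, for the translates of `ψ`
    have hW : ∀ s : ℝ, ∫ p, ψ p • D (shift (s • h) p) ∂spaceTimeMeasure =
        -∫ p, a (shift (-(s • h)) p) • U p ∂spaceTimeMeasure := by
      intro s
      have e1 : ∫ p, ψ p • D (shift (s • h) p) ∂spaceTimeMeasure =
          ∫ p, ψ (shift (-(s • h)) p) • D p ∂spaceTimeMeasure := by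
        rw [← (measurePreserving_shift (s • h)).integral_comp (measurableEmbedding_shift _)
          (fun p => ψ (shift (-(s • h)) p) • D p)]
        simp only [hshiftshift]
      have e2 := hG.integral_directional hUloc h
        (ψ := fun p => ψ (shift (-(s • h)) p)) (hψ.comp (hsmoothShift _)) (hcs _) (by
          intro p hp
          have h1 : shift (-(s • h)) p ∈ tsupport ψ :=
            tsupport_comp_subset_preimage ψ (hsmoothShift _).continuous hp
          exact ⟨(hsupp h1).1, trivial⟩)
      have e3 : ∀ p, fderiv ℝ (fun p => ψ (shift (-(s • h)) p)) p (0, h) =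
          a (shift (-(s • h)) p) := by
        intro p
        have h1 : HasFDerivAt (shift (-(s • h))) (ContinuousLinearMap.id ℝ (ℝ × R3)) p := by
          have : shift (-(s • h)) = fun p => p + (0, -(s • h)) := by
            ext1 p; simp [shift, Prod.ext_iff]
          rw [this]
          exact (hasFDerivAt_id p).add_const _
        have h2 := ((hψ.differentiable (by simp) (shift (-(s • h)) p)).hasFDerivAt.comp p h1).fderiv
        change fderiv ℝ (ψ ∘ shift (-(s • h))) p (0, h) = _
        rw [h2]
        rfl
      simp only [e3] at e2
      rw [e1, e2, neg_neg]
    have hshear1 : Integrable (fun q : ℝ × (ℝ × R3) => ψ q.2 • D (shift (q.1 • h) q.2))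
        (β.prod spaceTimeMeasure) := by
      have h1 := hψ2.comp_measurePreserving (measurePreserving_snd (μ := β))
      exact memLp_one_iff_integrable.1 ((memLp_comp_shift (β := β) ha hD).smul h1)
    have hshear2 : Integrable (fun q : ℝ × (ℝ × R3) => a (shift (-(q.1 • h)) q.2) • U q.2)
        (β.prod spaceTimeMeasure) := by
      have h1 := (hu T).comp_measurePreserving (measurePreserving_snd (μ := β))
      have h2 := memLp_comp_shift (β := β) (a := fun s : ℝ => -(s • h)) (by fun_prop) ha2
      refine (memLp_one_iff_integrable.1 (h1.smul (r := 1) h2)).congr (ae_of_all _ fun q => ?_)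
      by_cases hz : a (shift (-(q.1 • h)) q.2) = 0
      · simp [hz]
      · have : q.2 ∈ Iio T ×ˢ (univ : Set R3) := ⟨by simpa [shift] using hT _ hz, trivial⟩
        simp [indicator_of_mem this, U]
    have e4 : ∫ p, ψ p • R p ∂spaceTimeMeasure =
        ∫ p, (ψ (shift (-h) p) - ψ p) • U p ∂spaceTimeMeasure := by
      calc ∫ p, ψ p • R p ∂spaceTimeMeasure
          = ∫ p, ∫ s, ψ p • D (shift (s • h) p) ∂β ∂spaceTimeMeasure := by
            simp only [hRdef, integral_smul]
        _ = ∫ s, ∫ p, ψ p • D (shift (s • h) p) ∂spaceTimeMeasure ∂β :=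
            (integral_integral_swap (f := fun s p => ψ p • D (shift (s • h) p)) hshear1).symm
        _ = ∫ s, -∫ p, a (shift (-(s • h)) p) • U p ∂spaceTimeMeasure ∂β := by simp only [hW]
        _ = -∫ p, ∫ s, a (shift (-(s • h)) p) • U p ∂β ∂spaceTimeMeasure := by
            rw [integral_neg, integral_integral_swap
              (f := fun s p => a (shift (-(s • h)) p) • U p) hshear2]
        _ = _ := by
            rw [← integral_neg]
            refine integral_congr_ae (ae_of_all _ fun p => ?_)
            simp only [integral_smul_const, hder]
            rw [← neg_smul, neg_sub]
    have e5 : ∫ p, ψ p • U (shift h p) ∂spaceTimeMeasure =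
        ∫ p, ψ (shift (-h) p) • U p ∂spaceTimeMeasure := by
      rw [← (measurePreserving_shift h).integral_comp (measurableEmbedding_shift _)
        (fun p => ψ (shift (-h) p) • U p)]
      simp only [hshiftshift]
    have i4 : Integrable (fun p => ψ (shift (-h) p) • U p) spaceTimeMeasure :=
      hUloc.integrable_smul_left_of_hasCompactSupport
        (hψ.continuous.comp (hsmoothShift _).continuous) (hcs _)
    have i12 : Integrable (fun p => ψ p • U (shift h p) - ψ p • U p) spaceTimeMeasure := i1.sub i2
    simp only [smul_sub]
    rw [integral_sub i12 i3, integral_sub i1 i2, e4, e5]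
    simp only [sub_smul]
    rw [integral_sub i4 i2, sub_self]
  rw [spaceTimeMeasure_eq, ae_restrict_iff' hopen.measurableSet]
  filter_upwards [key] with p hp hpU
  exact sub_eq_zero.1 (hp hpU)

/-- Translates of a function with a weak gradient in `L²`: `‖u(· + h) - u‖ ≤ 3 |h| ‖∇u‖`. -/
theorem IsWeakGradient.lintegral_shift_sub_le {u : ℝ → R3 → R3}
    {G : ℝ → R3 → PiLp 2 (fun _ : Fin 3 => R3)} (hG : IsWeakGradient u G)
    (hu : IsLocalInTimeL2 (Function.uncurry u)) (h : R3) :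
    ∫⁻ p, ‖Function.uncurry u (shift h p) - Function.uncurry u p‖ₑ ^ 2 ∂spaceTimeMeasure ≤
      (ENNReal.ofReal (3 * ‖h‖) * eLpNorm (Function.uncurry G) 2 spaceTimeMeasure) ^ 2 := by
  rw [lintegral_enorm_sq_eq]
  gcongr
  rw [eLpNorm_congr_ae (hG.shift_sub_ae_eq hu h)]
  have : IsProbabilityMeasure ((volume : Measure ℝ).restrict (Ioc 0 1)) := ⟨by simp⟩
  have hD := memLp_directional hG.1 h
  have ha : Measurable fun s : ℝ => s • h := by fun_prop
  exact (memLp_integral_shift ha hD.1).2.trans hD.2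

/-! ### Rellich's theorem in space-time -/

theorem isLocalInTimeL2_of_bound {u : ℝ → R3 → R3}
    (hm : AEStronglyMeasurable (Function.uncurry u) spaceTimeMeasure) {M : ℝ≥0}
    (hM : ∀ᵐ t ∂timeMeasure, eLpNorm (u t) 2 volume ≤ M) :
    IsLocalInTimeL2 (Function.uncurry u) := by
  intro T
  have hmeas : MeasurableSet (Iio T ×ˢ univ : Set (ℝ × R3)) :=
    measurableSet_Iio.prod MeasurableSet.univ
  refine ⟨hm.indicator hmeas, ?_⟩
  rw [eLpNorm_indicator_eq_eLpNorm_restrict hmeas, ← ENNReal.pow_lt_top_iff.trans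
    (or_iff_left two_ne_zero), ← lintegral_enorm_sq_eq]
  have e : spaceTimeMeasure.restrict (Iio T ×ˢ univ) =
      (timeMeasure.restrict (Iio T)).prod volume := by
    rw [spaceTimeMeasure, ← Measure.prod_restrict, Measure.restrict_univ]
  rw [e, lintegral_prod _ (by rw [← e]; exact hm.restrict.enorm.pow_const 2)]
  calc ∫⁻ t in Iio T, (∫⁻ x, ‖u t x‖ₑ ^ 2) ∂timeMeasure
      ≤ ∫⁻ t in Iio T, (M : ℝ≥0∞) ^ 2 ∂timeMeasure := by
        refine lintegral_mono_ae (ae_restrict_of_ae ?_)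
        filter_upwards [hM] with t ht
        rw [lintegral_enorm_sq_eq]
        gcongr
    _ < ⊤ := by
        rw [lintegral_const, Measure.restrict_apply_univ, timeMeasure,
          Measure.restrict_apply measurableSet_Iio]
        refine ENNReal.mul_lt_top (by simp) ?_
        rw [inter_comm, Ioi_inter_Iio]
        simp

/-- **Rellich's theorem in space-time.** Functions that converge weakly to zero at almost every
time, are uniformly bounded in `L²` at almost every time, and have gradients bounded in
`L²((0, ∞) × ℝ³)` converge strongly to zero in `L²` on sets of finite measure. The difference
between a function and its averages over balls of radius `ρ` is of order `ρ`, uniformly in the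
sequence, and for fixed `ρ` the averages converge pointwise and boundedly. -/
theorem tendsto_lintegral_sq_of_weak {w : ℕ → ℝ → R3 → R3}
    {D : ℕ → ℝ → R3 → PiLp 2 (fun _ : Fin 3 => R3)} {M N : ℝ≥0}
    (hm : ∀ j, AEStronglyMeasurable (Function.uncurry (w j)) spaceTimeMeasure)
    (hb : ∀ j, ∀ᵐ t ∂timeMeasure, MemLp (w j t) 2 ∧ eLpNorm (w j t) 2 volume ≤ M)
    (hD : ∀ j, IsWeakGradient (w j) (D j))
    (hDN : ∀ j, eLpNorm (Function.uncurry (D j)) 2 spaceTimeMeasure ≤ N)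
    (hweak : ∀ᵐ t ∂timeMeasure, ∀ ψ : R3 → R3, MemLp ψ 2 →
      Tendsto (fun j => ∫ x, inner ℝ (w j t x) (ψ x)) atTop (𝓝 0))
    {S : Set (ℝ × R3)} (hS : spaceTimeMeasure S < ⊤) :
    Tendsto (fun j => ∫⁻ p in S, ‖Function.uncurry (w j) p‖ₑ ^ 2 ∂spaceTimeMeasure)
      atTop (𝓝 0) := by
  rw [ENNReal.tendsto_nhds_zero]
  intro ε hε
  obtain ⟨ρ, hρ0, hρ⟩ : ∃ ρ : ℝ, 0 < ρ ∧ 2 * (ENNReal.ofReal (3 * ρ) * N) ^ 2 ≤ ε / 2 := by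
    have hcont : Tendsto (fun ρ : ℝ => 2 * (ENNReal.ofReal (3 * ρ) * N) ^ 2) (𝓝[>] 0) (𝓝 0) := by
      have h1 : Tendsto (fun ρ : ℝ => ENNReal.ofReal (3 * ρ)) (𝓝[>] 0) (𝓝 0) := by
        have : Continuous fun ρ : ℝ => ENNReal.ofReal (3 * ρ) :=
          ENNReal.continuous_ofReal.comp (continuous_const_mul 3)
        have := this.tendsto 0
        rw [mul_zero, ENNReal.ofReal_zero] at this
        exact this.mono_left nhdsWithin_le_nhds
      have h2 := ENNReal.Tendsto.mul_const h1 (b := (N : ℝ≥0∞)) (Or.inr ENNReal.coe_ne_top)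
      have h3 := ENNReal.Tendsto.const_mul
        ((ENNReal.continuous_pow 2).continuousAt.tendsto.comp h2) (a := 2) (Or.inr (by simp))
      simpa using h3
    have := (ENNReal.tendsto_nhds_zero.1 hcont (ε / 2) (ENNReal.half_pos hε.ne')).and
      self_mem_nhdsWithin
    obtain ⟨ρ, h1, h2⟩ := this.exists
    exact ⟨ρ, h2, h1⟩
  set B : Set R3 := Metric.ball 0 ρ
  have hB0 : volume B ≠ 0 := (Metric.measure_ball_pos volume 0 hρ0).ne'
  have hBtop : volume B ≠ ⊤ := measure_ball_lt_top.ne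
  set V : ℝ≥0∞ := (volume B)⁻¹
  have hVtop : V ≠ ⊤ := ENNReal.inv_ne_top.2 hB0
  set β : Measure R3 := V • volume.restrict B with hβ
  have hβp : IsProbabilityMeasure β := ⟨by
    simp [β, V, ENNReal.inv_mul_cancel hB0 hBtop]⟩
  -- the averages over balls of radius `ρ`
  let A : ℕ → ℝ × R3 → R3 := fun j p => ∫ h, Function.uncurry (w j) (shift h p) ∂β
  have hmshift : ∀ j, AEStronglyMeasurable (fun q : (ℝ × R3) × R3 =>
      Function.uncurry (w j) (shift q.2 q.1)) (spaceTimeMeasure.prod β) := fun j =>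
    (aestronglyMeasurable_comp_shift (β := β) (a := fun h => h) measurable_id (hm j)).prod_swap
  have hAm : ∀ j, AEStronglyMeasurable (A j) spaceTimeMeasure := fun j =>
    (hmshift j).integral_prod_right'
  have hslice : ∀ᵐ p ∂spaceTimeMeasure, ∀ j, MemLp (w j p.1) 2 ∧ eLpNorm (w j p.1) 2 volume ≤ M :=
    Measure.quasiMeasurePreserving_fst.ae (ae_all_iff.2 hb)
  have hmemβ : ∀ {v : R3 → R3}, MemLp v 2 → ∀ x : R3, MemLp (fun h => v (x + h)) 2 β := by
    intro v hv x
    have h := hv.comp_measurePreserving (measurePreserving_add_left volume x)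
    exact (h.restrict B).smul_measure hVtop
  -- splitting into the average and the deviation from it
  have hpt : ∀ j, ∀ᵐ p ∂spaceTimeMeasure, ‖Function.uncurry (w j) p‖ₑ ^ 2 ≤
      2 * (∫⁻ h, ‖Function.uncurry (w j) (shift h p) - Function.uncurry (w j) p‖ₑ ^ 2 ∂β) +
        2 * ‖A j p‖ₑ ^ 2 := by
    intro j
    filter_upwards [hslice] with p hp
    have hi : Integrable (fun h => Function.uncurry (w j) (shift h p)) β :=
      (hmemβ (hp j).1 p.2).integrable (by norm_num)
    have e1 : Function.uncurry (w j) p =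
        A j p - ∫ h, (Function.uncurry (w j) (shift h p) - Function.uncurry (w j) p) ∂β := by
      rw [integral_sub hi (integrable_const _)]
      simp [A]
    have hJ := enorm_integral_sq_le (hi.sub (integrable_const (Function.uncurry (w j) p))).1
    set z := ∫ h, (Function.uncurry (w j) (shift h p) - Function.uncurry (w j) p) ∂β with hz
    have e2 : ‖Function.uncurry (w j) p‖ₑ ^ 2 ≤ 2 * ‖z‖ₑ ^ 2 + 2 * ‖A j p‖ₑ ^ 2 := by
      conv_lhs => rw [e1]
      calc ‖A j p - z‖ₑ ^ 2 ≤ (‖A j p‖ₑ + ‖z‖ₑ) ^ 2 := by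
            gcongr
            exact enorm_sub_le
        _ ≤ 2 * ‖z‖ₑ ^ 2 + 2 * ‖A j p‖ₑ ^ 2 := by
            have : (‖A j p‖₊ + ‖z‖₊) ^ 2 ≤ 2 * ‖z‖₊ ^ 2 + 2 * ‖A j p‖₊ ^ 2 := by
              rw [← NNReal.coe_le_coe]
              push_cast
              nlinarith [sq_nonneg (‖A j p‖ - ‖z‖)]
            simp only [enorm]
            exact_mod_cast this
    refine e2.trans ?_
    gcongr
    exact hJ
  have hfirst : ∀ j, ∫⁻ p in S, 2 * (∫⁻ h, ‖Function.uncurry (w j) (shift h p) -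
      Function.uncurry (w j) p‖ₑ ^ 2 ∂β) ∂spaceTimeMeasure ≤ ε / 2 := by
    intro j
    refine le_trans ?_ hρ
    have hmd : AEMeasurable (fun q : (ℝ × R3) × R3 => ‖Function.uncurry (w j) (shift q.2 q.1) -
        Function.uncurry (w j) q.1‖ₑ ^ 2) (spaceTimeMeasure.prod β) :=
      (((hmshift j).sub ((hm j).comp_quasiMeasurePreserving
        Measure.quasiMeasurePreserving_fst)).enorm.pow_const 2)
    refine (setLIntegral_le_lintegral _ _).trans ?_
    rw [lintegral_const_mul' _ _ (by simp), lintegral_lintegral_swap hmd]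
    gcongr
    have hloc := isLocalInTimeL2_of_bound (hm j) ((hb j).mono fun t ht => ht.2)
    calc _ ≤ ∫⁻ _ : R3, (ENNReal.ofReal (3 * ρ) * N) ^ 2 ∂β := by
          refine lintegral_mono_ae ?_
          have hmem : ∀ᵐ h ∂β, h ∈ B :=
            Measure.ae_smul_measure (ae_restrict_mem measurableSet_ball) V
          filter_upwards [hmem] with h hh
          refine ((hD j).lintegral_shift_sub_le hloc h).trans ?_
          have : ‖h‖ ≤ ρ := by
            have := Metric.mem_ball.1 hh
            rw [dist_zero_right] at this
            exact this.le
          gcongr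
          exact hDN j
      _ = _ := by simp
  have hsecond : Tendsto (fun j => ∫⁻ p in S, 2 * ‖A j p‖ₑ ^ 2 ∂spaceTimeMeasure)
      atTop (𝓝 0) := by
    have h0 : ∫⁻ p in S, (0 : ℝ≥0∞) ∂spaceTimeMeasure = 0 := by simp
    rw [← h0]
    refine tendsto_lintegral_of_dominated_convergence' (fun _ => 2 * (V * M ^ 2))
      (fun j => ((hAm j).restrict.enorm.pow_const 2).const_mul 2) (fun j => ?_) ?_ ?_
    · refine ae_restrict_of_ae ?_
      filter_upwards [hslice] with p hp
      gcongr
      refine (enorm_integral_sq_le (hmemβ (hp j).1 p.2).1).trans ?_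
      rw [hβ, lintegral_smul_measure, smul_eq_mul]
      gcongr
      calc ∫⁻ h in B, ‖w j p.1 (p.2 + h)‖ₑ ^ 2 ≤ ∫⁻ h, ‖w j p.1 (p.2 + h)‖ₑ ^ 2 :=
            setLIntegral_le_lintegral _ _
        _ = ∫⁻ y, ‖w j p.1 y‖ₑ ^ 2 := lintegral_add_left_eq_self (fun y => ‖w j p.1 y‖ₑ ^ 2) p.2
        _ = eLpNorm (w j p.1) 2 volume ^ 2 := lintegral_enorm_sq_eq _
        _ ≤ M ^ 2 := by
          gcongr
          exact (hp j).2
    · rw [lintegral_const, Measure.restrict_apply_univ]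
      exact (ENNReal.mul_lt_top (ENNReal.mul_lt_top (by simp)
        (ENNReal.mul_lt_top hVtop.lt_top (by simp))) hS).ne
    · refine ae_restrict_of_ae ?_
      have hweak' : ∀ᵐ p ∂spaceTimeMeasure, ∀ ψ : R3 → R3, MemLp ψ 2 →
          Tendsto (fun j => ∫ x, inner ℝ (w j p.1 x) (ψ x)) atTop (𝓝 0) :=
        Measure.quasiMeasurePreserving_fst.ae hweak
      filter_upwards [hslice, hweak'] with p hp hpw
      have hA0 : Tendsto (fun j => A j p) atTop (𝓝 0) := by
        have hcomp : ∀ i : Fin 3, Tendsto (fun j => (A j p) i) atTop (𝓝 0) := by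
          intro i
          let ψ : R3 → R3 := (Metric.ball p.2 ρ).indicator fun _ => EuclideanSpace.single i (1 : ℝ)
          have hψ : MemLp ψ 2 := memLp_indicator_const 2 measurableSet_ball _
            (Or.inr measure_ball_lt_top.ne)
          have h1 := (hpw ψ hψ).const_mul V.toReal
          rw [mul_zero] at h1
          refine h1.congr fun j => ?_
          have hi : Integrable (fun h => w j p.1 (p.2 + h)) β :=
            (hmemβ (hp j).1 p.2).integrable (by norm_num)
          have e1 : (A j p) i = ∫ h, w j p.1 (p.2 + h) i ∂β :=
            ((EuclideanSpace.proj i : R3 →L[ℝ] ℝ).integral_comp_comm hi).symm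
          rw [e1, hβ, integral_smul_measure, smul_eq_mul]
          congr 1
          rw [← integral_indicator measurableSet_ball,
            ← integral_add_left_eq_self (fun x => inner ℝ (w j p.1 x) (ψ x)) p.2]
          refine integral_congr_ae (ae_of_all _ fun h => ?_)
          have hiff : p.2 + h ∈ Metric.ball p.2 ρ ↔ h ∈ B := by
            simp [B, Metric.mem_ball, dist_eq_norm]
          by_cases hh : h ∈ B
          · rw [indicator_of_mem hh]
            simp only [ψ]
            rw [indicator_of_mem (hiff.2 hh)]
            simp [EuclideanSpace.inner_single_right]
          · rw [indicator_of_notMem hh]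
            simp only [ψ]
            rw [indicator_of_notMem (fun h' => hh (hiff.1 h')), inner_zero_right]
        have := (PiLp.continuous_toLp 2 (fun _ : Fin 3 => ℝ)).tendsto 0 |>.comp
          (tendsto_pi_nhds.2 hcomp)
        exact this
      have h2 := ENNReal.Tendsto.const_mul ((ENNReal.continuous_pow 2).continuousAt.tendsto.comp
        hA0.enorm) (a := 2) (Or.inr (by simp))
      simpa using h2
  filter_upwards [ENNReal.tendsto_nhds_zero.1 hsecond (ε / 2) (ENNReal.half_pos hε.ne')] with j hj
  calc ∫⁻ p in S, ‖Function.uncurry (w j) p‖ₑ ^ 2 ∂spaceTimeMeasure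
      ≤ ∫⁻ p in S, (2 * (∫⁻ h, ‖Function.uncurry (w j) (shift h p) -
          Function.uncurry (w j) p‖ₑ ^ 2 ∂β) + 2 * ‖A j p‖ₑ ^ 2) ∂spaceTimeMeasure :=
        lintegral_mono_ae (ae_restrict_of_ae (hpt j))
    _ = (∫⁻ p in S, 2 * (∫⁻ h, ‖Function.uncurry (w j) (shift h p) -
          Function.uncurry (w j) p‖ₑ ^ 2 ∂β) ∂spaceTimeMeasure) +
          ∫⁻ p in S, 2 * ‖A j p‖ₑ ^ 2 ∂spaceTimeMeasure :=
        lintegral_add_right' _ (((hAm j).restrict.enorm.pow_const 2).const_mul 2)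
    _ ≤ ε / 2 + ε / 2 := add_le_add (hfirst j) hj
    _ = ε := ENNReal.add_halves ε

/-! ### The weak form in terms of integrals over space-time -/

section SpaceTimeTests

variable {φ : ℝ → R3 → R3}

theorem deriv_slice {ψ : ℝ × R3 → R3} (hψ : Differentiable ℝ ψ) (t : ℝ) (x : R3) :
    deriv (fun τ => ψ (τ, x)) t = fderiv ℝ ψ (t, x) (1, 0) := by
  have h1 : HasDerivAt (fun τ : ℝ => (τ, x)) (1, 0) t :=
    (hasDerivAt_id t).prodMk (hasDerivAt_const t x)
  exact ((hψ (t, x)).hasFDerivAt.comp_hasDerivAt t h1).deriv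

theorem laplacian_slice {ψ : ℝ × R3 → R3} (hψ : ContDiff ℝ ∞ ψ) (t : ℝ) (x : R3) :
    Δ (fun x => ψ (t, x)) x = ∑ i : Fin 3, fderiv ℝ (fun p => fderiv ℝ ψ p
      (0, EuclideanSpace.single i 1)) (t, x) (0, EuclideanSpace.single i 1) := by
  have h1 : ContDiff ℝ ∞ fun x => ψ (t, x) := hψ.comp (by fun_prop)
  rw [laplacian_eq_sum_fderiv (contDiff_two h1)]
  refine Finset.sum_congr rfl fun i _ => ?_
  have h2 : ContDiff ℝ ∞ fun p => fderiv ℝ ψ p (0, EuclideanSpace.single i (1 : ℝ)) :=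
    (hψ.fderiv_right (m := ∞) (by simp)).clm_apply contDiff_const
  simp only [fderiv_slice (hψ.differentiable (by simp))]
  exact fderiv_slice (h2.differentiable (by simp)) t x _

/-- The linear part `∂_t φ + νΔφ` of the weak form. -/
def linearPart (ν : ℝ) (φ : ℝ → R3 → R3) (p : ℝ × R3) : R3 :=
  deriv (fun τ => φ τ p.2) p.1 + ν • Δ (φ p.1) p.2

/-- The spatial derivative of a test field. -/
def spatialDeriv (φ : ℝ → R3 → R3) (p : ℝ × R3) : R3 →L[ℝ] R3 := fderiv ℝ (φ p.1) p.2

theorem spatialDeriv_eq (h : ContDiff ℝ ∞ (Function.uncurry φ)) (p : ℝ × R3) :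
    spatialDeriv φ p = (fderiv ℝ (Function.uncurry φ) p).comp (ContinuousLinearMap.inr ℝ ℝ R3) := by
  ext1 v
  exact fderiv_slice (h.differentiable (by simp)) p.1 p.2 v

theorem IsTestField.continuous_spatialDeriv (h : IsTestField φ) : Continuous (spatialDeriv φ) := by
  rw [show spatialDeriv φ = _ from funext (spatialDeriv_eq h.1)]
  exact (h.1.continuous_fderiv (by simp)).clm_comp continuous_const

theorem IsTestField.hasCompactSupport_spatialDeriv (h : IsTestField φ) :
    HasCompactSupport (spatialDeriv φ) := by
  rw [show spatialDeriv φ = _ from funext (spatialDeriv_eq h.1)]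
  exact (h.2.1.fderiv ℝ).comp_left
    (g := fun L : ℝ × R3 →L[ℝ] R3 => L.comp (ContinuousLinearMap.inr ℝ ℝ R3)) (by simp)

theorem linearPart_eq (h : ContDiff ℝ ∞ (Function.uncurry φ)) (ν : ℝ) (p : ℝ × R3) :
    linearPart ν φ p = fderiv ℝ (Function.uncurry φ) p (1, 0) + ν • ∑ i : Fin 3,
      fderiv ℝ (fun p => fderiv ℝ (Function.uncurry φ) p (0, EuclideanSpace.single i 1)) p
        (0, EuclideanSpace.single i 1) := by
  have h1 := deriv_slice (h.differentiable (by simp)) p.1 p.2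
  have h2 := laplacian_slice h p.1 p.2
  exact congrArg₂ (fun a b => a + ν • b) h1 h2

theorem IsTestField.continuous_linearPart (h : IsTestField φ) (ν : ℝ) :
    Continuous (linearPart ν φ) := by
  rw [show linearPart ν φ = _ from funext (linearPart_eq h.1 ν)]
  have h0 := h.1.continuous_fderiv (by simp)
  have h2 : ∀ i : Fin 3, ContDiff ℝ ∞ fun p => fderiv ℝ (Function.uncurry φ) p
      (0, EuclideanSpace.single i (1 : ℝ)) := fun i =>
    (h.1.fderiv_right (m := ∞) (by simp)).clm_apply contDiff_const
  exact (h0.clm_apply continuous_const).add ((continuous_finsetSum _ fun i _ =>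
    ((h2 i).continuous_fderiv (by simp)).clm_apply continuous_const).const_smul ν)

theorem IsTestField.hasCompactSupport_linearPart (h : IsTestField φ) (ν : ℝ) :
    HasCompactSupport (linearPart ν φ) := by
  rw [show linearPart ν φ = _ from funext (linearPart_eq h.1 ν)]
  have h1 : ∀ i : Fin 3, HasCompactSupport fun p => fderiv ℝ (fun p => fderiv ℝ
      (Function.uncurry φ) p (0, EuclideanSpace.single i (1 : ℝ))) p
      (0, EuclideanSpace.single i 1) := fun i =>
    (h.2.1.fderiv_apply ℝ _).fderiv_apply ℝ _
  refine (h.2.1.fderiv_apply ℝ _).add ?_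
  simp only [Fin.sum_univ_three]
  exact HasCompactSupport.smul_left (f := fun _ => ν) (((h1 0).add (h1 1)).add (h1 2))

end SpaceTimeTests

/-- A compactly supported function vanishes outside of a cylinder. As the space-time measure only
sees positive times, the cylinders need no lower bound in time. -/
theorem exists_cylinder {F : Type*} [NormedAddCommGroup F] {a : ℝ × R3 → F}
    (ha : HasCompactSupport a) : ∃ T : ℝ, ∀ p, a p ≠ 0 → p ∈ Iio T ×ˢ Metric.ball (0 : R3) T := by
  obtain ⟨B, hB⟩ := ha.isCompact.isBounded.subset_ball 0
  refine ⟨B, fun p hp => ?_⟩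
  have := hB (subset_tsupport _ hp)
  rw [Metric.mem_ball, dist_zero_right] at this
  refine ⟨(le_abs_self p.1).trans_lt ((norm_fst_le p).trans_lt this), ?_⟩
  rw [Metric.mem_ball, dist_zero_right]
  exact (norm_snd_le p).trans_lt this

theorem measurableSet_cylinder (T : ℝ) : MeasurableSet (Iio T ×ˢ Metric.ball (0 : R3) T) :=
  measurableSet_Iio.prod measurableSet_ball

theorem spaceTimeMeasure_cylinder_lt_top (T : ℝ) :
    spaceTimeMeasure (Iio T ×ˢ Metric.ball (0 : R3) T) < ⊤ := by
  rw [spaceTimeMeasure, Measure.prod_prod, timeMeasure, Measure.restrict_apply measurableSet_Iio,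
    inter_comm, Ioi_inter_Iio]
  exact ENNReal.mul_lt_top (by simp) measure_ball_lt_top

theorem IsLocalInTimeL2.memLp_cylinder {u : ℝ × R3 → R3} (hu : IsLocalInTimeL2 u) (T : ℝ) :
    MemLp u 2 (spaceTimeMeasure.restrict (Iio T ×ˢ Metric.ball (0 : R3) T)) := by
  have h1 := (hu T).restrict (Iio T ×ˢ Metric.ball (0 : R3) T)
  refine h1.ae_eq ?_
  filter_upwards [ae_restrict_mem (measurableSet_cylinder T)] with p hp
  exact indicator_of_mem (show p ∈ Iio T ×ˢ univ from ⟨hp.1, trivial⟩) _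

theorem integrable_inner_of_hasCompactSupport {u : ℝ × R3 → R3} (hu : IsLocalInTimeL2 u)
    {a : ℝ × R3 → R3} (ha : Continuous a) (hc : HasCompactSupport a) :
    Integrable (fun p => inner ℝ (u p) (a p)) spaceTimeMeasure := by
  obtain ⟨T, hT⟩ := exists_cylinder hc
  have h1 := integrable_inner_of_memLp (hu T) (ha.memLp_of_hasCompactSupport hc)
  refine h1.congr (ae_of_all _ fun p => ?_)
  by_cases h : a p = 0
  · simp [h]
  · have : p ∈ Iio T ×ˢ (univ : Set R3) := ⟨(hT p h).1, trivial⟩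
    simp [indicator_of_mem this]

theorem integrable_quadratic_of_hasCompactSupport {u : ℝ × R3 → R3} (hu : IsLocalInTimeL2 u)
    {A : ℝ × R3 → R3 →L[ℝ] R3} (hA : Continuous A) (hc : HasCompactSupport A) :
    Integrable (fun p => inner ℝ (u p) (A p (u p))) spaceTimeMeasure := by
  obtain ⟨T, hT⟩ := exists_cylinder hc
  obtain ⟨C, hC⟩ := hA.bounded_above_of_compact_support hc
  have hC' : ∀ x, ‖A x‖ ≤ C.toNNReal := fun x => (hC x).trans (Real.le_coe_toNNReal C)
  have h1 := integrable_inner_of_memLp (hu T) (memLp_clm_apply hA.aestronglyMeasurable hC' (hu T)).1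
  refine h1.congr (ae_of_all _ fun p => ?_)
  by_cases h : A p = 0
  · simp [h]
  · have : p ∈ Iio T ×ˢ (univ : Set R3) := ⟨(hT p h).1, trivial⟩
    simp [indicator_of_mem this]

/-- The left-hand side of the weak form as a sum of integrals over space-time. -/
theorem integral_weakForm_eq {u : ℝ → R3 → R3} (hu : IsLocalInTimeL2 (Function.uncurry u)) (ν : ℝ)
    {φ : ℝ → R3 → R3} (hφ : IsTestField φ) :
    ∫ t in Ioi (0 : ℝ), ∫ x,
      (inner ℝ (u t x) (deriv (fun τ => φ τ x) t + ν • Δ (φ t) x)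
        + inner ℝ (u t x) (fderiv ℝ (φ t) x (u t x))) =
    (∫ p, inner ℝ (Function.uncurry u p) (linearPart ν φ p) ∂spaceTimeMeasure) +
      ∫ p, inner ℝ (Function.uncurry u p) (spatialDeriv φ p (Function.uncurry u p))
        ∂spaceTimeMeasure := by
  have i1 := integrable_inner_of_hasCompactSupport hu (hφ.continuous_linearPart ν)
    (hφ.hasCompactSupport_linearPart ν)
  have i2 := integrable_quadratic_of_hasCompactSupport hu hφ.continuous_spatialDeriv
    hφ.hasCompactSupport_spatialDeriv
  rw [← integral_add i1 i2, spaceTimeMeasure, integral_prod _ (by exact i1.add i2)]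
  rfl

/-- Passage to the limit in the quadratic term under strong convergence on bounded sets. -/
theorem tendsto_integral_quadratic {u : ℕ → ℝ × R3 → R3} {u' : ℝ × R3 → R3}
    (hu : ∀ j, IsLocalInTimeL2 (u j)) (hu' : IsLocalInTimeL2 u')
    (hlim : ∀ T : ℝ, Tendsto (fun j => ∫⁻ p in Iio T ×ˢ Metric.ball (0 : R3) T,
      ‖u j p - u' p‖ₑ ^ 2 ∂spaceTimeMeasure) atTop (𝓝 0))
    {A : ℝ × R3 → R3 →L[ℝ] R3} (hA : Continuous A) (hc : HasCompactSupport A) :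
    Tendsto (fun j => ∫ p, inner ℝ (u j p) (A p (u j p)) ∂spaceTimeMeasure) atTop
      (𝓝 (∫ p, inner ℝ (u' p) (A p (u' p)) ∂spaceTimeMeasure)) := by
  obtain ⟨T, hT⟩ := exists_cylinder hc
  obtain ⟨C, hC⟩ := hA.bounded_above_of_compact_support hc
  have hC' : ∀ x, ‖A x‖ ≤ C.toNNReal := fun x => (hC x).trans (Real.le_coe_toNNReal C)
  set μ := spaceTimeMeasure.restrict (Iio T ×ˢ Metric.ball (0 : R3) T) with hμ
  have hsupp : ∀ v : ℝ × R3 → R3, ∫ p, inner ℝ (v p) (A p (v p)) ∂spaceTimeMeasure =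
      ∫ p, inner ℝ (v p) (A p (v p)) ∂μ := fun v => by
    refine (setIntegral_eq_integral_of_forall_compl_eq_zero fun p hp => ?_).symm
    have : A p = 0 := by
      by_contra h
      exact hp (hT p h)
    simp [this]
  simp only [hsupp]
  have m' : MemLp u' 2 μ := hu'.memLp_cylinder T
  have m : ∀ j, MemLp (u j) 2 μ := fun j => (hu j).memLp_cylinder T
  have mw : ∀ j, MemLp (fun p => u j p - u' p) 2 μ := fun j => (m j).sub m'
  have hAm : AEStronglyMeasurable A μ := hA.aestronglyMeasurable
  set a : ℕ → ℝ≥0 := fun j => (eLpNorm (fun p => u j p - u' p) 2 μ).toNNReal with ha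
  set b : ℝ≥0 := (eLpNorm u' 2 μ).toNNReal
  have hae : ∀ j, eLpNorm (fun p => u j p - u' p) 2 μ = a j := fun j =>
    (ENNReal.coe_toNNReal (mw j).2.ne).symm
  have hbe : eLpNorm u' 2 μ = b := (ENNReal.coe_toNNReal m'.2.ne).symm
  have ha0 : Tendsto (fun j => (a j : ℝ)) atTop (𝓝 0) := by
    have h1 := hlim T
    simp only [lintegral_enorm_sq_eq] at h1
    have h2 : Tendsto (fun j => (eLpNorm (fun p => u j p - u' p) 2 μ ^ 2) ^ (1 / 2 : ℝ)) atTop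
        (𝓝 0) := by
      have := (ENNReal.continuous_rpow_const (y := 1 / 2)).continuousAt.tendsto.comp h1
      rw [ENNReal.zero_rpow_of_pos (by norm_num)] at this
      exact this
    have h3 : ∀ j, (eLpNorm (fun p => u j p - u' p) 2 μ ^ 2) ^ (1 / 2 : ℝ) = a j := fun j => by
      rw [hae, ← ENNReal.rpow_natCast, ← ENNReal.rpow_mul]
      simp
    simp only [h3] at h2
    exact NNReal.tendsto_coe.2 (ENNReal.tendsto_coe.1 h2)
  have hbound : ∀ j, |(∫ p, inner ℝ (u j p) (A p (u j p)) ∂μ) -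
      ∫ p, inner ℝ (u' p) (A p (u' p)) ∂μ| ≤
        a j * (C.toNNReal * b) + a j * (C.toNNReal * a j) + b * (C.toNNReal * a j) := by
    intro j
    have A1 := memLp_clm_apply hAm hC' m'
    have A2 := memLp_clm_apply hAm hC' (mw j)
    have A3 := memLp_clm_apply hAm hC' (m j)
    have e : (∫ p, inner ℝ (u j p) (A p (u j p)) ∂μ) - ∫ p, inner ℝ (u' p) (A p (u' p)) ∂μ =
        (∫ p, inner ℝ (u j p - u' p) (A p (u' p)) ∂μ) +
        (∫ p, inner ℝ (u j p - u' p) (A p (u j p - u' p)) ∂μ) +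
        ∫ p, inner ℝ (u' p) (A p (u j p - u' p)) ∂μ := by
      have j1 := integrable_inner_of_memLp (mw j) A1.1
      have j2 := integrable_inner_of_memLp (mw j) A2.1
      have j3 := integrable_inner_of_memLp m' A2.1
      rw [← integral_sub (integrable_inner_of_memLp (m j) A3.1) (integrable_inner_of_memLp m' A1.1),
        ← integral_add j1 j2, ← integral_add (by exact j1.add j2) j3]
      refine integral_congr_ae (ae_of_all _ fun p => ?_)
      simp only [map_sub, inner_sub_left, inner_sub_right]
      ring
    rw [e]
    refine (abs_add_le _ _).trans (add_le_add ((abs_add_le _ _).trans (add_le_add ?_ ?_)) ?_)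
    · have := abs_integral_inner_le (b := C.toNNReal * b) (mw j) A1.1 (hae j).le
        (A1.2.trans (by rw [ENNReal.coe_mul, hbe]))
      simpa using this
    · have := abs_integral_inner_le (b := C.toNNReal * a j) (mw j) A2.1 (hae j).le
        (A2.2.trans (by rw [ENNReal.coe_mul, hae]))
      simpa using this
    · have := abs_integral_inner_le (b := C.toNNReal * a j) m' A2.1 hbe.le
        (A2.2.trans (by rw [ENNReal.coe_mul, hae]))
      simpa using this
  rw [tendsto_iff_dist_tendsto_zero]
  refine squeeze_zero (fun _ => dist_nonneg) (fun j => (Real.dist_eq _ _).le.trans (hbound j)) ?_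
  have h1 := (ha0.mul_const (C.toNNReal * b : ℝ)).add
    ((ha0.mul (ha0.const_mul (C.toNNReal : ℝ))))
  have h2 := h1.add ((ha0.const_mul (C.toNNReal : ℝ)).const_mul (b : ℝ))
  simpa using h2

/-- The weak gradient in terms of components and of integrals over space-time. -/
theorem isWeakGradient_iff {u : ℝ → R3 → R3} {G : ℝ → R3 → PiLp 2 (fun _ : Fin 3 => R3)}
    (hu : LocallyIntegrable (Function.uncurry u) spaceTimeMeasure)
    (hG : MemLp (Function.uncurry G) 2 spaceTimeMeasure) :
    IsWeakGradient u G ↔ ∀ ψ : ℝ × R3 → ℝ, ContDiff ℝ ∞ ψ → HasCompactSupport ψ →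
      tsupport ψ ⊆ Ioi 0 ×ˢ univ → ∀ k : Fin 3,
        ∫ p, fderiv ℝ ψ p (0, EuclideanSpace.single k 1) • Function.uncurry u p ∂spaceTimeMeasure =
          -∫ p, ψ p • Function.uncurry G p k ∂spaceTimeMeasure := by
  have key : ∀ ψ : ℝ × R3 → ℝ, ContDiff ℝ ∞ ψ → HasCompactSupport ψ → ∀ k : Fin 3,
      (∫ t in Ioi (0 : ℝ),
          ∫ x, (fderiv ℝ (fun x => ψ (t, x)) x (EuclideanSpace.single k 1)) • u t x =
        ∫ p, fderiv ℝ ψ p (0, EuclideanSpace.single k 1) • Function.uncurry u p ∂spaceTimeMeasure) ∧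
      (∫ t in Ioi (0 : ℝ), ∫ x, ψ (t, x) • G t x k =
        ∫ p, ψ p • Function.uncurry G p k ∂spaceTimeMeasure) := by
    intro ψ hψ hc k
    have hd := hψ.differentiable (by simp)
    have i1 : Integrable (fun p => fderiv ℝ ψ p (0, EuclideanSpace.single k 1) •
        Function.uncurry u p) spaceTimeMeasure :=
      hu.integrable_smul_left_of_hasCompactSupport
        ((hψ.continuous_fderiv (by simp)).clm_apply continuous_const) (hc.fderiv_apply ℝ _)
    have i2 : Integrable (fun p => ψ p • Function.uncurry G p k) spaceTimeMeasure :=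
      ((memLp_component hG k).locallyIntegrable
        (by norm_num)).integrable_smul_left_of_hasCompactSupport hψ.continuous hc
    rw [spaceTimeMeasure] at i1 i2 ⊢
    rw [integral_prod _ i1, integral_prod _ i2]
    simp only [fderiv_slice hd]
    exact ⟨rfl, rfl⟩
  refine ⟨fun h ψ hψ hc hs k => ?_, fun h => ⟨hG, fun φ hφ hc hs k => ?_⟩⟩
  · rw [← (key ψ hψ hc k).1, ← (key ψ hψ hc k).2]
    exact h.2 (fun t x => ψ (t, x)) hψ hc hs k
  · have e := h _ hφ hc hs k
    rw [← (key _ hφ hc k).1, ← (key _ hφ hc k).2] at e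
    exact e

theorem IsWeakGradient.sub {u v : ℝ → R3 → R3} {G H : ℝ → R3 → PiLp 2 (fun _ : Fin 3 => R3)}
    (hG : IsWeakGradient u G) (hH : IsWeakGradient v H)
    (hu : LocallyIntegrable (Function.uncurry u) spaceTimeMeasure)
    (hv : LocallyIntegrable (Function.uncurry v) spaceTimeMeasure) :
    IsWeakGradient (fun t x => u t x - v t x) (fun t x => G t x - H t x) := by
  have hmem : MemLp (Function.uncurry fun t x => G t x - H t x) 2 spaceTimeMeasure := hG.1.sub hH.1
  have hloc : LocallyIntegrable (Function.uncurry fun t x => u t x - v t x) spaceTimeMeasure :=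
    hu.sub hv
  rw [isWeakGradient_iff hloc hmem]
  intro ψ hψ hc hs k
  have e1 := (isWeakGradient_iff hu hG.1).1 hG ψ hψ hc hs k
  have e2 := (isWeakGradient_iff hv hH.1).1 hH ψ hψ hc hs k
  have hcd : Continuous fun p => fderiv ℝ ψ p (0, EuclideanSpace.single k (1 : ℝ)) :=
    (hψ.continuous_fderiv (by simp)).clm_apply continuous_const
  have i1 := hu.integrable_smul_left_of_hasCompactSupport hcd (hc.fderiv_apply ℝ _)
  have i2 := hv.integrable_smul_left_of_hasCompactSupport hcd (hc.fderiv_apply ℝ _)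
  have i3 := ((memLp_component hG.1 k).locallyIntegrable
        (by norm_num)).integrable_smul_left_of_hasCompactSupport hψ.continuous hc
  have i4 := ((memLp_component hH.1 k).locallyIntegrable
        (by norm_num)).integrable_smul_left_of_hasCompactSupport hψ.continuous hc
  have f1 : ∀ p, fderiv ℝ ψ p (0, EuclideanSpace.single k (1 : ℝ)) •
      (Function.uncurry fun t x => u t x - v t x) p =
      fderiv ℝ ψ p (0, EuclideanSpace.single k (1 : ℝ)) • Function.uncurry u p -
      fderiv ℝ ψ p (0, EuclideanSpace.single k (1 : ℝ)) • Function.uncurry v p := fun p =>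
    smul_sub _ _ _
  have f2 : ∀ p, ψ p • (Function.uncurry fun t x => G t x - H t x) p k =
      ψ p • Function.uncurry G p k - ψ p • Function.uncurry H p k := fun p =>
    smul_sub _ _ _
  simp only [f1, f2]
  rw [integral_sub i1 i2, integral_sub i3 i4, e1, e2]
  abel

/-! ### Almost everywhere convergence and total sets -/

/-- Equi-Lipschitz functions that converge in the sense of distributions converge almost
everywhere. -/
theorem ae_tendsto_of_equiLipschitz {F : ℕ → ℝ → ℝ} {F' : ℝ → ℝ} {K B : ℝ} (hK : 0 ≤ K)
    (hF : ∀ j, LocallyIntegrable (F j) timeMeasure) (hF' : LocallyIntegrable F' timeMeasure)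
    (hL : ∀ j, ∃ L : ℝ → ℝ, (∀ᵐ t ∂timeMeasure, F j t = L t) ∧ (∀ t, 0 < t → |L t| ≤ B + K * t) ∧
      ∀ s t, 0 < s → 0 < t → |L s - L t| ≤ K * |s - t|)
    (hw : ∀ η : ℝ → ℝ, ContDiff ℝ ∞ η → HasCompactSupport η →
      Tendsto (fun j => ∫ t, η t * F j t ∂timeMeasure) atTop (𝓝 (∫ t, η t * F' t ∂timeMeasure))) :
    ∀ᵐ t ∂timeMeasure, Tendsto (fun j => F j t) atTop (𝓝 (F' t)) := by
  choose L hFL hLB hLK using hL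
  have hmem : ∀ᵐ t ∂timeMeasure, t ∈ Ioi (0 : ℝ) := ae_restrict_mem measurableSet_Ioi
  have hcongr : ∀ (η : ℝ → ℝ) j, ∫ t, η t * F j t ∂timeMeasure = ∫ t, η t * L j t ∂timeMeasure :=
    fun η j => integral_congr_ae ((hFL j).mono fun t ht => by simp only [ht])
  have hLm : ∀ j, AEStronglyMeasurable (L j) timeMeasure := fun j =>
    (hF j).aestronglyMeasurable.congr (hFL j)
  have hLloc : ∀ j, LocallyIntegrable (L j) timeMeasure := by
    intro j x
    obtain ⟨s, hs, hi⟩ := hF j x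
    exact ⟨s, hs, hi.congr_fun_ae (ae_restrict_of_ae (hFL j))⟩
  have hcauchy : ∀ t : ℝ, 0 < t → ∃ l, Tendsto (fun j => L j t) atTop (𝓝 l) := by
    intro t ht
    refine cauchySeq_tendsto_of_complete (Metric.cauchySeq_iff'.2 fun ε hε => ?_)
    -- averages over a small interval around `t` converge and are close to the values at `t`
    obtain ⟨δ, hδ0, hδt, hδ⟩ : ∃ δ : ℝ, 0 < δ ∧ δ < t ∧ K * δ ≤ ε / 4 := by
      refine ⟨min (t / 2) (ε / (4 * (K + 1))), by positivity, ?_, ?_⟩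
      · exact (min_le_left _ _).trans_lt (by linarith)
      · calc K * min (t / 2) (ε / (4 * (K + 1))) ≤ (K + 1) * (ε / (4 * (K + 1))) := by
              gcongr
              · linarith
              · exact min_le_right _ _
          _ = ε / 4 := by field_simp
    let χ : ContDiffBump t := ⟨δ / 2, δ, by positivity, by linarith⟩
    let η : ℝ → ℝ := χ.normed volume
    have hη : ContDiff ℝ ∞ η := χ.contDiff_normed
    have hηc : HasCompactSupport η := χ.hasCompactSupport_normed
    have hη0 : ∀ s, 0 ≤ η s := χ.nonneg_normed
    have hηs : ∀ s, η s ≠ 0 → |s - t| < δ := by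
      intro s hs
      have h1 : s ∈ Function.support (χ.normed volume) := hs
      rw [χ.support_normed_eq] at h1
      exact h1
    have hηi : Integrable η timeMeasure :=
      (hη.continuous.integrable_of_hasCompactSupport hηc).mono_measure Measure.restrict_le_self
    have hη1 : ∫ s, η s ∂timeMeasure = 1 := by
      rw [timeMeasure, setIntegral_eq_integral_of_forall_compl_eq_zero]
      · exact χ.integral_normed
      · intro s hs
        by_contra h
        have h1 := hηs s h
        rw [abs_lt] at h1
        exact hs (show 0 < s by linarith [h1.1])
    have hclose : ∀ j, |(∫ s, η s * L j s ∂timeMeasure) - L j t| ≤ ε / 4 := by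
      intro j
      have i1 : Integrable (fun s => η s * L j s) timeMeasure :=
        (hLloc j).integrable_smul_left_of_hasCompactSupport hη.continuous hηc
      have e1 : (∫ s, η s * L j s ∂timeMeasure) - L j t =
          ∫ s, η s * (L j s - L j t) ∂timeMeasure := by
        simp only [mul_sub]
        rw [integral_sub i1 (hηi.mul_const _), integral_mul_const, hη1, one_mul]
      rw [e1]
      calc |∫ s, η s * (L j s - L j t) ∂timeMeasure| ≤ ∫ s, η s * (ε / 4) ∂timeMeasure := by
            rw [← Real.norm_eq_abs]
            refine norm_integral_le_of_norm_le (hηi.mul_const (ε / 4)) ?_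
            filter_upwards [hmem] with s hs
            rw [Real.norm_eq_abs, abs_mul, abs_of_nonneg (hη0 s)]
            by_cases h : η s = 0
            · simp [h]
            · refine mul_le_mul_of_nonneg_left ?_ (hη0 s)
              refine (hLK j s t hs ht).trans (le_trans ?_ hδ)
              exact mul_le_mul_of_nonneg_left (hηs s h).le hK
        _ = ε / 4 := by rw [integral_mul_const, hη1, one_mul]
    have hconv := (hw η hη hηc).cauchySeq
    simp only [hcongr] at hconv
    obtain ⟨N, hN⟩ := Metric.cauchySeq_iff'.1 hconv (ε / 4) (by positivity)
    refine ⟨N, fun n hn => ?_⟩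
    have h1 := hN n hn
    rw [Real.dist_eq] at h1 ⊢
    have h2 := abs_le.1 (hclose n)
    have h3 := abs_le.1 (hclose N)
    have h4 := abs_lt.1 h1
    rw [abs_lt]
    constructor <;> linarith [h2.1, h2.2, h3.1, h3.2, h4.1, h4.2]
  choose! l hl using hcauchy
  have hllim : ∀ᵐ t ∂timeMeasure, Tendsto (fun j => L j t) atTop (𝓝 (l t)) := by
    filter_upwards [hmem] with t ht using hl t ht
  have hlm : AEStronglyMeasurable l timeMeasure :=
    aestronglyMeasurable_of_tendsto_ae atTop hLm hllim
  have hlB : ∀ᵐ t ∂timeMeasure, |l t| ≤ B + K * t := by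
    filter_upwards [hmem] with t ht
    exact le_of_tendsto (hl t ht).abs (Eventually.of_forall fun j => hLB j t ht)
  have hlloc : LocallyIntegrable l timeMeasure := by
    have hc : Continuous fun t : ℝ => B + K * t := by fun_prop
    refine hc.locallyIntegrable.mono hlm ?_
    filter_upwards [hlB] with t ht using ht.trans (le_abs_self _)
  have hlF : ∀ᵐ t ∂timeMeasure, l t - F' t = 0 := by
    refine ae_eq_zero_of_integral_contDiff_smul_eq_zero (hlloc.sub hF') fun η hη hηc => ?_
    have i1 : Integrable (fun s => η s * l s) timeMeasure :=
      hlloc.integrable_smul_left_of_hasCompactSupport hη.continuous hηc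
    have i2 : Integrable (fun s => η s * F' s) timeMeasure :=
      hF'.integrable_smul_left_of_hasCompactSupport hη.continuous hηc
    have hdom : Tendsto (fun j => ∫ t, η t * L j t ∂timeMeasure) atTop
        (𝓝 (∫ t, η t * l t ∂timeMeasure)) := by
      refine tendsto_integral_of_dominated_convergence (fun t => ‖η t * (B + K * t)‖)
        (fun j => hη.continuous.aestronglyMeasurable.mul (hLm j)) ?_ (fun j => ?_) ?_
      · have : Continuous fun t => η t * (B + K * t) := hη.continuous.mul (by fun_prop)
        exact (this.integrable_of_hasCompactSupport hηc.mul_right).norm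
      · filter_upwards [hmem] with t ht
        rw [norm_mul, norm_mul]
        exact mul_le_mul_of_nonneg_left ((hLB j t ht).trans (le_abs_self _)) (norm_nonneg _)
      · filter_upwards [hllim] with t ht using ht.const_mul _
    have h1 := hw η hη hηc
    simp only [hcongr] at h1
    have h2 := tendsto_nhds_unique hdom h1
    simp only [smul_eq_mul, mul_sub]
    rw [integral_sub i1 i2, h2, sub_self]
  have hall : ∀ᵐ t ∂timeMeasure, ∀ j, F j t = L j t := ae_all_iff.2 hFL
  filter_upwards [hllim, hlF, hall] with t h1 h2 h3
  simp only [h3]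
  rwa [sub_eq_zero.1 h2] at h1

/-- Weak convergence of a bounded sequence in a Hilbert space can be tested on a total set. -/
theorem tendsto_inner_of_total {H : Type*} [NormedAddCommGroup H] [InnerProductSpace ℝ H]
    [CompleteSpace H] {a : ℕ → H} {a' : H} {M : ℝ} (hM : ∀ j, ‖a j‖ ≤ M) {D : Set H}
    (hD : ∀ g, (∀ d ∈ D, inner ℝ d g = 0) → g = 0)
    (h : ∀ d ∈ D, Tendsto (fun j => inner ℝ (a j) d) atTop (𝓝 (inner ℝ a' d))) (g : H) :
    Tendsto (fun j => inner ℝ (a j) g) atTop (𝓝 (inner ℝ a' g)) := by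
  let E : Submodule ℝ H :=
    { carrier := {g | Tendsto (fun j => inner ℝ (a j) g) atTop (𝓝 (inner ℝ a' g))}
      zero_mem' := by simp
      add_mem' := fun {x y} hx hy => by
        simp only [mem_ofPred_eq, inner_add_right] at *
        exact hx.add hy
      smul_mem' := fun c x hx => by
        simp only [mem_ofPred_eq, inner_smul_right] at *
        exact hx.const_mul c }
  have hclosed : IsClosed (E : Set H) := by
    refine isClosed_of_closure_subset fun x hx => ?_
    change Tendsto (fun j => inner ℝ (a j) x) atTop (𝓝 (inner ℝ a' x))
    rw [Metric.tendsto_atTop]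
    intro ε hε
    set R := |M| + ‖a'‖ + 1
    have hR : 0 < R := by positivity
    obtain ⟨y, hy, hxy⟩ := Metric.mem_closure_iff.1 hx (ε / (2 * R)) (by positivity)
    have hy' : Tendsto (fun j => inner ℝ (a j) y) atTop (𝓝 (inner ℝ a' y)) := hy
    obtain ⟨N, hN⟩ := Metric.tendsto_atTop.1 hy' (ε / 2) (by positivity)
    refine ⟨N, fun n hn => ?_⟩
    have h1 := hN n hn
    rw [Real.dist_eq] at h1 ⊢
    have e : inner ℝ (a n) x - inner ℝ a' x =
        inner ℝ (a n - a') (x - y) + (inner ℝ (a n) y - inner ℝ a' y) := by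
      simp only [inner_sub_left, inner_sub_right]; ring
    rw [e]
    have h2 : |inner ℝ (a n - a') (x - y)| ≤ ε / 2 := by
      refine (abs_real_inner_le_norm _ _).trans ?_
      have h3 : ‖a n - a'‖ ≤ R := by
        refine (norm_sub_le _ _).trans ?_
        have := (hM n).trans (le_abs_self M)
        simp only [R]; linarith
      rw [dist_eq_norm] at hxy
      calc ‖a n - a'‖ * ‖x - y‖ ≤ R * (ε / (2 * R)) := by gcongr
        _ = ε / 2 := by field_simp
    calc _ ≤ _ := abs_add_le _ _
      _ < ε / 2 + ε / 2 := by linarith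
      _ = ε := by ring
  have hEc : CompleteSpace E := hclosed.completeSpace_coe
  have htop : E = ⊤ := by
    rw [← Submodule.orthogonal_eq_bot_iff, Submodule.eq_bot_iff]
    intro g hg
    exact hD g fun d hd => (Submodule.mem_orthogonal E g).1 hg d (h d hd)
  have : g ∈ E := by rw [htop]; trivial
  exact this

/-- The classical gradient field of a scalar function. -/
def gradField (ψ : R3 → ℝ) (x : R3) : R3 := ∑ k, pderiv k ψ x • EuclideanSpace.single k (1 : ℝ)

theorem inner_gradField (ψ : R3 → ℝ) (x v : R3) : inner ℝ v (gradField ψ x) = fderiv ℝ ψ x v := by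
  rw [fderiv_apply_eq_sum_pderiv, PiLp.inner_apply]
  simp [gradField, Finset.sum_apply, Pi.single_apply, mul_comm]

theorem contDiff_gradField {ψ : R3 → ℝ} (hψ : ContDiff ℝ ∞ ψ) : ContDiff ℝ ∞ (gradField ψ) :=
  ContDiff.sum fun k _ => (contDiff_pderiv hψ k).smul contDiff_const

theorem hasCompactSupport_gradField {ψ : R3 → ℝ} (hψ : HasCompactSupport ψ) :
    HasCompactSupport (gradField ψ) := by
  have h : ∀ k, HasCompactSupport fun x => pderiv k ψ x • EuclideanSpace.single k (1 : ℝ) :=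
    fun k => (hasCompactSupport_pderiv hψ k).smul_right
  unfold gradField
  simp only [Fin.sum_univ_three]
  exact ((h 0).add (h 1)).add (h 2)

theorem memLp_gradField {ψ : R3 → ℝ} (hψ : ContDiff ℝ ∞ ψ) (hc : HasCompactSupport ψ) :
    MemLp (gradField ψ) 2 (volume : Measure R3) :=
  (contDiff_gradField hψ).continuous.memLp_of_hasCompactSupport (hasCompactSupport_gradField hc)

theorem isDivFree_congr {f g : R3 → R3} (h : f =ᵐ[volume] g) (hf : IsDivFree f) : IsDivFree g := by
  intro ψ h1 h2
  rw [← hf ψ h1 h2]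
  refine integral_congr_ae ?_
  filter_upwards [h] with x hx
  rw [hx]

theorem mem_L2sigma_iff (f : Lp R3 2 (volume : Measure R3)) :
    f ∈ L2sigma ↔ ∀ ψ (h1 : ContDiff ℝ ∞ ψ) (h2 : HasCompactSupport ψ),
      inner ℝ f ((memLp_gradField h1 h2).toLp) = 0 := by
  have key : ∀ ψ (h1 : ContDiff ℝ ∞ ψ) (h2 : HasCompactSupport ψ),
      inner ℝ f ((memLp_gradField h1 h2).toLp) = ∫ x, fderiv ℝ ψ x (f x) := by
    intro ψ h1 h2
    rw [L2.inner_def]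
    refine integral_congr_ae ?_
    filter_upwards [(memLp_gradField h1 h2).coeFn_toLp] with x hx
    rw [hx, inner_gradField]
  constructor
  · intro h ψ h1 h2
    rw [key ψ h1 h2]
    exact h ψ h1 h2
  · intro h ψ h1 h2
    rw [← key ψ h1 h2]
    exact h ψ h1 h2

theorem isClosed_L2sigma : IsClosed (L2sigma : Set (Lp R3 2 (volume : Measure R3))) := by
  have : (L2sigma : Set (Lp R3 2 (volume : Measure R3))) = ⋂ (ψ : R3 → ℝ) (h1 : ContDiff ℝ ∞ ψ)
      (h2 : HasCompactSupport ψ), {f | inner ℝ f ((memLp_gradField h1 h2).toLp) = 0} := by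
    ext f
    simp only [mem_iInter, mem_ofPred_eq, SetLike.mem_coe]
    exact mem_L2sigma_iff f
  rw [this]
  exact isClosed_iInter fun ψ => isClosed_iInter fun h1 => isClosed_iInter fun h2 =>
    isClosed_eq (by fun_prop) continuous_const

theorem ae_memLp_slice {v : ℝ × R3 → R3} (hv : MemLp v 2 spaceTimeMeasure) :
    ∀ᵐ t ∂timeMeasure, MemLp (fun x => v (t, x)) 2 volume := by
  have h1 : ∫⁻ p, ‖v p‖ₑ ^ 2 ∂spaceTimeMeasure < ⊤ := by
    rw [lintegral_enorm_sq_eq]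
    exact ENNReal.pow_lt_top hv.2
  rw [spaceTimeMeasure, lintegral_prod _ (hv.1.enorm.pow_const 2)] at h1
  have h2 := ae_lt_top' (AEMeasurable.lintegral_prod_right' (hv.1.enorm.pow_const 2)) h1.ne
  have h3 := hv.1.prodMk_left
  filter_upwards [h2, h3] with t ht1 ht2
  refine ⟨ht2, ?_⟩
  rw [lintegral_enorm_sq_eq] at ht1
  exact (ENNReal.pow_lt_top_iff.1 ht1).resolve_right two_ne_zero

/-! ### Weak limits in weighted space-time -/

/-- Bounded sequences in a separable Hilbert space have weakly convergent subsequences, by the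
sequential Banach-Alaoglu theorem and the Riesz representation. -/
theorem exists_subseq_weakly_convergent {H : Type*} [NormedAddCommGroup H] [InnerProductSpace ℝ H]
    [CompleteSpace H] [TopologicalSpace.SeparableSpace H] (x : ℕ → H) (C : ℝ)
    (hx : ∀ n, ‖x n‖ ≤ C) :
    ∃ (y : H) (σ : ℕ → ℕ), StrictMono σ ∧ ‖y‖ ≤ C ∧
      ∀ z, Tendsto (fun n => inner ℝ (x (σ n)) z) atTop (𝓝 (inner ℝ y z)) := by
  have hs := WeakDual.isSeqCompact_closedBall ℝ H 0 C
  obtain ⟨y', hy', σ, hσ, hlim⟩ := @hs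
    (fun n => StrongDual.toWeakDual (InnerProductSpace.toDual ℝ H (x n))) (fun n => by
      simpa using hx n)
  refine ⟨(InnerProductSpace.toDual ℝ H).symm (WeakDual.toStrongDual y'), σ, hσ, ?_, fun z => ?_⟩
  · simpa using hy'
  · have := ((WeakDual.eval_continuous z).tendsto y').comp hlim
    rw [InnerProductSpace.toDual_symm_apply]
    exact this

/-- Sequential weak compactness of balls of `L²`, in terms of functions. -/
theorem exists_subseq_weak_memLp {E : Type*} [NormedAddCommGroup E] [InnerProductSpace ℝ E]
    [CompleteSpace E] [SecondCountableTopology E] {v : ℕ → ℝ × R3 → E} {C : ℝ≥0}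
    (hv : ∀ j, MemLp (v j) 2 spaceTimeMeasure) (hC : ∀ j, eLpNorm (v j) 2 spaceTimeMeasure ≤ C) :
    ∃ (σ : ℕ → ℕ) (v' : ℝ × R3 → E), StrictMono σ ∧ MemLp v' 2 spaceTimeMeasure ∧
      eLpNorm v' 2 spaceTimeMeasure ≤ C ∧ ∀ ζ, MemLp ζ 2 spaceTimeMeasure →
        Tendsto (fun j => ∫ p, inner ℝ (v (σ j) p) (ζ p) ∂spaceTimeMeasure) atTop
          (𝓝 (∫ p, inner ℝ (v' p) (ζ p) ∂spaceTimeMeasure)) := by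
  have : Fact ((2 : ℝ≥0∞) ≠ ⊤) := ⟨by simp⟩
  obtain ⟨y, σ, hσ, hy, hlim⟩ := exists_subseq_weakly_convergent
    (fun j => (hv j).toLp (v j)) C fun j => by
      rw [Lp.norm_toLp]
      exact ENNReal.toReal_le_coe_of_le_coe (hC j)
  refine ⟨σ, y, hσ, Lp.memLp y, ?_, fun ζ hζ => ?_⟩
  · rw [Lp.norm_def] at hy
    rw [← ENNReal.ofReal_coe_nnreal]
    exact ENNReal.le_ofReal_iff_toReal_le (Lp.eLpNorm_ne_top y) C.2 |>.2 hy
  · have h := hlim (hζ.toLp ζ)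
    simp only [← integral_inner_eq_inner_toLp (hv _) hζ] at h
    rw [show (y : Lp E 2 spaceTimeMeasure) = (Lp.memLp y).toLp y from (Lp.toLp_coeFn _ _).symm,
      ← integral_inner_eq_inner_toLp (Lp.memLp y) hζ] at h
    exact h

/-- A field bounded in `L²` uniformly in time becomes square integrable over space-time after
multiplication by `e^{-t}`. -/
theorem memLp_exp_smul {u : ℝ → R3 → R3}
    (hm : AEStronglyMeasurable (Function.uncurry u) spaceTimeMeasure) {M : ℝ≥0}
    (hM : ∀ᵐ t ∂timeMeasure, eLpNorm (u t) 2 volume ≤ M) :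
    MemLp (fun p => Real.exp (-p.1) • Function.uncurry u p) 2 spaceTimeMeasure ∧
      eLpNorm (fun p => Real.exp (-p.1) • Function.uncurry u p) 2 spaceTimeMeasure ≤ M := by
  have hm' : AEStronglyMeasurable (fun p : ℝ × R3 => Real.exp (-p.1) • Function.uncurry u p)
      spaceTimeMeasure := by
    have : Continuous fun p : ℝ × R3 => Real.exp (-p.1) := by fun_prop
    exact this.aestronglyMeasurable.smul hm
  have hle : eLpNorm (fun p => Real.exp (-p.1) • Function.uncurry u p) 2 spaceTimeMeasure ≤ M := by
    rw [← ENNReal.pow_le_pow_left_iff two_ne_zero, ← lintegral_enorm_sq_eq, spaceTimeMeasure,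
      lintegral_prod _ (hm'.enorm.pow_const 2)]
    calc ∫⁻ t, ∫⁻ x, ‖Real.exp (-t) • u t x‖ₑ ^ 2 ∂volume ∂timeMeasure
        ≤ ∫⁻ t, ENNReal.ofReal (Real.exp (-t)) * (M : ℝ≥0∞) ^ 2 ∂timeMeasure := by
          refine lintegral_mono_ae ?_
          filter_upwards [hM, ae_restrict_mem (s := Ioi (0 : ℝ)) measurableSet_Ioi] with t ht ht0
          have h0 : ENNReal.ofReal (Real.exp (-t)) ^ 2 ≤ ENNReal.ofReal (Real.exp (-t)) := by
            rw [← ENNReal.ofReal_pow (Real.exp_pos _).le]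
            refine ENNReal.ofReal_le_ofReal ?_
            have h1 : Real.exp (-t) ≤ 1 := Real.exp_le_one_iff.2 (by simpa using (le_of_lt ht0))
            nlinarith [Real.exp_pos (-t)]
          simp only [enorm_smul, mul_pow, Real.enorm_of_nonneg (Real.exp_pos _).le]
          rw [lintegral_const_mul' _ _ (by finiteness), lintegral_enorm_sq_eq]
          gcongr
      _ = (M : ℝ≥0∞) ^ 2 := by
          rw [lintegral_mul_const' _ _ (by finiteness), timeMeasure,
            ← ofReal_integral_eq_lintegral_ofReal (integrableOn_exp_neg_Ioi 0)
              (Eventually.of_forall fun t => (Real.exp_pos _).le), integral_exp_neg_Ioi_zero]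
          simp
  exact ⟨⟨hm', hle.trans_lt ENNReal.coe_lt_top⟩, hle⟩

/-- `e^t η(t) ψ(x)`, the tensor product with the inverse of the weight `e^{-t}`, is square
integrable. -/
theorem memLp_exp_tensor {η : ℝ → ℝ} (hη : Continuous η) (hηc : HasCompactSupport η)
    {ψ : R3 → R3} (hψ : MemLp ψ 2 volume) :
    MemLp (fun p : ℝ × R3 => Real.exp p.1 • η p.1 • ψ p.2) 2 spaceTimeMeasure := by
  have h1 : MemLp (fun t => Real.exp t * η t) 2 timeMeasure :=
    ((Real.continuous_exp.mul hη).memLp_of_hasCompactSupport hηc.mul_left).mono_measure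
      Measure.restrict_le_self
  simp only [smul_smul]
  have hm : AEStronglyMeasurable (fun p : ℝ × R3 => (Real.exp p.1 * η p.1) • ψ p.2)
      spaceTimeMeasure :=
    (h1.1.comp_fst).smul (hψ.1.comp_snd)
  refine ⟨hm, ?_⟩
  refine (ENNReal.pow_lt_top_iff.1 (?_ : _ ^ 2 < ⊤)).resolve_right two_ne_zero
  rw [← lintegral_enorm_sq_eq, spaceTimeMeasure,
    lintegral_prod _ (hm.enorm.pow_const 2)]
  simp only [enorm_smul, mul_pow]
  simp_rw [lintegral_const_mul' _ _ (ENNReal.pow_ne_top enorm_ne_top), lintegral_enorm_sq_eq ψ]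
  rw [lintegral_mul_const' _ _ (ENNReal.pow_ne_top hψ.2.ne), lintegral_enorm_sq_eq]
  exact ENNReal.mul_lt_top (ENNReal.pow_lt_top h1.2) (ENNReal.pow_lt_top hψ.2)

theorem integral_tensor {u : ℝ → R3 → R3}
    (hu : MemLp (fun p => Real.exp (-p.1) • Function.uncurry u p) 2 spaceTimeMeasure)
    {η : ℝ → ℝ} (hη : Continuous η) (hηc : HasCompactSupport η)
    {ψ : R3 → R3} (hψ : MemLp ψ 2 volume) :
    Integrable (fun t => η t * pairing (u t) ψ) timeMeasure ∧
    ∫ p, inner ℝ (Real.exp (-p.1) • Function.uncurry u p) (Real.exp p.1 • η p.1 • ψ p.2)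
      ∂spaceTimeMeasure = ∫ t, η t * pairing (u t) ψ ∂timeMeasure := by
  have i1 := integrable_inner_of_memLp hu (memLp_exp_tensor hη hηc hψ)
  have e : (fun p : ℝ × R3 => inner ℝ (Real.exp (-p.1) • Function.uncurry u p)
      (Real.exp p.1 • η p.1 • ψ p.2)) =
      fun p => η p.1 * inner ℝ (Function.uncurry u p) (ψ p.2) := by
    funext p
    rw [real_inner_smul_left, real_inner_smul_right, real_inner_smul_right, ← mul_assoc,
      ← Real.exp_add, neg_add_cancel, Real.exp_zero, one_mul]
  rw [e] at i1 ⊢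
  rw [spaceTimeMeasure] at i1 ⊢
  have h1 := i1.integral_prod_left
  have e2 : (fun t => ∫ x, η t * inner ℝ (Function.uncurry u (t, x)) (ψ x)) =
      fun t => η t * pairing (u t) ψ := by
    funext t
    rw [integral_const_mul]
    rfl
  rw [e2] at h1
  refine ⟨h1, ?_⟩
  rw [integral_prod _ i1, e2]

theorem isLocalInTimeL2_of_exp {u : ℝ → R3 → R3}
    (hu : MemLp (fun p => Real.exp (-p.1) • Function.uncurry u p) 2 spaceTimeMeasure) :
    IsLocalInTimeL2 (Function.uncurry u) := by
  intro T
  have hc : Measurable fun p : ℝ × R3 => (Iio T).indicator Real.exp p.1 :=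
    (Real.measurable_exp.indicator measurableSet_Iio).comp measurable_fst
  have h : MemLp (fun p => (Iio T).indicator Real.exp p.1 • Real.exp (-p.1) • Function.uncurry u p)
      2 spaceTimeMeasure :=
    hu.of_le_mul (c := Real.exp T) (hc.aestronglyMeasurable.smul hu.1)
      (Eventually.of_forall fun p => by
      change ‖(Iio T).indicator Real.exp p.1 • Real.exp (-p.1) • Function.uncurry u p‖ ≤ _
      rw [norm_smul ((Iio T).indicator Real.exp p.1)]
      refine mul_le_mul_of_nonneg_right ?_ (norm_nonneg _)
      by_cases hp : p.1 ∈ Iio T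
      · rw [indicator_of_mem hp, Real.norm_of_nonneg (Real.exp_pos _).le]
        exact Real.exp_le_exp.2 (le_of_lt hp)
      · rw [indicator_of_notMem hp, norm_zero]
        exact (Real.exp_pos _).le)
  refine h.ae_eq (Eventually.of_forall fun p => ?_)
  by_cases hp : p.1 ∈ Iio T
  · have hp' : p ∈ Iio T ×ˢ (univ : Set R3) := ⟨hp, trivial⟩
    simp only [indicator_of_mem hp, indicator_of_mem hp']
    rw [smul_smul, ← Real.exp_add, add_neg_cancel, Real.exp_zero, one_smul]
  · have hp' : p ∉ Iio T ×ˢ (univ : Set R3) := fun h => hp h.1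
    simp only [indicator_of_notMem hp, indicator_of_notMem hp', zero_smul]

theorem locallyIntegrable_pairing {u : ℝ → R3 → R3}
    (hu : MemLp (fun p => Real.exp (-p.1) • Function.uncurry u p) 2 spaceTimeMeasure)
    {ψ : R3 → R3} (hψ : MemLp ψ 2 volume) :
    LocallyIntegrable (fun t => pairing (u t) ψ) timeMeasure := by
  intro t
  let χ : ContDiffBump t := ⟨1, 2, one_pos, one_lt_two⟩
  have h := (integral_tensor hu χ.continuous χ.hasCompactSupport hψ).1
  refine ⟨Metric.ball t 1, Metric.ball_mem_nhds t one_pos, ?_⟩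
  refine (h.integrableOn (s := Metric.ball t 1)).congr_fun (fun s hs => ?_) measurableSet_ball
  simp only [χ.one_of_mem_closedBall (Metric.ball_subset_closedBall hs), one_mul]

/-! ### Weak convergence at almost every time -/

theorem IsSolenoidalTest.memLp {φ : R3 → R3} (hφ : IsSolenoidalTest φ) :
    MemLp φ 2 (volume : Measure R3) :=
  hφ.smooth.continuous.memLp_of_hasCompactSupport hφ.compact

/-- A countable set of solenoidal test fields that is total in `L²_σ`. -/
theorem exists_countable_solenoidal : ∃ D : Set (R3 → R3), D.Countable ∧
    (∀ φ ∈ D, IsSolenoidalTest φ) ∧ ∀ g ∈ L2sigma, (∀ φ ∈ D, pairing g φ = 0) → g = 0 := by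
  have : Fact ((2 : ℝ≥0∞) ≠ ⊤) := ⟨by simp⟩
  let S : Set (Lp R3 2 (volume : Measure R3)) := {d | ∃ φ, ∃ h : IsSolenoidalTest φ,
    d = h.memLp.toLp}
  obtain ⟨E, hES, hEc, hE⟩ :=
    (TopologicalSpace.IsSeparable.of_separableSpace S).exists_countable_dense_subset
  have hES' : ∀ d ∈ E, ∃ φ, ∃ h : IsSolenoidalTest φ, d = h.memLp.toLp := hES
  choose! F hF1 hF2 using hES'
  have hpair : ∀ (g : Lp R3 2 (volume : Measure R3)) {φ} (h : IsSolenoidalTest φ),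
      pairing g φ = inner ℝ g h.memLp.toLp := by
    intro g φ h
    rw [pairing, integral_inner_eq_inner_toLp (Lp.memLp g) h.memLp, Lp.toLp_coeFn]
  refine ⟨F '' E, hEc.image F, ?_, fun g hg h => ?_⟩
  · rintro _ ⟨d, hd, rfl⟩
    exact hF1 d hd
  · have hcl : closure E ⊆ {d | inner ℝ g d = 0} :=
      closure_minimal (fun d hd => by
        have h1 := h (F d) ⟨d, hd, rfl⟩
        rw [hpair g (hF1 d hd), ← hF2 d hd] at h1
        exact h1) (isClosed_eq (by fun_prop) continuous_const)
    have h0 := ae_eq_zero_of_orthogonal_solenoidal (Lp.memLp g) hg fun φ hφ => by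
      have h2 := hpair g hφ
      rw [pairing] at h2
      rw [h2]
      exact hcl (hE ⟨φ, hφ, rfl⟩)
    exact (Lp.eq_zero_iff_ae_eq_zero).2 h0

/-- Solenoidality can be tested with countably many scalar functions. -/
theorem exists_countable_gradient : ∃ D : Set (R3 → ℝ), D.Countable ∧
    (∀ ψ ∈ D, ContDiff ℝ ∞ ψ ∧ HasCompactSupport ψ) ∧
      ∀ v : R3 → R3, MemLp v 2 → (∀ ψ ∈ D, pairing v (gradField ψ) = 0) → IsDivFree v := by
  have : Fact ((2 : ℝ≥0∞) ≠ ⊤) := ⟨by simp⟩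
  let S : Set (Lp R3 2 (volume : Measure R3)) := {d | ∃ ψ, ∃ h : ContDiff ℝ ∞ ψ,
    ∃ h' : HasCompactSupport ψ, d = (memLp_gradField h h').toLp}
  obtain ⟨E, hES, hEc, hE⟩ :=
    (TopologicalSpace.IsSeparable.of_separableSpace S).exists_countable_dense_subset
  have hES' : ∀ d ∈ E, ∃ ψ, ∃ h : ContDiff ℝ ∞ ψ,
    ∃ h' : HasCompactSupport ψ, d = (memLp_gradField h h').toLp := hES
  choose! F hF1 hF2 hF3 using hES'
  refine ⟨F '' E, hEc.image F, ?_, fun v hv h ψ hψ hψc => ?_⟩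
  · rintro _ ⟨d, hd, rfl⟩
    exact ⟨hF1 d hd, hF2 d hd⟩
  · have hcl : closure E ⊆ {d | inner ℝ (hv.toLp v) d = 0} :=
      closure_minimal (fun d hd => by
        have h1 := h (F d) ⟨d, hd, rfl⟩
        rw [pairing, integral_inner_eq_inner_toLp hv (memLp_gradField (hF1 d hd) (hF2 d hd)),
          ← hF3 d hd] at h1
        exact h1) (isClosed_eq (by fun_prop) continuous_const)
    simp only [← inner_gradField]
    rw [integral_inner_eq_inner_toLp hv (memLp_gradField hψ hψc)]
    exact hcl (hE ⟨ψ, hψ, hψc, rfl⟩)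

/-- The pairings of a bounded sequence of weak solutions with a solenoidal test field are
equi-Lipschitz in time; hence they converge at almost every time if they converge weakly. -/
theorem ae_tendsto_pairing {ν : ℝ} (hν : 0 ≤ ν) {M : ℝ≥0} {f : ℕ → R3 → R3}
    {u : ℕ → ℝ → R3 → R3} {u' : ℝ → R3 → R3} (hu : ∀ j, IsWeakSolution ν (f j) (u j))
    (hM : ∀ j, timeL2Norm ⊤ (u j) ≤ M) {φ : R3 → R3} (hφ : IsSolenoidalTest φ) {c : ℝ}
    (hf : Tendsto (fun j => pairing (f j) φ) atTop (𝓝 c))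
    (hu' : LocallyIntegrable (fun t => pairing (u' t) φ) timeMeasure)
    (hw : ∀ η : ℝ → ℝ, ContDiff ℝ ∞ η → HasCompactSupport η →
      Tendsto (fun j => ∫ t, η t * pairing (u j t) φ ∂timeMeasure) atTop
        (𝓝 (∫ t, η t * pairing (u' t) φ ∂timeMeasure))) :
    ∀ᵐ t ∂timeMeasure, Tendsto (fun j => pairing (u j t) φ) atTop (𝓝 (pairing (u' t) φ)) := by
  have hae := fun j => (hu j).memL2.ae_memLp (hM j)
  obtain ⟨K, hK, hflux⟩ := exists_flux_bound hφ ν.toNNReal M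
  have hfluxb : ∀ j, ∀ᵐ t ∂timeMeasure, |flux ν φ (u j t)| ≤ K := fun j =>
    (hae j).mono fun t ht => hflux ν hν (Real.le_coe_toNNReal ν) _ ht.1 ht.2
  have hfluxm : ∀ j, LocallyIntegrable (fun t => flux ν φ (u j t)) timeMeasure := fun j =>
    locallyIntegrable_of_ae_bound (aestronglyMeasurable_flux (hu j).memL2.1 hφ.smooth ν) (hfluxb j)
  obtain ⟨B, hB⟩ := hf.norm.bddAbove_range
  refine ae_tendsto_of_equiLipschitz (K := K) (B := B) hK (fun j => ?_) hu' (fun j => ?_) hw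
  · have hL : eLpNorm φ 2 volume ≤ (eLpNorm φ 2 volume).toNNReal :=
      (ENNReal.coe_toNNReal hφ.memLp.2.ne).ge
    refine locallyIntegrable_of_ae_bound (K := M * (eLpNorm φ 2 volume).toNNReal)
      (aestronglyMeasurable_pairing (φ := fun p => φ p.2) (hu j).memL2.1 ?_) ?_
    · have : Continuous fun p : ℝ × R3 => φ p.2 := hφ.smooth.continuous.comp continuous_snd
      exact this.aestronglyMeasurable
    · filter_upwards [hae j] with t ht
      exact abs_integral_inner_le ht.1 hφ.memLp ht.2 hL
  · have hint : ∀ s t, 0 ≤ s → 0 ≤ t → |∫ τ in s..t, flux ν φ (u j τ)| ≤ K * |t - s| := by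
      intro s t hs ht
      rw [← Real.norm_eq_abs]
      refine intervalIntegral.norm_integral_le_of_norm_le_const_ae ?_
      filter_upwards [(ae_restrict_iff' measurableSet_Ioi).1 (hfluxb j)] with τ hτ hm
      exact hτ (lt_of_le_of_lt (le_min hs ht) hm.1)
    refine ⟨fun s => pairing (f j) φ + ∫ τ in (0 : ℝ)..s, flux ν φ (u j τ),
      (hu j).pairing_eq hν hφ, fun t ht => ?_, fun s t hs ht => ?_⟩
    · have h1 := hint 0 t le_rfl ht.le
      rw [sub_zero, abs_of_pos ht] at h1
      exact (abs_add_le _ _).trans (add_le_add (hB ⟨j, rfl⟩) h1)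
    · have h1 := hint t s ht.le hs.le
      rw [← integral_indicator_Ioi_eq ht.le hs.le, ← intervalIntegral.integral_interval_sub_left
        (intervalIntegrable_indicator (hfluxm j) 0 s) (intervalIntegrable_indicator (hfluxm j) 0 t),
        integral_indicator_Ioi_eq le_rfl hs.le, integral_indicator_Ioi_eq le_rfl ht.le] at h1
      rwa [add_sub_add_left_eq_sub]

/-- A bounded sequence of weak solutions that converges weakly in space-time converges weakly in
`L²` at almost every time, and the limit is solenoidal with the same bound. At almost every time
there is convergence against countably many solenoidal fields that are total in `L²_σ`; the pairings
with the orthogonal complement of `L²_σ` vanish. -/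
theorem ae_weak_tendsto {ν : ℝ} (hν : 0 ≤ ν) {M : ℝ≥0} {f : ℕ → R3 → R3}
    {u : ℕ → ℝ → R3 → R3} {u' : ℝ → R3 → R3} (hu : ∀ j, IsWeakSolution ν (f j) (u j))
    (hM : ∀ j, timeL2Norm ⊤ (u j) ≤ M)
    (hf : ∀ φ, IsSolenoidalTest φ → ∃ c, Tendsto (fun j => pairing (f j) φ) atTop (𝓝 c))
    (hu' : MemLp (fun p => Real.exp (-p.1) • Function.uncurry u' p) 2 spaceTimeMeasure)
    (hw : ∀ (η : ℝ → ℝ) (ψ : R3 → R3), ContDiff ℝ ∞ η → HasCompactSupport η → MemLp ψ 2 →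
      Tendsto (fun j => ∫ t, η t * pairing (u j t) ψ ∂timeMeasure) atTop
        (𝓝 (∫ t, η t * pairing (u' t) ψ ∂timeMeasure))) :
    ∀ᵐ t ∂timeMeasure, MemLp (u' t) 2 ∧ eLpNorm (u' t) 2 volume ≤ M ∧ IsDivFree (u' t) ∧
      ∀ ψ : R3 → R3, MemLp ψ 2 →
        Tendsto (fun j => pairing (u j t) ψ) atTop (𝓝 (pairing (u' t) ψ)) := by
  obtain ⟨D, hDc, hDs, hD⟩ := exists_countable_solenoidal
  obtain ⟨E, hEc, hEs, hE⟩ := exists_countable_gradient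
  have hslice : ∀ᵐ t ∂timeMeasure, MemLp (u' t) 2 := by
    filter_upwards [ae_memLp_slice hu'] with t ht
    have h1 := ht.const_smul (Real.exp t)
    refine h1.ae_eq (Eventually.of_forall fun x => ?_)
    simp only [Pi.smul_apply, smul_smul, ← Real.exp_add, add_neg_cancel, Real.exp_zero, one_smul]
    rfl
  have hDlim : ∀ᵐ t ∂timeMeasure, ∀ φ ∈ D,
      Tendsto (fun j => pairing (u j t) φ) atTop (𝓝 (pairing (u' t) φ)) := by
    refine (ae_ball_iff hDc).2 fun φ hφ => ?_
    obtain ⟨c, hc⟩ := hf φ (hDs φ hφ)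
    exact ae_tendsto_pairing hν hu hM (hDs φ hφ) hc
      (locallyIntegrable_pairing hu' (hDs φ hφ).memLp)
      fun η h1 h2 => hw η φ h1 h2 (hDs φ hφ).memLp
  have hElim : ∀ᵐ t ∂timeMeasure, ∀ ψ ∈ E, pairing (u' t) (gradField ψ) = 0 := by
    refine (ae_ball_iff hEc).2 fun ψ hψ => ?_
    have hm := memLp_gradField (hEs ψ hψ).1 (hEs ψ hψ).2
    refine ae_eq_zero_of_integral_contDiff_smul_eq_zero (locallyIntegrable_pairing hu' hm)
      fun η h1 h2 => tendsto_nhds_unique (hw η _ h1 h2 hm) ?_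
    have h0 : ∀ j, ∫ t, η t * pairing (u j t) (gradField ψ) ∂timeMeasure = 0 := by
      intro j
      refine integral_eq_zero_of_ae ?_
      filter_upwards [(hu j).divFree] with t ht
      have h3 := ht ψ (hEs ψ hψ).1 (hEs ψ hψ).2
      simp only [pairing, inner_gradField, h3, mul_zero]
      rfl
    simp only [h0]
    exact tendsto_const_nhds
  have hae := ae_all_iff.2 fun j => (hu j).memL2.ae_memLp (hM j)
  filter_upwards [hslice, hDlim, hElim, hae, ae_all_iff.2 fun j => (hu j).divFree]
    with t h1 h2 h3 h4 h5
  have hdiv : IsDivFree (u' t) := hE _ h1 h3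
  have hmem : ∀ {v : R3 → R3} (hv : MemLp v 2 volume), IsDivFree v → hv.toLp v ∈ L2sigma :=
    fun hv h => isDivFree_congr hv.coeFn_toLp.symm h
  have hnorm : ∀ j, ‖(h4 j).1.toLp (u j t)‖ ≤ M := fun j => by
    rw [Lp.norm_toLp]
    exact ENNReal.toReal_le_coe_of_le_coe (h4 j).2
  have hclosed : L2sigmaᗮᗮ = L2sigma := by
    rw [Submodule.orthogonal_orthogonal_eq_closure]
    exact isClosed_L2sigma.submodule_topologicalClosure_eq
  let T : Set (Lp R3 2 (volume : Measure R3)) :=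
    {d | ∃ φ ∈ D, ∃ h : MemLp φ 2 volume, d = h.toLp φ} ∪ (L2sigmaᗮ : Submodule ℝ _)
  have hlim := tendsto_inner_of_total (a := fun j => (h4 j).1.toLp (u j t)) (a' := h1.toLp (u' t))
    hnorm (D := T) (fun g hg => ?_) (fun d hd => ?_)
  · have hlim' : ∀ ψ : R3 → R3, MemLp ψ 2 →
        Tendsto (fun j => pairing (u j t) ψ) atTop (𝓝 (pairing (u' t) ψ)) := by
      intro ψ hψ
      have h6 := hlim (hψ.toLp ψ)
      simp only [← integral_inner_eq_inner_toLp _ hψ] at h6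
      exact h6
    refine ⟨h1, ?_, hdiv, hlim'⟩
    have h7 := hlim (h1.toLp (u' t))
    have h8 : inner ℝ (h1.toLp (u' t)) (h1.toLp (u' t)) ≤ M * ‖h1.toLp (u' t)‖ :=
      le_of_tendsto h7 (Eventually.of_forall fun j =>
        (real_inner_le_norm _ _).trans (mul_le_mul_of_nonneg_right (hnorm j) (norm_nonneg _)))
    rw [real_inner_self_eq_norm_mul_norm] at h8
    have h9 : ‖h1.toLp (u' t)‖ ≤ M := by
      by_contra h
      push Not at h
      have h10 : 0 < ‖h1.toLp (u' t)‖ := lt_of_le_of_lt M.2 h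
      nlinarith
    rw [Lp.norm_toLp] at h9
    rw [← ENNReal.ofReal_coe_nnreal]
    exact (ENNReal.le_ofReal_iff_toReal_le h1.2.ne M.2).2 h9
  · have hgσ : g ∈ L2sigma := by
      rw [← hclosed, Submodule.mem_orthogonal]
      exact fun d hd => hg d (Or.inr hd)
    refine hD g hgσ fun φ hφ => ?_
    have h6 := hg _ (Or.inl ⟨φ, hφ, (hDs φ hφ).memLp, rfl⟩)
    rw [pairing, integral_inner_eq_inner_toLp (Lp.memLp g) (hDs φ hφ).memLp, Lp.toLp_coeFn,
      real_inner_comm]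
    exact h6
  · rcases hd with ⟨φ, hφ, h, rfl⟩ | hd
    · simp only [← integral_inner_eq_inner_toLp _ h]
      exact h2 φ hφ
    · have h6 : ∀ {v : R3 → R3} (hv : MemLp v 2 volume), IsDivFree v → inner ℝ (hv.toLp v) d = 0 :=
        fun hv h => (Submodule.mem_orthogonal _ _).1 hd _ (hmem hv h)
      rw [h6 h1 hdiv]
      refine tendsto_const_nhds.congr fun j => ?_
      rw [h6 (h4 j).1 (h5 j)]

/-! ### Stability of weak solutions under weak convergence -/

theorem aemeasurable_eLpNorm_slice {φ : ℝ → R3 → R3}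
    (h : AEStronglyMeasurable (Function.uncurry φ) spaceTimeMeasure) :
    AEMeasurable (fun t => eLpNorm (φ t) 2 volume) timeMeasure := by
  have h1 : AEMeasurable (fun t => ∫⁻ x, ‖Function.uncurry φ (t, x)‖ₑ ^ 2) timeMeasure :=
    AEMeasurable.lintegral_prod_right' (h.enorm.pow_const 2)
  have h2 := h1.pow_const (1 / 2 : ℝ)
  refine h2.congr (Eventually.of_forall fun t => ?_)
  simp only [Function.uncurry_apply_pair]
  rw [lintegral_enorm_sq_eq, ← ENNReal.rpow_natCast, ← ENNReal.rpow_mul]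
  norm_num

theorem timeL2Norm_top_le {u : ℝ → R3 → R3} {M : ℝ≥0∞}
    (h : ∀ᵐ t ∂timeMeasure, eLpNorm (u t) 2 volume ≤ M) : timeL2Norm ⊤ u ≤ M := by
  rw [timeL2Norm, eLpNorm_exponent_top]
  exact eLpNormEssSup_le_of_ae_enorm_bound (by simpa using h)

/-- Bounded weak convergence at almost every time implies weak* convergence in `L^∞(0, ∞; L²)`. -/
theorem weakStarTendsto_of_ae {u : ℕ → ℝ → R3 → R3} {u' : ℝ → R3 → R3} {M : ℝ≥0}
    (hm : ∀ j, AEStronglyMeasurable (Function.uncurry (u j)) spaceTimeMeasure)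
    (hM : ∀ j, ∀ᵐ t ∂timeMeasure, MemLp (u j t) 2 ∧ eLpNorm (u j t) 2 volume ≤ M)
    (hlim : ∀ᵐ t ∂timeMeasure, ∀ ψ : R3 → R3, MemLp ψ 2 →
      Tendsto (fun j => pairing (u j t) ψ) atTop (𝓝 (pairing (u' t) ψ))) :
    WeakStarTendsto u u' := by
  intro φ hφ
  have hφm := aemeasurable_eLpNorm_slice hφ.1
  have hφi : ∫⁻ t, eLpNorm (φ t) 2 volume ∂timeMeasure < ⊤ := by
    have h := hφ.2
    rw [timeL2Norm, eLpNorm_one_eq_lintegral_enorm] at h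
    simpa using h
  have hfin := ae_lt_top' hφm hφi.ne
  have hsl : ∀ᵐ t ∂timeMeasure, AEStronglyMeasurable (φ t) volume := hφ.1.prodMk_left
  change Tendsto (fun j => ∫ t, pairing (u j t) (φ t) ∂timeMeasure) atTop
    (𝓝 (∫ t, pairing (u' t) (φ t) ∂timeMeasure))
  refine tendsto_integral_of_dominated_convergence
    (fun t => M * (eLpNorm (φ t) 2 volume).toReal)
    (fun j => aestronglyMeasurable_pairing (hm j) hφ.1)
    ((integrable_toReal_of_lintegral_ne_top hφm hφi.ne).const_mul _) (fun j => ?_) ?_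
  · filter_upwards [hfin, hsl, hM j] with t h1 h2 h3
    exact abs_integral_inner_le (b := (eLpNorm (φ t) 2 volume).toNNReal) h3.1 ⟨h2, h1⟩ h3.2
      (ENNReal.coe_toNNReal h1.ne).ge
  · filter_upwards [hfin, hsl, hlim] with t h1 h2 h3
    exact h3 _ ⟨h2, h1⟩

/-- Weak gradients pass to weak limits. -/
theorem IsWeakGradient.of_weak_limit {u : ℕ → ℝ → R3 → R3} {u' : ℝ → R3 → R3}
    {G : ℕ → ℝ → R3 → PiLp 2 (fun _ : Fin 3 => R3)} {G' : ℝ × R3 → PiLp 2 (fun _ : Fin 3 => R3)}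
    (hG : ∀ j, IsWeakGradient (u j) (G j))
    (hu : ∀ j, IsLocalInTimeL2 (Function.uncurry (u j)))
    (hu' : IsLocalInTimeL2 (Function.uncurry u')) (hG' : MemLp G' 2 spaceTimeMeasure)
    (hulim : ∀ ζ : ℝ × R3 → R3, Continuous ζ → HasCompactSupport ζ →
      Tendsto (fun j => ∫ p, inner ℝ (Function.uncurry (u j) p) (ζ p) ∂spaceTimeMeasure) atTop
        (𝓝 (∫ p, inner ℝ (Function.uncurry u' p) (ζ p) ∂spaceTimeMeasure)))
    (hGlim : ∀ ζ, MemLp ζ 2 spaceTimeMeasure →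
      Tendsto (fun j => ∫ p, inner ℝ (Function.uncurry (G j) p) (ζ p) ∂spaceTimeMeasure) atTop
        (𝓝 (∫ p, inner ℝ (G' p) (ζ p) ∂spaceTimeMeasure))) :
    IsWeakGradient u' (fun t x => G' (t, x)) := by
  have hG'' : MemLp (Function.uncurry fun t x => G' (t, x)) 2 spaceTimeMeasure := hG'
  rw [isWeakGradient_iff hu'.locallyIntegrable hG'']
  intro ψ hψ hc hs k
  have hdc : Continuous fun p => fderiv ℝ ψ p (0, EuclideanSpace.single k 1) :=
    (hψ.continuous_fderiv (by simp)).clm_apply continuous_const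
  have hds : HasCompactSupport fun p => fderiv ℝ ψ p (0, EuclideanSpace.single k 1) :=
    hc.fderiv_apply ℝ _
  have iu : ∀ {v : ℝ × R3 → R3}, IsLocalInTimeL2 v → Integrable (fun p =>
      fderiv ℝ ψ p (0, EuclideanSpace.single k 1) • v p) spaceTimeMeasure := fun hv =>
    hv.locallyIntegrable.integrable_smul_left_of_hasCompactSupport hdc hds
  have iG : ∀ {D : ℝ → R3 → PiLp 2 (fun _ : Fin 3 => R3)},
      MemLp (Function.uncurry D) 2 spaceTimeMeasure →
      Integrable (fun p => ψ p • Function.uncurry D p k) spaceTimeMeasure := fun hD =>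
    ((memLp_component hD k).locallyIntegrable
      (by norm_num)).integrable_smul_left_of_hasCompactSupport hψ.continuous hc
  refine ext_inner_left ℝ fun v => ?_
  -- both sides are tested with a fixed vector `v`
  have e1 : ∀ {w : ℝ × R3 → R3}, IsLocalInTimeL2 w →
      inner ℝ v (∫ p, fderiv ℝ ψ p (0, EuclideanSpace.single k 1) • w p ∂spaceTimeMeasure) =
        ∫ p, inner ℝ (w p) (fderiv ℝ ψ p (0, EuclideanSpace.single k 1) • v)
          ∂spaceTimeMeasure := by
    intro w hw
    rw [← integral_inner (iu hw)]
    refine integral_congr_ae (Eventually.of_forall fun p => ?_)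
    simp only [real_inner_smul_right]
    rw [real_inner_comm]
  let V : PiLp 2 (fun _ : Fin 3 => R3) := WithLp.toLp 2 (Pi.single k v)
  have hV : ∀ q : PiLp 2 (fun _ : Fin 3 => R3), inner ℝ q V = inner ℝ v (q k) := by
    intro q
    rw [PiLp.inner_apply, Finset.sum_eq_single k]
    · simp only [V, Pi.single_eq_same]
      exact real_inner_comm _ _
    · intro i _ hi
      simp only [V, Pi.single_eq_of_ne hi, inner_zero_right]
    · simp
  have e2 : ∀ {D : ℝ → R3 → PiLp 2 (fun _ : Fin 3 => R3)},
      MemLp (Function.uncurry D) 2 spaceTimeMeasure →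
      inner ℝ v (-∫ p, ψ p • Function.uncurry D p k ∂spaceTimeMeasure) =
        -∫ p, inner ℝ (Function.uncurry D p) (ψ p • V) ∂spaceTimeMeasure := by
    intro D hD
    rw [inner_neg_right, ← integral_inner (iG hD)]
    congr 1
    refine integral_congr_ae (Eventually.of_forall fun p => ?_)
    simp only [real_inner_smul_right, hV]
  rw [e1 hu', e2 hG'']
  have h1 := hulim (fun p => fderiv ℝ ψ p (0, EuclideanSpace.single k 1) • v)
    (hdc.smul continuous_const) hds.smul_right
  have hψV : MemLp (fun p => ψ p • V) 2 spaceTimeMeasure :=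
    ((hψ.continuous.smul continuous_const).memLp_of_hasCompactSupport hc.smul_right)
  have h2 := (hGlim _ hψV).neg
  refine tendsto_nhds_unique h1 (h2.congr fun j => ?_)
  rw [← e1 (hu j), ← e2 (hG j).1]
  congr 1
  exact ((isWeakGradient_iff (hu j).locallyIntegrable (hG j).1).1 (hG j) ψ hψ hc hs k).symm

theorem memLp_exp_test {ζ : ℝ × R3 → R3} (hζ : Continuous ζ) (hζc : HasCompactSupport ζ) :
    MemLp (fun p : ℝ × R3 => Real.exp p.1 • ζ p) 2 spaceTimeMeasure := by
  have hc : Continuous fun p : ℝ × R3 => Real.exp p.1 • ζ p :=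
    (Real.continuous_exp.comp continuous_fst).smul hζ
  exact hc.memLp_of_hasCompactSupport (hζc.smul_left (f := fun p : ℝ × R3 => Real.exp p.1))

theorem integral_exp_inner (v : ℝ → R3 → R3) (ζ : ℝ × R3 → R3) :
    ∫ p, inner ℝ (Real.exp (-p.1) • Function.uncurry v p) (Real.exp p.1 • ζ p)
      ∂spaceTimeMeasure = ∫ p, inner ℝ (Function.uncurry v p) (ζ p) ∂spaceTimeMeasure := by
  refine integral_congr_ae (Eventually.of_forall fun p => ?_)
  beta_reduce
  rw [real_inner_smul_left, real_inner_smul_right, ← mul_assoc, ← Real.exp_add,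
    neg_add_cancel, Real.exp_zero, one_mul]

/-- The class of weak solutions with a bound `M` in `L^∞ L²`, a bound `N` for the gradient and a
bound `L` in `L^r X` is stable under weak convergence of the data. A global weak limit is taken in
space-time with the weight `e^{-t}`, since `L^∞(0, ∞; L²)` is not contained in
`L²((0, ∞) × ℝ³)`. -/
theorem exists_solution_of_weak_limit {X : Type*} [NormedAddCommGroup X] [NormedSpace ℝ X]
    {ι : X →L[ℝ] VecDist} {r : ℝ≥0∞} (hFatou : HasFatouTime ι r) {ν : ℝ} (hν : 0 ≤ ν)
    {M N L : ℝ≥0} {f : ℕ → R3 → R3} {f' : R3 → R3}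
    (hf : ∀ φ : R3 → R3, Continuous φ → HasCompactSupport φ →
      Tendsto (fun j => pairing (f j) φ) atTop (𝓝 (pairing f' φ)))
    {u : ℕ → ℝ → R3 → R3} {G : ℕ → ℝ → R3 → PiLp 2 (fun _ : Fin 3 => R3)}
    (hu : ∀ j, IsWeakSolution ν (f j) (u j)) (hM : ∀ j, timeL2Norm ⊤ (u j) ≤ M)
    (hG : ∀ j, IsWeakGradient (u j) (G j))
    (hN : ∀ j, eLpNorm (Function.uncurry (G j)) 2 spaceTimeMeasure ≤ N)
    (hL : ∀ j, lrNorm ι r (u j) ≤ L) :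
    ∃ u' G', IsWeakSolution ν f' u' ∧ timeL2Norm ⊤ u' ≤ M ∧ IsWeakGradient u' G' ∧
      eLpNorm (Function.uncurry G') 2 spaceTimeMeasure ≤ N ∧ lrNorm ι r u' ≤ L := by
  have hae := fun j => (hu j).memL2.ae_memLp (hM j)
  have hexp := fun j => memLp_exp_smul (hu j).memL2.1 ((hae j).mono fun t ht => ht.2)
  have hloc := fun j => isLocalInTimeL2_of_exp (hexp j).1
  -- extraction of weak limits of `e^{-t} u_j` and of the gradients
  obtain ⟨σ, U, hσ, hU, -, hUlim⟩ := exists_subseq_weak_memLp (fun j => (hexp j).1)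
    fun j => (hexp j).2
  obtain ⟨τ, G', hτ, hG', hG'N, hGlim⟩ := exists_subseq_weak_memLp
    (v := fun j => Function.uncurry (G (σ j))) (fun j => (hG (σ j)).1) fun j => hN (σ j)
  set ρ : ℕ → ℕ := fun j => σ (τ j) with hρ
  have hρt : Tendsto ρ atTop atTop := (hσ.comp hτ).tendsto_atTop
  let u' : ℝ → R3 → R3 := fun t x => Real.exp t • U (t, x)
  have hu'U : (fun p => Real.exp (-p.1) • Function.uncurry u' p) = U := by
    funext p
    change Real.exp (-p.1) • Real.exp p.1 • U (p.1, p.2) = _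
    rw [smul_smul, ← Real.exp_add, neg_add_cancel, Real.exp_zero, one_smul]
  have hu'exp : MemLp (fun p => Real.exp (-p.1) • Function.uncurry u' p) 2 spaceTimeMeasure := by
    rw [hu'U]; exact hU
  have hu'loc := isLocalInTimeL2_of_exp hu'exp
  have hWc : ∀ ζ : ℝ × R3 → R3, Continuous ζ → HasCompactSupport ζ →
      Tendsto (fun j => ∫ p, inner ℝ (Function.uncurry (u (ρ j)) p) (ζ p) ∂spaceTimeMeasure) atTop
        (𝓝 (∫ p, inner ℝ (Function.uncurry u' p) (ζ p) ∂spaceTimeMeasure)) := by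
    intro ζ hζ hζc
    have h := (hUlim _ (memLp_exp_test hζ hζc)).comp hτ.tendsto_atTop
    rw [← hu'U, integral_exp_inner u'] at h
    exact h.congr fun j => integral_exp_inner _ ζ
  have hWt : ∀ (η : ℝ → ℝ) (ψ : R3 → R3), ContDiff ℝ ∞ η → HasCompactSupport η → MemLp ψ 2 →
      Tendsto (fun j => ∫ t, η t * pairing (u (ρ j) t) ψ ∂timeMeasure) atTop
        (𝓝 (∫ t, η t * pairing (u' t) ψ ∂timeMeasure)) := by
    intro η ψ h1 h2 h3
    have h := (hUlim _ (memLp_exp_tensor h1.continuous h2 h3)).comp hτ.tendsto_atTop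
    rw [← hu'U, (integral_tensor hu'exp h1.continuous h2 h3).2] at h
    exact h.congr fun j => (integral_tensor (hexp _).1 h1.continuous h2 h3).2
  have hlim := ae_weak_tendsto hν (fun j => hu (ρ j)) (fun j => hM (ρ j))
    (fun φ hφ => ⟨_, (hf φ hφ.smooth.continuous hφ.compact).comp hρt⟩) hu'exp hWt
  have hu'm : AEStronglyMeasurable (Function.uncurry u') spaceTimeMeasure := by
    have : Continuous fun p : ℝ × R3 => Real.exp p.1 := Real.continuous_exp.comp continuous_fst
    exact this.aestronglyMeasurable.smul hU.1
  have hu'M : timeL2Norm ⊤ u' ≤ M := timeL2Norm_top_le (hlim.mono fun t ht => ht.2.1)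
  have hu'L2 : MemTimeL2 ⊤ u' := ⟨hu'm, hu'M.trans_lt ENNReal.coe_lt_top⟩
  have hgrad : IsWeakGradient u' fun t x => G' (t, x) :=
    IsWeakGradient.of_weak_limit (fun j => hG (ρ j)) (fun j => hloc (ρ j)) hu'loc hG' hWc hGlim
  have hws : WeakStarTendsto (fun j => u (ρ j)) u' :=
    weakStarTendsto_of_ae (fun j => (hu _).memL2.1) (fun j => hae _)
      (hlim.mono fun t ht => ht.2.2.2)
  refine ⟨u', fun t x => G' (t, x), ⟨hu'L2, ?_, hlim.mono fun t ht => ht.2.2.1, fun φ hφ => ?_⟩,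
    hu'M, hgrad, hG'N, hFatou _ u' L (fun j => (hu _).memL2) hu'L2 hws fun j => hL _⟩
  · exact (iInf₂_le _ hgrad).trans_lt hG'.2
  · -- strong convergence on cylinders makes the quadratic term converge
    have hstrong : ∀ T : ℝ, Tendsto (fun j => ∫⁻ p in Iio T ×ˢ Metric.ball (0 : R3) T,
        ‖Function.uncurry (u (ρ j)) p - Function.uncurry u' p‖ₑ ^ 2 ∂spaceTimeMeasure) atTop
        (𝓝 0) := by
      intro T
      refine tendsto_lintegral_sq_of_weak (w := fun j t x => u (ρ j) t x - u' t x) (M := M + M)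
        (N := N + N) (fun j => ((hu _).memL2.1).sub hu'm) (fun j => ?_)
        (fun j => (hG (ρ j)).sub hgrad (hloc _).locallyIntegrable hu'loc.locallyIntegrable)
        (fun j => ?_) ?_ (spaceTimeMeasure_cylinder_lt_top T)
      · filter_upwards [hae (ρ j), hlim] with t h1 h2
        refine ⟨h1.1.sub h2.1, (eLpNorm_sub_le h1.1.1 h2.1.1 (by norm_num)).trans ?_⟩
        rw [ENNReal.coe_add]
        exact add_le_add h1.2 h2.2.1
      · refine (eLpNorm_sub_le (hG (ρ j)).1.1 hG'.1 (by norm_num)).trans ?_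
        rw [ENNReal.coe_add]
        exact add_le_add (hN _) hG'N
      · filter_upwards [ae_all_iff.2 fun j => hae (ρ j), hlim] with t h1 h2 ψ hψ
        have h3 := (h2.2.2.2 ψ hψ).sub_const (pairing (u' t) ψ)
        rw [sub_self] at h3
        refine h3.congr fun j => ?_
        simp only [inner_sub_left]
        rw [integral_sub (integrable_inner_of_memLp (h1 j).1 hψ)
          (integrable_inner_of_memLp h2.1 hψ)]
        rfl
    have hquad := tendsto_integral_quadratic (fun j => hloc (ρ j)) hu'loc hstrong
      hφ.continuous_spatialDeriv hφ.hasCompactSupport_spatialDeriv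
    have hlin := hWc _ (hφ.continuous_linearPart ν) (hφ.hasCompactSupport_linearPart ν)
    rw [integral_weakForm_eq hu'loc ν hφ]
    refine tendsto_nhds_unique (hlin.add hquad) ?_
    have h0c : Continuous (φ 0) :=
      hφ.1.continuous.comp (by fun_prop : Continuous fun x : R3 => ((0 : ℝ), x))
    have h0s : HasCompactSupport (φ 0) :=
      HasCompactSupport.intro (hφ.2.1.isCompact.image continuous_snd) fun x hx => by
        by_contra h
        exact hx ⟨((0 : ℝ), x), subset_tsupport _ h, rfl⟩
    refine ((hf _ h0c h0s).comp hρt).neg.congr fun j => ?_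
    rw [← integral_weakForm_eq (hloc _) ν hφ, (hu (ρ j)).weakForm φ hφ]
    rfl

/-! ### Affine changes of variables -/

theorem map_affine_volume {c : ℝ} (hc : 0 < c) (y : R3) :
    Measure.map (fun x : R3 => c • x + y) volume = ENNReal.ofReal (c ^ 3)⁻¹ • volume := by
  have h1 : Measurable fun x : R3 => c • x := by fun_prop
  have h2 : Measurable fun x : R3 => x + y := by fun_prop
  have e : (fun x : R3 => c • x + y) = (fun x => x + y) ∘ fun x => c • x := rfl
  rw [e, ← Measure.map_map h2 h1, Measure.map_addHaar_smul _ hc.ne', Measure.map_smul,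
    (measurePreserving_add_right volume y).map_eq]
  congr 2
  rw [finrank_euclideanSpace_fin, abs_of_pos (by positivity)]

theorem map_mul_timeMeasure {b : ℝ} (hb : 0 < b) :
    Measure.map (fun t => b * t) timeMeasure = ENNReal.ofReal b⁻¹ • timeMeasure := by
  have hm : Measurable fun t : ℝ => b * t := by fun_prop
  have hs : Ioi (0 : ℝ) = (fun t => b * t) ⁻¹' Ioi 0 := by
    ext t
    simp [hb]
  rw [timeMeasure]
  conv_lhs => rw [hs]
  rw [← Measure.restrict_map hm measurableSet_Ioi, Real.map_volume_mul_left hb.ne',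
    Measure.restrict_smul, abs_of_pos (by positivity)]

theorem integral_affine {F : Type*} [NormedAddCommGroup F] [NormedSpace ℝ F] {c : ℝ} (hc : 0 < c)
    (y : R3) (g : R3 → F) : ∫ x, g (c • x + y) = (c ^ 3)⁻¹ • ∫ x, g x := by
  rw [Measure.integral_comp_smul volume (fun x => g (x + y)), integral_add_right_eq_self g y,
    finrank_euclideanSpace_fin, abs_of_pos (by positivity)]

theorem integral_mul_Ioi {F : Type*} [NormedAddCommGroup F] [NormedSpace ℝ F] {b : ℝ} (hb : 0 < b)
    (g : ℝ → F) : ∫ t in Ioi (0 : ℝ), g (b * t) = b⁻¹ • ∫ t in Ioi (0 : ℝ), g t := by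
  rw [integral_comp_mul_left_Ioi g 0 hb, mul_zero]

/-- The affine change of variables of space-time. -/
def dilation (b c : ℝ) (y : R3) (p : ℝ × R3) : ℝ × R3 := (b * p.1, c • p.2 + y)

theorem map_dilation {b c : ℝ} (hb : 0 < b) (hc : 0 < c) (y : R3) :
    Measure.map (dilation b c y) spaceTimeMeasure =
      ENNReal.ofReal (b * c ^ 3)⁻¹ • spaceTimeMeasure := by
  have h1 : Measurable fun t : ℝ => b * t := by fun_prop
  have h2 : Measurable fun x : R3 => c • x + y := by fun_prop
  have e : dilation b c y = Prod.map (fun t : ℝ => b * t) fun x : R3 => c • x + y := rfl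
  rw [e, spaceTimeMeasure, ← Measure.map_prod_map _ _ h1 h2, map_mul_timeMeasure hb,
    map_affine_volume hc, Measure.prod_smul_left, Measure.prod_smul_right, smul_smul,
    ← ENNReal.ofReal_mul (by positivity), mul_inv]

theorem measurable_dilation (b c : ℝ) (y : R3) : Measurable (dilation b c y) := by
  unfold dilation
  fun_prop

theorem quasiMeasurePreserving_dilation {b c : ℝ} (hb : 0 < b) (hc : 0 < c) (y : R3) :
    Measure.QuasiMeasurePreserving (dilation b c y) spaceTimeMeasure spaceTimeMeasure :=
  ⟨measurable_dilation b c y, by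
    rw [map_dilation hb hc]
    exact Measure.smul_absolutelyContinuous⟩

theorem quasiMeasurePreserving_affine {c : ℝ} (hc : 0 < c) (y : R3) :
    Measure.QuasiMeasurePreserving (fun x : R3 => c • x + y) volume volume :=
  ⟨by fun_prop, by
    rw [map_affine_volume hc]
    exact Measure.smul_absolutelyContinuous⟩

theorem quasiMeasurePreserving_mul {b : ℝ} (hb : 0 < b) :
    Measure.QuasiMeasurePreserving (fun t : ℝ => b * t) timeMeasure timeMeasure :=
  ⟨by fun_prop, by
    rw [map_mul_timeMeasure hb]
    exact Measure.smul_absolutelyContinuous⟩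

theorem measurableEmbedding_affine {c : ℝ} (hc : 0 < c) (y : R3) :
    MeasurableEmbedding fun x : R3 => c • x + y := by
  have h1 := (Homeomorph.smulOfNeZero c hc.ne' (α := R3)).measurableEmbedding
  exact (Homeomorph.addRight y).measurableEmbedding.comp h1

theorem measurableEmbedding_mul {b : ℝ} (hb : 0 < b) : MeasurableEmbedding fun t : ℝ => b * t :=
  (Homeomorph.mulLeft₀ b hb.ne').measurableEmbedding

theorem eLpNorm_affine {F : Type*} [NormedAddCommGroup F] {c : ℝ} (hc : 0 < c) (y : R3)
    (g : R3 → F) : eLpNorm (fun x => g (c • x + y)) 2 volume =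
      ENNReal.ofReal (c ^ (-(3 / 2) : ℝ)) * eLpNorm g 2 volume := by
  have h := (measurableEmbedding_affine hc y).eLpNorm_map_measure (g := g) (p := 2)
    (μ := volume)
  rw [map_affine_volume hc, eLpNorm_smul_measure_of_ne_zero (by positivity)] at h
  refine h.symm.trans ?_
  rw [smul_eq_mul, ENNReal.ofReal_rpow_of_pos (by positivity), ← Real.rpow_natCast,
    ← Real.rpow_neg hc.le, ← Real.rpow_mul hc.le]
  norm_num

theorem eLpNorm_dilation {F : Type*} [NormedAddCommGroup F] {b c : ℝ} (hb : 0 < b) (hc : 0 < c)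
    (y : R3) {g : ℝ × R3 → F} (hg : AEStronglyMeasurable g spaceTimeMeasure) :
    eLpNorm (fun p => g (dilation b c y p)) 2 spaceTimeMeasure =
      ENNReal.ofReal (b ^ (-(1 / 2) : ℝ) * c ^ (-(3 / 2) : ℝ)) * eLpNorm g 2 spaceTimeMeasure := by
  have hg' : AEStronglyMeasurable g (Measure.map (dilation b c y) spaceTimeMeasure) := by
    rw [map_dilation hb hc]
    exact hg.mono_ac Measure.smul_absolutelyContinuous
  have h := eLpNorm_map_measure (p := 2) hg' (measurable_dilation b c y).aemeasurable
  rw [map_dilation hb hc, eLpNorm_smul_measure_of_ne_zero (by positivity)] at h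
  refine h.symm.trans ?_
  rw [smul_eq_mul, ENNReal.ofReal_rpow_of_pos (by positivity), ← Real.rpow_neg_one,
    Real.mul_rpow hb.le (by positivity), Real.mul_rpow (by positivity) (by positivity),
    ← Real.rpow_natCast, ← Real.rpow_mul hc.le, ← Real.rpow_mul hc.le, ← Real.rpow_mul hb.le]
  norm_num

/-- The rescaled field `(t, x) ↦ a u(b t, c x + y)`. -/
def rescale (a b c : ℝ) (y : R3) (u : ℝ → R3 → R3) (t : ℝ) (x : R3) : R3 :=
  a • u (b * t) (c • x + y)

theorem timeL2Norm_rescale {a b c : ℝ} (ha : 0 < a) (hb : 0 < b) (hc : 0 < c) (y : R3)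
    (u : ℝ → R3 → R3) : timeL2Norm ⊤ (rescale a b c y u) =
      ENNReal.ofReal (a * c ^ (-(3 / 2) : ℝ)) * timeL2Norm ⊤ u := by
  have h1 : ∀ t, eLpNorm (rescale a b c y u t) 2 volume =
      ENNReal.ofReal (a * c ^ (-(3 / 2) : ℝ)) * eLpNorm (u (b * t)) 2 volume := by
    intro t
    have e : rescale a b c y u t = a • fun x => u (b * t) (c • x + y) := rfl
    rw [e, eLpNorm_const_smul, eLpNorm_affine hc, ← mul_assoc, Real.enorm_of_nonneg ha.le,
      ENNReal.ofReal_mul ha.le]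
  simp only [timeL2Norm, h1, eLpNorm_exponent_top, eLpNormEssSup_eq_essSup_enorm, enorm_eq_self]
  rw [ENNReal.essSup_const_mul]
  congr 1
  have h2 := (measurableEmbedding_mul hb).essSup_map_measure (μ := timeMeasure)
    (g := fun t => eLpNorm (u t) 2 volume)
  rw [map_mul_timeMeasure hb, essSup_ennreal_smul_measure (by positivity)] at h2
  exact h2.symm

theorem aestronglyMeasurable_rescale {a b c : ℝ} (hb : 0 < b) (hc : 0 < c) (y : R3)
    {u : ℝ → R3 → R3} (hu : AEStronglyMeasurable (Function.uncurry u) spaceTimeMeasure) :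
    AEStronglyMeasurable (Function.uncurry (rescale a b c y u)) spaceTimeMeasure :=
  (hu.comp_quasiMeasurePreserving (quasiMeasurePreserving_dilation hb hc y)).const_smul a

theorem IsDivFree.affine {f : R3 → R3} (hf : IsDivFree f) (a : ℝ) {c : ℝ} (hc : 0 < c) (y : R3) :
    IsDivFree fun x => a • f (c • x + y) := by
  intro ψ hψ hψc
  let ψ' : R3 → ℝ := fun x => ψ (c⁻¹ • x + -(c⁻¹ • y))
  have hψ' : ContDiff ℝ ∞ ψ' := hψ.comp (by fun_prop)
  have hψ'c : HasCompactSupport ψ' := HasCompactSupport.comp_affine hψc (inv_ne_zero hc.ne') _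
  have h := hf ψ' hψ' hψ'c
  have e : ∀ x, fderiv ℝ ψ x (a • f (c • x + y)) =
      (a * c) • fderiv ℝ ψ' (c • x + y) (f (c • x + y)) := by
    intro x
    have h1 : fderiv ℝ ψ' (c • x + y) = c⁻¹ • fderiv ℝ ψ x := by
      rw [fderiv_comp_affine (hψ.differentiable (by simp))]
      congr 2
      rw [smul_add, smul_smul, inv_mul_cancel₀ hc.ne', one_smul, add_neg_cancel_right]
    rw [h1, map_smul, smul_apply, smul_smul, mul_assoc, mul_inv_cancel₀ hc.ne', mul_one]
  simp only [e]
  rw [integral_smul, integral_affine hc y (fun x => fderiv ℝ ψ' x (f x)), h]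
  simp

theorem tsupport_comp_dilation {F : Type*} [NormedAddCommGroup F] {g : ℝ × R3 → F} {b c : ℝ}
    (hb : 0 < b) (hs : tsupport g ⊆ Ioi 0 ×ˢ univ) (y : R3) :
    tsupport (fun p => g (dilation b c y p)) ⊆ Ioi 0 ×ˢ univ := by
  have hcont : Continuous (dilation b c y) := by
    unfold dilation
    fun_prop
  intro p hp
  have h1 := hs (tsupport_comp_subset_preimage g hcont hp)
  exact ⟨(pos_iff_pos_of_mul_pos h1.1).1 hb, trivial⟩

theorem hasCompactSupport_comp_dilation {F : Type*} [NormedAddCommGroup F] {g : ℝ × R3 → F}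
    {b c : ℝ} (hb : 0 < b) (hc : 0 < c) (hg : HasCompactSupport g) (y : R3) :
    HasCompactSupport fun p => g (dilation b c y p) := by
  have h := hg.comp_homeomorph ((Homeomorph.mulLeft₀ b hb.ne').prodCongr
    ((Homeomorph.smulOfNeZero c hc.ne' (α := R3)).trans (Homeomorph.addRight y)))
  exact h

theorem contDiff_comp_dilation {F : Type*} [NormedAddCommGroup F] [NormedSpace ℝ F]
    {g : ℝ × R3 → F} (hg : ContDiff ℝ ∞ g) (b c : ℝ) (y : R3) :
    ContDiff ℝ ∞ fun p => g (dilation b c y p) :=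
  hg.comp (by unfold dilation; fun_prop)

theorem IsWeakGradient.rescale {u : ℝ → R3 → R3} {G : ℝ → R3 → PiLp 2 (fun _ : Fin 3 => R3)}
    (hG : IsWeakGradient u G) (a : ℝ) {b c : ℝ} (hb : 0 < b) (hc : 0 < c) (y : R3) :
    IsWeakGradient (rescale a b c y u) fun t x => (a * c) • G (b * t) (c • x + y) := by
  refine ⟨?_, fun φ hφ hφc hφs k => ?_⟩
  · refine MemLp.const_smul (f := fun p => Function.uncurry G (dilation b c y p)) ⟨?_, ?_⟩ (a * c)
    · exact hG.1.1.comp_quasiMeasurePreserving (quasiMeasurePreserving_dilation hb hc y)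
    · rw [eLpNorm_dilation hb hc y hG.1.1]
      exact ENNReal.mul_lt_top ENNReal.ofReal_lt_top hG.1.2
  · let φ' : ℝ → R3 → ℝ := fun t x => φ (b⁻¹ * t) (c⁻¹ • x + -(c⁻¹ • y))
    have h := hG.2 φ' (contDiff_comp_dilation hφ b⁻¹ c⁻¹ (-(c⁻¹ • y)))
      (hasCompactSupport_comp_dilation (inv_pos.2 hb) (inv_pos.2 hc) hφc _)
      (tsupport_comp_dilation (inv_pos.2 hb) hφs _) k
    have hx : ∀ x, c⁻¹ • (c • x + y) + -(c⁻¹ • y) = x := fun x => by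
      rw [smul_add, smul_smul, inv_mul_cancel₀ hc.ne', one_smul, add_neg_cancel_right]
    have ht : ∀ t, b⁻¹ * (b * t) = t := fun t => inv_mul_cancel_left₀ hb.ne' t
    have hsl : ∀ t, Differentiable ℝ (φ t) := fun t =>
      (hφ.differentiable (by simp)).comp (by fun_prop : Differentiable ℝ fun x : R3 => (t, x))
    have e1 : ∀ t x, fderiv ℝ (φ t) x (EuclideanSpace.single k 1) •
        NavierStokes.rescale a b c y u t x =
        (a * c) • (fderiv ℝ (φ' (b * t)) (c • x + y) (EuclideanSpace.single k 1) •
          u (b * t) (c • x + y)) := by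
      intro t x
      have h1 : fderiv ℝ (φ' (b * t)) (c • x + y) = c⁻¹ • fderiv ℝ (φ t) x := by
        simp only [φ', ht]
        rw [fderiv_comp_affine (hsl t), hx]
      rw [h1, smul_apply, NavierStokes.rescale, smul_smul, smul_smul]
      congr 1
      rw [smul_eq_mul]
      field_simp
    have e2 : ∀ t x, φ t x • ((a * c) • G (b * t) (c • x + y)) k =
        (a * c) • (φ' (b * t) (c • x + y) • G (b * t) (c • x + y) k) := by
      intro t x
      simp only [φ', ht, hx]
      rw [PiLp.smul_apply, smul_comm]
    have e3 : ∀ t, ∫ x, fderiv ℝ (φ' (b * t)) (c • x + y) (EuclideanSpace.single k 1) •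
        u (b * t) (c • x + y) = (c ^ 3)⁻¹ • ∫ x, fderiv ℝ (φ' (b * t)) x
          (EuclideanSpace.single k 1) • u (b * t) x := fun t =>
      integral_affine hc y fun x =>
        fderiv ℝ (φ' (b * t)) x (EuclideanSpace.single k 1) • u (b * t) x
    have e4 : ∀ t, ∫ x, φ' (b * t) (c • x + y) • G (b * t) (c • x + y) k =
        (c ^ 3)⁻¹ • ∫ x, φ' (b * t) x • G (b * t) x k := fun t =>
      integral_affine hc y fun x => φ' (b * t) x • G (b * t) x k
    simp only [e1, e2, integral_smul, e3, e4]
    rw [integral_mul_Ioi hb fun t => ∫ x, fderiv ℝ (φ' t) x (EuclideanSpace.single k 1) • u t x,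
      integral_mul_Ioi hb fun t => ∫ x, φ' t x • G t x k, h]
    simp only [smul_neg]

/-! ### Symmetries of the equations -/

theorem divergence_comp_affine {f : R3 → R3} (hf : Differentiable ℝ f) (c : ℝ) (y x : R3) :
    divergence (fun x => f (c • x + y)) x = c * divergence f (c • x + y) := by
  simp only [divergence, fderiv_comp_affine hf, smul_apply, Finset.mul_sum]
  rfl

theorem IsTestField.comp_dilation {φ : ℝ → R3 → R3} (hφ : IsTestField φ) {b c : ℝ} (hb : 0 < b)
    (hc : 0 < c) (y : R3) : IsTestField fun t x => φ (b * t) (c • x + y) := by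
  refine ⟨contDiff_comp_dilation hφ.1 b c y, hasCompactSupport_comp_dilation hb hc hφ.2.1 y,
    fun t ht x => ?_⟩
  have hsl : Differentiable ℝ (φ (b * t)) :=
    (hφ.1.differentiable (by simp)).comp
      (by fun_prop : Differentiable ℝ fun x : R3 => (b * t, x))
  rw [divergence_comp_affine hsl, hφ.2.2 _ (by positivity), mul_zero]

/-- The symmetries of the Navier-Stokes equations: `a u(b t, c x + y)` with `b = a c` solves the
equations with viscosity `ν a / c`. -/
theorem IsWeakSolution.rescale {ν : ℝ} {f : R3 → R3} {u : ℝ → R3 → R3} (hu : IsWeakSolution ν f u)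
    {a c : ℝ} (ha : 0 < a) (hc : 0 < c) (y : R3) {f' : R3 → R3}
    (hf : f' =ᵐ[volume] fun x => a • f (c • x + y)) :
    IsWeakSolution (ν * a / c) f' (rescale a (a * c) c y u) := by
  have hb : 0 < a * c := mul_pos ha hc
  refine ⟨⟨aestronglyMeasurable_rescale hb hc y hu.memL2.1, ?_⟩, ?_, ?_, fun φ hφ => ?_⟩
  · rw [timeL2Norm_rescale ha hb hc]
    exact ENNReal.mul_lt_top ENNReal.ofReal_lt_top hu.memL2.2
  · have h := hu.memH1
    simp only [gradNorm, iInf_lt_iff] at h ⊢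
    obtain ⟨G, hG, -⟩ := h
    exact ⟨_, hG.rescale a hb hc y, (hG.rescale a hb hc y).1.2⟩
  · filter_upwards [(quasiMeasurePreserving_mul hb).ae hu.divFree] with t ht
    exact ht.affine a hc y
  · set b := a * c with hbdef
    let φ' : ℝ → R3 → R3 := fun t x => φ (b⁻¹ * t) (c⁻¹ • x + -(c⁻¹ • y))
    have hφ' : IsTestField φ' := hφ.comp_dilation (inv_pos.2 hb) (inv_pos.2 hc) _
    have hw := hu.weakForm φ' hφ'
    have hx : ∀ x, c⁻¹ • (c • x + y) + -(c⁻¹ • y) = x := fun x => by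
      rw [smul_add, smul_smul, inv_mul_cancel₀ hc.ne', one_smul, add_neg_cancel_right]
    have ht : ∀ t, b⁻¹ * (b * t) = t := fun t => inv_mul_cancel_left₀ hb.ne' t
    have hsl : ∀ t, ContDiff ℝ ∞ (φ t) := fun t =>
      hφ.1.comp (by fun_prop : ContDiff ℝ ∞ fun x : R3 => (t, x))
    have hst : ∀ x, Differentiable ℝ fun τ => φ τ x := fun x =>
      (hφ.1.differentiable (by simp)).comp (by fun_prop : Differentiable ℝ fun t : ℝ => (t, x))
    let I : ℝ → R3 → ℝ := fun t x => inner ℝ (u t x) (deriv (fun τ => φ' τ x) t + ν • Δ (φ' t) x)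
        + inner ℝ (u t x) (fderiv ℝ (φ' t) x (u t x))
    have e : ∀ t x, inner ℝ (NavierStokes.rescale a b c y u t x)
          (deriv (fun τ => φ τ x) t + (ν * a / c) • Δ (φ t) x)
        + inner ℝ (NavierStokes.rescale a b c y u t x)
          (fderiv ℝ (φ t) x (NavierStokes.rescale a b c y u t x)) =
        (a * b) • I (b * t) (c • x + y) := by
      intro t x
      have h1 : fderiv ℝ (φ' (b * t)) (c • x + y) = c⁻¹ • fderiv ℝ (φ t) x := by
        simp only [φ', ht]
        rw [fderiv_comp_affine ((hsl t).differentiable (by simp)), hx]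
      have h2 : Δ (φ' (b * t)) (c • x + y) = c⁻¹ ^ 2 • Δ (φ t) x := by
        simp only [φ', ht]
        rw [laplacian_comp_affine (contDiff_two (hsl t)), hx]
      have h3 : deriv (fun τ => φ' τ (c • x + y)) (b * t) = b⁻¹ • deriv (fun τ => φ τ x) t := by
        simp only [φ', hx]
        have h4 := deriv_comp_mul_left b⁻¹ (fun τ => φ τ x) (b * t)
        rw [ht] at h4
        exact h4
      simp only [I, h1, h2, h3, NavierStokes.rescale]
      simp only [smul_apply, map_smul, inner_add_right, real_inner_smul_left,
        real_inner_smul_right, smul_eq_mul]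
      rw [hbdef]
      field_simp
    have e2 : ∀ t, ∫ x, I (b * t) (c • x + y) = (c ^ 3)⁻¹ • ∫ x, I (b * t) x := fun t =>
      integral_affine hc y (I (b * t))
    simp only [e, integral_smul, e2]
    rw [integral_mul_Ioi hb fun t => ∫ x, I t x, hw]
    have e3 : ∫ x, inner ℝ (f' x) (φ 0 x) = a • (c ^ 3)⁻¹ • ∫ x, inner ℝ (f x) (φ' 0 x) := by
      rw [← integral_affine hc y fun x => inner ℝ (f x) (φ' 0 x), ← integral_smul]
      refine integral_congr_ae ?_
      filter_upwards [hf] with x h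
      rw [h]
      simp only [φ', hx, mul_zero, real_inner_smul_left, smul_eq_mul]
    rw [e3]
    simp only [smul_eq_mul]
    field_simp

/-! ### Function norms under affine changes of variables -/

theorem Represents.congr {T : VecDist} {f g : R3 → R3} (hT : Represents T f)
    (h : f =ᵐ[volume] g) : Represents T g := by
  intro φ
  have e : (fun x => φ x • f x) =ᵐ[volume] fun x => φ x • g x := by
    filter_upwards [h] with x hx
    rw [hx]
  exact ⟨(integrable_congr e).1 (hT φ).1, (hT φ).2.trans (integral_congr_ae e)⟩

theorem Represents.const_smul {T : VecDist} {f : R3 → R3} (hT : Represents T f) (a : ℝ) :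
    Represents (a • T) fun x => a • f x := by
  intro φ
  have e : (fun x => φ x • a • f x) = fun x => a • (φ x • f x) := by
    funext x
    rw [smul_comm]
  rw [e, integral_smul, ← (hT φ).2]
  exact ⟨(hT φ).1.smul a, rfl⟩

theorem Represents.translate {T : VecDist} {f : R3 → R3} (hT : Represents T f) (y : R3) :
    Represents (translate (-y) T) fun x => f (x + y) := by
  intro φ
  have h := hT (SchwartzMap.compSubConstCLM ℝ y φ)
  simp only [SchwartzMap.compSubConstCLM_apply] at h
  have e : (fun x => φ x • f (x + y)) = fun x => (fun z => φ (z - y) • f z) (x + y) := by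
    funext x
    simp
  rw [e]
  refine ⟨h.1.comp_add_right y, ?_⟩
  rw [integral_add_right_eq_self (fun z => φ (z - y) • f z) y, ← h.2, NavierStokes.translate,
    neg_neg]
  rfl

theorem Represents.dilate {T : VecDist} {f : R3 → R3} (hT : Represents T f) {c : ℝ} (hc : 0 < c) :
    Represents (dilate c hc T) fun x => f (c⁻¹ • x) := by
  intro φ
  have h := hT (SchwartzMap.compCLMOfContinuousLinearEquiv ℝ
      (ContinuousLinearEquiv.smulLeft (M₁ := R3) (R₁ := ℝ) (Units.mk0 c hc.ne')) φ)
  simp only [SchwartzMap.compCLMOfContinuousLinearEquiv_apply, Function.comp_apply,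
    ContinuousLinearEquiv.smulLeft_apply_apply] at h
  have hu : ∀ x : R3, Units.mk0 c hc.ne' • x = c • x := fun x => rfl
  simp only [hu] at h
  have e : (fun x => φ x • f (c⁻¹ • x)) = fun x => (fun z => φ (c • z) • f z) (c⁻¹ • x) := by
    funext x
    simp only [smul_smul, mul_inv_cancel₀ hc.ne', one_smul]
  rw [e]
  refine ⟨h.1.comp_smul (inv_ne_zero hc.ne'), ?_⟩
  rw [Measure.integral_comp_smul volume (fun z => φ (c • z) • f z), ← h.2,
    finrank_euclideanSpace_fin, inv_pow, inv_inv, abs_of_pos (by positivity)]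
  rfl

section SpaceNorm

variable {X : Type*} [NormedAddCommGroup X] [NormedSpace ℝ X] {ι : X →L[ℝ] VecDist}

theorem IsTranslationInvariant.exists_translate (h : IsTranslationInvariant ι) {x : X} {f : R3 → R3}
    (hx : Represents (ι x) f) (y : R3) :
    ∃ w : X, Represents (ι w) (fun x => f (x + y)) ∧ ‖w‖ = ‖x‖ := by
  obtain ⟨w, hw, hn⟩ := h x (-y)
  exact ⟨w, hw ▸ hx.translate y, hn⟩

/-- `‖a f(c ·)‖ ≤ B a c ^ (-3 / p) ‖f‖` in a `p`-homogeneous space. -/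
theorem IsHomogeneousSpace.exists_dilate {p : ℝ≥0∞} (h : IsHomogeneousSpace ι p) :
    ∃ B : ℝ, 0 < B ∧ ∀ (a c : ℝ), 0 < a → 0 < c → ∀ (x : X) (f : R3 → R3), Represents (ι x) f →
      ∃ w : X, Represents (ι w) (fun x => a • f (c • x)) ∧
        ‖w‖ ≤ B * (a * c ^ (-(3 * p⁻¹.toReal))) * ‖x‖ := by
  obtain ⟨A, B, hA, hB, hAB⟩ := h
  refine ⟨B, hB, fun a c ha hc x f hx => ?_⟩
  obtain ⟨w, hw, -, hn⟩ := hAB x c⁻¹ (inv_pos.2 hc)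
  refine ⟨a • w, ?_, ?_⟩
  · have h1 := (hx.dilate (inv_pos.2 hc)).const_smul a
    rw [← hw, inv_inv, ← map_smul] at h1
    exact h1
  · rw [norm_smul, Real.norm_of_nonneg ha.le]
    rw [Real.inv_rpow hc.le, ← Real.rpow_neg hc.le] at hn
    calc a * ‖w‖ ≤ a * (B * (c ^ (-(3 * p⁻¹.toReal)) * ‖x‖)) := by gcongr
      _ = _ := by ring

theorem spaceNorm_le_mul {K : ℝ} (hK : 0 < K) {f g : R3 → R3}
    (h : ∀ x : X, Represents (ι x) f → ∃ w : X, Represents (ι w) g ∧ ‖w‖ ≤ K * ‖x‖) :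
    spaceNorm ι g ≤ ENNReal.ofReal K * spaceNorm ι f := by
  have hK0 : ENNReal.ofReal K ≠ 0 := (ENNReal.ofReal_pos.2 hK).ne'
  unfold spaceNorm
  rw [ENNReal.mul_iInf_of_ne hK0 ENNReal.ofReal_ne_top]
  refine le_iInf fun x => ?_
  rw [ENNReal.mul_iInf_of_ne hK0 ENNReal.ofReal_ne_top]
  refine le_iInf fun hx => ?_
  obtain ⟨w, hw, hn⟩ := h x hx
  refine (iInf₂_le w hw).trans ?_
  rw [← ofReal_norm, ← ofReal_norm, ← ENNReal.ofReal_mul hK.le]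
  exact ENNReal.ofReal_le_ofReal hn

theorem lrNorm_rescale_le {r : ℝ≥0∞} {K a b c : ℝ} (hK : 0 < K) (hb : 0 < b) (y : R3)
    (h : ∀ f, spaceNorm ι (fun x => a • f (c • x + y)) ≤ ENNReal.ofReal K * spaceNorm ι f)
    (u : ℝ → R3 → R3) :
    lrNorm ι r (rescale a b c y u) ≤ ENNReal.ofReal (K * b ^ (-r⁻¹.toReal)) * lrNorm ι r u := by
  have hK0 : ENNReal.ofReal (K * b ^ (-r⁻¹.toReal)) ≠ 0 :=
    (ENNReal.ofReal_pos.2 (by positivity)).ne'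
  conv_rhs => unfold lrNorm
  rw [ENNReal.mul_iInf_of_ne hK0 ENNReal.ofReal_ne_top]
  refine le_iInf fun g => ?_
  rw [ENNReal.mul_iInf_of_ne hK0 ENNReal.ofReal_ne_top]
  refine le_iInf fun hg => ?_
  rw [ENNReal.mul_iInf_of_ne hK0 ENNReal.ofReal_ne_top]
  refine le_iInf fun hug => ?_
  have hq := quasiMeasurePreserving_mul hb
  have hg' : AEMeasurable (fun t => ENNReal.ofReal K * g (b * t)) timeMeasure :=
    (hg.comp_quasiMeasurePreserving hq).const_mul _
  have hle : ∀ᵐ t ∂timeMeasure, spaceNorm ι (rescale a b c y u t) ≤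
      ENNReal.ofReal K * g (b * t) := by
    filter_upwards [hq.ae hug] with t ht
    exact (h (u (b * t))).trans (by gcongr)
  have h0 : lrNorm ι r (rescale a b c y u) ≤
      eLpNorm (fun t => ENNReal.ofReal K * g (b * t)) r timeMeasure :=
    iInf₂_le_of_le _ hg' (iInf_le _ hle)
  refine h0.trans ?_
  have e : eLpNorm (fun t => g (b * t)) r timeMeasure =
      ENNReal.ofReal (b ^ (-r⁻¹.toReal)) * eLpNorm g r timeMeasure := by
    have h1 := (measurableEmbedding_mul hb).eLpNorm_map_measure (g := g) (p := r)
      (μ := timeMeasure)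
    rw [map_mul_timeMeasure hb, eLpNorm_smul_measure_of_ne_zero (by positivity)] at h1
    refine h1.symm.trans ?_
    rw [smul_eq_mul, ENNReal.ofReal_rpow_of_pos (by positivity), one_div, Real.inv_rpow hb.le,
      ← Real.rpow_neg hb.le]
  rw [ENNReal.ofReal_mul hK.le, mul_assoc, ← e]
  exact eLpNorm_le_mul_eLpNorm_of_ae_le_mul' (c := K.toNNReal)
    (Eventually.of_forall fun t => le_rfl) r

end SpaceNorm

/-! ### Bounded solutions and the data space -/

section BoundedSolutions

variable {X : Type*} [NormedAddCommGroup X] [NormedSpace ℝ X] {ι : X →L[ℝ] VecDist} {r : ℝ≥0∞}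

/-- The datum `f` has a weak solution with viscosity `ν` whose energy norms are bounded by `M` and
whose norm in `L^r(0, ∞; X)` is bounded by `L`. The gradient is named, since the infimum in
`gradNorm` need not a priori be attained. -/
def HasBoundedSolution (ι : X →L[ℝ] VecDist) (r : ℝ≥0∞) (ν : ℝ) (f : R3 → R3) (M L : ℝ≥0) : Prop :=
  ∃ u G, IsWeakSolution ν f u ∧ timeL2Norm ⊤ u ≤ M ∧ IsWeakGradient u G ∧
    ENNReal.ofReal (Real.sqrt ν) * eLpNorm (Function.uncurry G) 2 spaceTimeMeasure ≤ M ∧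
    lrNorm ι r u ≤ L

theorem HasBoundedSolution.mono {ν : ℝ} {f : R3 → R3} {M M' L L' : ℝ≥0}
    (h : HasBoundedSolution ι r ν f M L) (hM : M ≤ M') (hL : L ≤ L') :
    HasBoundedSolution ι r ν f M' L' := by
  obtain ⟨u, G, h1, h2, h3, h4, h5⟩ := h
  exact ⟨u, G, h1, h2.trans (by exact_mod_cast hM), h3, h4.trans (by exact_mod_cast hM),
    h5.trans (by exact_mod_cast hL)⟩

theorem HasBoundedSolution.of_weak_limit (hFatou : HasFatouTime ι r) {ν : ℝ} (hν : 0 < ν)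
    {f : ℕ → R3 → R3} {f' : R3 → R3} {M L : ℝ≥0}
    (hf : ∀ φ : R3 → R3, Continuous φ → HasCompactSupport φ →
      Tendsto (fun j => pairing (f j) φ) atTop (𝓝 (pairing f' φ)))
    (h : ∀ j, HasBoundedSolution ι r ν (f j) M L) : HasBoundedSolution ι r ν f' M L := by
  choose u G h1 h2 h3 h4 h5 using h
  have h0 : ENNReal.ofReal (Real.sqrt ν) ≠ 0 := (ENNReal.ofReal_pos.2 (Real.sqrt_pos.2 hν)).ne'
  set N : ℝ≥0∞ := M / ENNReal.ofReal (Real.sqrt ν) with hNdef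
  have hN : N ≠ ⊤ := ENNReal.div_ne_top ENNReal.coe_ne_top h0
  have key : ∀ x : ℝ≥0∞, ENNReal.ofReal (Real.sqrt ν) * x ≤ M ↔ x ≤ N.toNNReal := by
    intro x
    rw [ENNReal.coe_toNNReal hN, hNdef,
      ENNReal.le_div_iff_mul_le (Or.inl h0) (Or.inl ENNReal.ofReal_ne_top), mul_comm]
  obtain ⟨u', G', e1, e2, e3, e4, e5⟩ := exists_solution_of_weak_limit hFatou hν.le hf h1 h2 h3
    (fun j => (key _).1 (h4 j)) h5
  exact ⟨u', G', e1, e2, e3, (key _).2 e4, e5⟩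

theorem IsWeakSolution.hasBoundedSolution {ν : ℝ} {f : R3 → R3} {u : ℝ → R3 → R3}
    (hu : IsWeakSolution ν f u) {K : ℝ≥0} (hK : energyNorm ν u + lrNorm ι r u < K) :
    HasBoundedSolution ι r ν f K K := by
  have h1 : energyNorm ν u < K := lt_of_le_of_lt le_self_add hK
  have h2 : ENNReal.ofReal (Real.sqrt ν) * gradNorm u < K := lt_of_le_of_lt le_add_self h1
  have h3 : ∃ G, IsWeakGradient u G ∧
      ENNReal.ofReal (Real.sqrt ν) * eLpNorm (Function.uncurry G) 2 spaceTimeMeasure < K := by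
    by_cases hν : ENNReal.ofReal (Real.sqrt ν) = 0
    · have h4 := hu.memH1
      simp only [gradNorm, iInf_lt_iff] at h4
      obtain ⟨G, hG, -⟩ := h4
      refine ⟨G, hG, ?_⟩
      rw [hν, zero_mul] at h2 ⊢
      exact h2
    · rw [mul_comm, ← ENNReal.lt_div_iff_mul_lt (Or.inl hν) (Or.inl ENNReal.ofReal_ne_top)] at h2
      simp only [gradNorm, iInf_lt_iff] at h2
      obtain ⟨G, hG, hGK⟩ := h2
      refine ⟨G, hG, ?_⟩
      rwa [ENNReal.lt_div_iff_mul_lt (Or.inl hν) (Or.inl ENNReal.ofReal_ne_top), mul_comm] at hGK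
  obtain ⟨G, hG, hGK⟩ := h3
  exact ⟨u, G, hu, (lt_of_le_of_lt le_self_add h1).le, hG, hGK.le,
    (lt_of_le_of_lt le_add_self hK).le⟩

theorem HasBoundedSolution.translate (hX : IsTranslationInvariant ι) {ν : ℝ} {f f' : R3 → R3}
    {M L : ℝ≥0} (h : HasBoundedSolution ι r ν f M L) (y : R3)
    (hf : f' =ᵐ[volume] fun x => f (x + y)) : HasBoundedSolution ι r ν f' M L := by
  obtain ⟨u, G, h1, h2, h3, h4, h5⟩ := h
  have h1' := h1.rescale (f' := f') one_pos one_pos y (by simpa using hf)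
  rw [mul_one, mul_one, div_one] at h1'
  refine ⟨_, _, h1', ?_, h3.rescale 1 one_pos one_pos y, ?_, ?_⟩
  · rw [timeL2Norm_rescale one_pos one_pos one_pos]
    simpa using h2
  · have e := eLpNorm_dilation one_pos one_pos y h3.1.1
    have e1 : (Function.uncurry fun t x => ((1 : ℝ) * 1) • G (1 * t) ((1 : ℝ) • x + y)) =
        fun p => Function.uncurry G (dilation 1 1 y p) := by
      funext p
      simp [dilation, Function.uncurry]
    rw [e1, e]
    simpa using h4
  · have e := lrNorm_rescale_le (ι := ι) (r := r) (K := 1) (a := 1) (b := 1) (c := 1)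
      one_pos one_pos y
      (fun g => spaceNorm_le_mul one_pos fun x hx => by
        obtain ⟨w, hw, hn⟩ := hX.exists_translate hx y
        refine ⟨w, by simpa using hw, by rw [hn, one_mul]⟩) u
    refine e.trans ?_
    simpa using h5

/-- Bounds for the rescaled solution `a u(a c t, c x)` of viscosity `ν a / c`: both energy norms are
multiplied by `a c ^ (-3 / 2)`. The hypothesis `hX` is the homogeneity of `X`, with `e = 3 / s`. -/
theorem HasBoundedSolution.rescale {B e : ℝ} (hB : 0 < B)
    (hX : ∀ (a c : ℝ), 0 < a → 0 < c → ∀ (x : X) (f : R3 → R3), Represents (ι x) f →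
      ∃ w : X, Represents (ι w) (fun x => a • f (c • x)) ∧ ‖w‖ ≤ B * (a * c ^ (-e)) * ‖x‖)
    {ν : ℝ} {f f' : R3 → R3} {M L : ℝ≥0} (h : HasBoundedSolution ι r ν f M L) {a c : ℝ}
    (ha : 0 < a) (hc : 0 < c) (hf : f' =ᵐ[volume] fun x => a • f (c • x)) :
    ∃ u, IsWeakSolution (ν * a / c) f' u ∧
      energyNorm (ν * a / c) u ≤ ENNReal.ofReal (a * c ^ (-(3 / 2) : ℝ) * (2 * M)) ∧
      lrNorm ι r u ≤ ENNReal.ofReal (B * (a * c ^ (-e)) * (a * c) ^ (-r⁻¹.toReal) * L) := by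
  obtain ⟨u, G, h1, h2, h3, h4, h5⟩ := h
  have hb : 0 < a * c := mul_pos ha hc
  refine ⟨_, h1.rescale (f' := f') ha hc 0 (by simpa using hf), ?_, ?_⟩
  · have hG := h3.rescale a hb hc 0
    have e1 : (Function.uncurry fun t x => (a * c) • G (a * c * t) (c • x + 0)) =
        (a * c) • fun p => Function.uncurry G (dilation (a * c) c 0 p) := rfl
    have e2 : eLpNorm (Function.uncurry fun t x => (a * c) • G (a * c * t) (c • x + 0)) 2
        spaceTimeMeasure =
          ENNReal.ofReal ((a * c) * ((a * c) ^ (-(1 / 2) : ℝ) * c ^ (-(3 / 2) : ℝ))) *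
          eLpNorm (Function.uncurry G) 2 spaceTimeMeasure := by
      rw [e1, eLpNorm_const_smul, eLpNorm_dilation hb hc 0 h3.1.1, ← mul_assoc,
        Real.enorm_of_nonneg hb.le, ← ENNReal.ofReal_mul hb.le]
    have e3 : Real.sqrt (ν * a / c) * ((a * c) * ((a * c) ^ (-(1 / 2) : ℝ) * c ^ (-(3 / 2) : ℝ))) =
        a * c ^ (-(3 / 2) : ℝ) * Real.sqrt ν := by
      have h6 : Real.sqrt (ν * a / c) = Real.sqrt ν * (a / c) ^ (1 / 2 : ℝ) := by
        rw [mul_div_assoc, Real.sqrt_mul' _ (by positivity), Real.sqrt_eq_rpow (a / c)]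
      have h7 : (a / c) ^ (1 / 2 : ℝ) * ((a * c) * (a * c) ^ (-(1 / 2) : ℝ)) = a := by
        rw [Real.div_rpow ha.le hc.le, Real.mul_rpow ha.le hc.le, Real.rpow_neg ha.le,
          Real.rpow_neg hc.le, ← Real.sqrt_eq_rpow, ← Real.sqrt_eq_rpow]
        have h8 := Real.sq_sqrt ha.le
        have h9 := Real.sq_sqrt hc.le
        have h10 := Real.sqrt_pos.2 ha
        have h11 := Real.sqrt_pos.2 hc
        field_simp
        rw [h9]
      rw [h6]
      linear_combination (Real.sqrt ν * c ^ (-(3 / 2) : ℝ)) * h7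
    have e4 : ENNReal.ofReal (Real.sqrt (ν * a / c)) *
        gradNorm (NavierStokes.rescale a (a * c) c 0 u) ≤
        ENNReal.ofReal (a * c ^ (-(3 / 2) : ℝ)) * M := by
      calc _ ≤ ENNReal.ofReal (Real.sqrt (ν * a / c)) *
            eLpNorm (Function.uncurry fun t x => (a * c) • G (a * c * t) (c • x + 0)) 2
              spaceTimeMeasure := by
            gcongr
            exact iInf₂_le _ hG
        _ = ENNReal.ofReal (a * c ^ (-(3 / 2) : ℝ)) * (ENNReal.ofReal (Real.sqrt ν) *
              eLpNorm (Function.uncurry G) 2 spaceTimeMeasure) := by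
            rw [e2, ← mul_assoc, ← ENNReal.ofReal_mul (Real.sqrt_nonneg _), e3,
              ENNReal.ofReal_mul (by positivity), mul_assoc]
        _ ≤ _ := by gcongr
    rw [energyNorm, timeL2Norm_rescale ha hb hc,
      ENNReal.ofReal_mul (p := a * c ^ (-(3 / 2) : ℝ)) (by positivity), two_mul,
      ENNReal.ofReal_add (NNReal.coe_nonneg M) (NNReal.coe_nonneg M), ENNReal.ofReal_coe_nnreal,
      mul_add]
    exact add_le_add (by gcongr) e4
  · have hK : 0 < B * (a * c ^ (-e)) := by positivity
    refine (lrNorm_rescale_le hK hb 0 (fun g => spaceNorm_le_mul hK fun x hx => ?_) u).trans ?_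
    · simpa using hX a c ha hc x g hx
    · rw [ENNReal.ofReal_mul (p := B * (a * c ^ (-e)) * (a * c) ^ (-r⁻¹.toReal)) (by positivity),
        ENNReal.ofReal_coe_nnreal]
      gcongr

end BoundedSolutions

theorem timeL2Norm_zero : timeL2Norm ⊤ (fun _ _ => (0 : R3)) = 0 :=
  le_antisymm (timeL2Norm_top_le (Eventually.of_forall fun _ => by simp)) bot_le

theorem isWeakGradient_zero : IsWeakGradient (fun _ _ => 0) (fun _ _ => 0) := by
  refine ⟨MemLp.zero', fun φ _ _ _ k => ?_⟩
  simp

theorem isWeakSolution_zero (ν : ℝ) {f : R3 → R3} (hf : f =ᵐ[volume] 0) :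
    IsWeakSolution ν f (fun _ _ => 0) := by
  have hG := isWeakGradient_zero
  refine ⟨⟨aestronglyMeasurable_const, by rw [timeL2Norm_zero]; exact ENNReal.zero_lt_top⟩,
    ?_, ?_, fun φ _ => ?_⟩
  · exact (iInf₂_le _ hG).trans_lt hG.1.2
  · refine Eventually.of_forall fun t ψ _ _ => ?_
    simp
  · have : ∫ x, inner ℝ (f x) (φ 0 x) = 0 := by
      refine integral_eq_zero_of_ae ?_
      filter_upwards [hf] with x hx
      rw [hx]
      simp
    rw [this]
    simp

theorem energyNorm_zero (ν : ℝ) : energyNorm ν (fun _ _ => 0) = 0 := by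
  have hG := isWeakGradient_zero
  have h1 : gradNorm (fun _ _ => 0) = 0 := by
    refine le_antisymm ((iInf₂_le _ hG).trans ?_) bot_le
    have : (Function.uncurry fun (_ : ℝ) (_ : R3) => (0 : PiLp 2 (fun _ : Fin 3 => R3))) = 0 := rfl
    rw [this, eLpNorm_zero]
  rw [energyNorm, timeL2Norm_zero, h1, mul_zero, add_zero]

theorem lrNorm_zero {X : Type*} [NormedAddCommGroup X] [NormedSpace ℝ X] (ι : X →L[ℝ] VecDist)
    (r : ℝ≥0∞) : lrNorm ι r (fun _ _ => 0) = 0 := by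
  have hR : Represents (ι 0) fun _ => 0 := fun φ => by simp
  have h1 : spaceNorm ι (fun _ => 0) = 0 :=
    le_antisymm ((iInf₂_le 0 hR).trans (by simp)) bot_le
  have h2 : lrNorm ι r (fun _ _ => 0) ≤ eLpNorm (fun _ : ℝ => (0 : ℝ≥0∞)) r timeMeasure :=
    iInf₂_le_of_le _ aemeasurable_const (iInf_le _ (Eventually.of_forall fun t => h1.le))
  refine le_antisymm (h2.trans ?_) bot_le
  have : (fun _ : ℝ => (0 : ℝ≥0∞)) = 0 := rfl
  rw [this, eLpNorm_zero]

section DataSpace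

variable {Z : Type*} [NormedAddCommGroup Z] [NormedSpace ℝ Z] {ι : Z →L[ℝ] VecDist}

theorem norm_dataSpace (w : dataSpace ι) : ‖w‖ = max ‖w.1.1‖ ‖w.1.2‖ := rfl

/-- An affine change of variables in the data space, given the corresponding one in `Z`. -/
theorem exists_dataSpace_affine (w : dataSpace ι) {a c : ℝ} (ha : 0 < a) (hc : 0 < c) (y : R3)
    {z : Z} (hz : Represents (ι z) fun x => a • w.1.1 (c • x + y)) :
    ∃ w' : dataSpace ι, (w'.1.1 : R3 → R3) =ᵐ[volume] (fun x => a • w.1.1 (c • x + y)) ∧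
      ‖w'.1.1‖ = a * c ^ (-(3 / 2) : ℝ) * ‖w.1.1‖ ∧ w'.1.2 = z := by
  have e : eLpNorm (fun x => a • w.1.1 (c • x + y)) 2 volume =
      ENNReal.ofReal (a * c ^ (-(3 / 2) : ℝ)) * eLpNorm w.1.1 2 volume := by
    have e1 : (fun x => a • w.1.1 (c • x + y)) = a • fun x => w.1.1 (c • x + y) := rfl
    rw [e1, eLpNorm_const_smul, eLpNorm_affine hc, ← mul_assoc, Real.enorm_of_nonneg ha.le,
      ENNReal.ofReal_mul ha.le]
  have hm : MemLp (fun x => a • w.1.1 (c • x + y)) 2 volume := by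
    refine ⟨?_, ?_⟩
    · exact ((Lp.aestronglyMeasurable w.1.1).comp_quasiMeasurePreserving
        (quasiMeasurePreserving_affine hc y)).const_smul a
    · rw [e]
      exact ENNReal.mul_lt_top ENNReal.ofReal_lt_top (Lp.memLp w.1.1).2
  have hco := hm.coeFn_toLp
  refine ⟨⟨(hm.toLp _, z), ?_, hz.congr hco.symm⟩, hco, ?_, rfl⟩
  · exact isDivFree_congr hco.symm (IsDivFree.affine w.2.1 a hc y)
  · change ‖hm.toLp _‖ = _
    rw [Lp.norm_toLp, e, ENNReal.toReal_mul, ENNReal.toReal_ofReal (by positivity), Lp.norm_def]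

theorem exists_dataSpace_translate (hZ : IsTranslationInvariant ι) (w : dataSpace ι) (y : R3) :
    ∃ w' : dataSpace ι, (w'.1.1 : R3 → R3) =ᵐ[volume] (fun x => w.1.1 (x + y)) ∧ ‖w'‖ = ‖w‖ := by
  obtain ⟨z, hz, hn⟩ := hZ.exists_translate w.2.2 y
  obtain ⟨w', h1, h2, h3⟩ := exists_dataSpace_affine w one_pos one_pos y (z := z)
    (by simpa using hz)
  refine ⟨w', by simpa using h1, ?_⟩
  rw [norm_dataSpace, norm_dataSpace, h2, h3, hn]
  simp

theorem exists_dataSpace_dilate (hZ : IsHomogeneousSpace ι 2) :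
    ∃ B : ℝ, 0 < B ∧ ∀ (w : dataSpace ι) (a c : ℝ), 0 < a → 0 < c →
      ∃ w' : dataSpace ι, (w'.1.1 : R3 → R3) =ᵐ[volume] (fun x => a • w.1.1 (c • x)) ∧
        ‖w'‖ ≤ B * (a * c ^ (-(3 / 2) : ℝ)) * ‖w‖ := by
  obtain ⟨B, hB, h⟩ := hZ.exists_dilate
  refine ⟨max 1 B, by positivity, fun w a c ha hc => ?_⟩
  obtain ⟨z, hz, hn⟩ := h a c ha hc _ _ w.2.2
  obtain ⟨w', h1, h2, h3⟩ := exists_dataSpace_affine w ha hc 0 (z := z) (by simpa using hz)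
  refine ⟨w', by simpa using h1, ?_⟩
  have e : (3 * (2 : ℝ≥0∞)⁻¹.toReal) = 3 / 2 := by simp; norm_num
  rw [e] at hn
  have hk : 0 < a * c ^ (-(3 / 2) : ℝ) := by positivity
  rw [norm_dataSpace, h2, h3]
  refine max_le ?_ (hn.trans ?_)
  · calc a * c ^ (-(3 / 2) : ℝ) * ‖w.1.1‖ = 1 * (a * c ^ (-(3 / 2) : ℝ)) * ‖w.1.1‖ := by ring
      _ ≤ max 1 B * (a * c ^ (-(3 / 2) : ℝ)) * ‖w‖ := by
        gcongr
        · exact le_max_left _ _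
        · exact le_max_left _ _
  · gcongr
    · exact le_max_right _ _
    · exact le_max_right _ _

theorem dataSpace_eq_zero (hι : Function.Injective ι) {w : dataSpace ι}
    (h : (w.1.1 : R3 → R3) =ᵐ[volume] 0) : w = 0 := by
  have h1 : w.1.1 = 0 := (Lp.eq_zero_iff_ae_eq_zero).2 h
  have h2 : ι w.1.2 = 0 := by
    ext φ : 1
    rw [(w.2.2 φ).2]
    refine integral_eq_zero_of_ae ?_
    filter_upwards [h] with x hx
    rw [hx]
    simp
  have h3 : w.1.2 = 0 := hι (by rw [h2, map_zero])
  exact Subtype.ext (Prod.ext h1 h3)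

theorem isClosed_dataSpace (ι : Z →L[ℝ] VecDist) :
    IsClosed (dataSpace ι : Set (Lp R3 2 (volume : Measure R3) × Z)) := by
  have hm : ∀ (φ : 𝓢(R3, ℝ)) (v : R3), MemLp (fun x => φ x • v) 2 (volume : Measure R3) := by
    intro φ v
    have h := φ.memLp 2 (volume : Measure R3)
    exact (ContinuousLinearMap.toSpanSingleton ℝ v).comp_memLp' h
  have hint : ∀ (φ : 𝓢(R3, ℝ)) (f : Lp R3 2 (volume : Measure R3)),
      Integrable (fun x => φ x • f x) := fun φ f =>
    memLp_one_iff_integrable.1 ((Lp.memLp f).smul (φ.memLp 2 (volume : Measure R3)))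
  have key : (dataSpace ι : Set (Lp R3 2 (volume : Measure R3) × Z)) = {q | q.1 ∈ L2sigma} ∩
      ⋂ (φ : 𝓢(R3, ℝ)) (v : R3), {q | inner ℝ v (ι q.2 φ) = inner ℝ q.1 ((hm φ v).toLp)} := by
    have hkey : ∀ (φ : 𝓢(R3, ℝ)) (v : R3) (f : Lp R3 2 (volume : Measure R3)),
        inner ℝ f ((hm φ v).toLp) = inner ℝ v (∫ x, φ x • f x) := by
      intro φ v f
      rw [← integral_inner (hint φ f), L2.inner_def]
      refine integral_congr_ae ?_
      filter_upwards [(hm φ v).coeFn_toLp] with x hx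
      rw [hx, real_inner_smul_right, real_inner_smul_right, real_inner_comm]
    ext q
    simp only [mem_inter_iff, mem_iInter, mem_ofPred_eq, SetLike.mem_coe, hkey]
    constructor
    · exact fun hq => ⟨hq.1, fun φ v => by rw [(hq.2 φ).2]⟩
    · exact fun hq => ⟨hq.1, fun φ => ⟨hint φ q.1, ext_inner_left ℝ (hq.2 φ)⟩⟩
  rw [key]
  refine (isClosed_L2sigma.preimage continuous_fst).inter ?_
  refine isClosed_iInter fun φ => isClosed_iInter fun v => isClosed_eq ?_ (by fun_prop)
  have h1 : Continuous fun T : VecDist => T φ := (PointwiseConvergenceCLM.evalCLM _ _ φ).continuous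
  have h2 : Continuous fun q : Lp R3 2 (volume : Measure R3) × Z => ι q.2 φ :=
    h1.comp (ι.continuous.comp continuous_snd)
  exact continuous_const.inner h2

end DataSpace

/-! ### Uniform boundedness and scaling -/

/-- Far translates of an `L²` field tend to zero weakly. -/
theorem tendsto_pairing_translate {v : R3 → R3} (hv : MemLp v 2) {y : ℕ → R3}
    (hy : Tendsto (fun j => ‖y j‖) atTop atTop) {φ : R3 → R3} (hφ : Continuous φ)
    (hφc : HasCompactSupport φ) :
    Tendsto (fun j => pairing (fun x => v (x + y j)) φ) atTop (𝓝 0) := by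
  have hφm : MemLp φ 2 (volume : Measure R3) := hφ.memLp_of_hasCompactSupport hφc
  obtain ⟨R, hR⟩ := hφc.isCompact.isBounded.subset_ball (0 : R3)
  let w : ℕ → R3 → R3 := fun j => (Metric.ball (y j) R).indicator v
  have hw : ∀ j, MemLp (w j) 2 volume := fun j => hv.indicator measurableSet_ball
  -- only the part of `v` near `y j` meets the support of `φ`
  have e : ∀ j, pairing (fun x => v (x + y j)) φ = pairing (fun x => w j (x + y j)) φ := by
    intro j
    refine integral_congr_ae (Eventually.of_forall fun x => ?_)
    by_cases hx : φ x = 0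
    · simp only [hx, inner_zero_right]
    · have h1 : x + y j ∈ Metric.ball (y j) R := by
        have h2 := hR (subset_tsupport _ hx)
        simpa [Metric.mem_ball, dist_eq_norm] using h2
      simp only [w, indicator_of_mem h1]
  have hlim : Tendsto (fun j => eLpNorm (w j) 2 volume) atTop (𝓝 0) := by
    have h1 : Tendsto (fun j => ∫⁻ x, ‖w j x‖ₑ ^ 2) atTop (𝓝 (∫⁻ _ : R3, 0)) := by
      refine tendsto_lintegral_of_dominated_convergence' (fun x => ‖v x‖ₑ ^ 2)
        (fun j => (hw j).1.enorm.pow_const 2) (fun j => Eventually.of_forall fun x => ?_) ?_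
        (Eventually.of_forall fun x => ?_)
      · exact pow_le_pow_left' (enorm_indicator_le_enorm_self _ _) 2
      · rw [lintegral_enorm_sq_eq]
        exact ENNReal.pow_ne_top hv.2.ne
      · refine tendsto_const_nhds.congr' ?_
        filter_upwards [hy.eventually_gt_atTop (R + ‖x‖)] with j hj
        have h2 : x ∉ Metric.ball (y j) R := by
          rw [Metric.mem_ball, dist_eq_norm, norm_sub_rev]
          have := norm_sub_norm_le (y j) x
          linarith
        simp only [w, indicator_of_notMem h2, enorm_zero]
        norm_num
    simp only [lintegral_enorm_sq_eq, lintegral_zero] at h1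
    have h2 := (ENNReal.continuous_rpow_const (y := 1 / 2)).continuousAt.tendsto.comp h1
    rw [ENNReal.zero_rpow_of_pos (by norm_num)] at h2
    refine h2.congr fun j => ?_
    simp only [Function.comp_apply]
    rw [← ENNReal.rpow_natCast, ← ENNReal.rpow_mul]
    norm_num
  have hlim' : Tendsto (fun j => (eLpNorm (w j) 2 volume).toReal *
      (eLpNorm φ 2 volume).toReal) atTop (𝓝 0) := by
    have h1 := (ENNReal.tendsto_toReal ENNReal.zero_ne_top).comp hlim
    have h2 := h1.mul_const (eLpNorm φ 2 (volume : Measure R3)).toReal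
    rw [ENNReal.toReal_zero, zero_mul] at h2
    exact h2
  refine squeeze_zero_norm (fun j => ?_) hlim'
  have hmp := measurePreserving_add_right (volume : Measure R3) (y j)
  have hm : MemLp (fun x => w j (x + y j)) 2 volume := (hw j).comp_measurePreserving hmp
  rw [e j, Real.norm_eq_abs]
  refine abs_integral_inner_le (a := (eLpNorm (w j) 2 volume).toNNReal)
    (b := (eLpNorm φ 2 volume).toNNReal) hm hφm ?_ (ENNReal.coe_toNNReal hφm.2.ne).ge
  rw [ENNReal.coe_toNNReal (hw j).2.ne]
  exact (eLpNorm_comp_measurePreserving (hw j).1 hmp).le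

theorem not_isMeagre_univ_of_isClosed {E : Type*} [NormedAddCommGroup E] [NormedSpace ℝ E]
    [CompleteSpace E] {p : Submodule ℝ E} (hp : IsClosed (p : Set E)) :
    ¬IsMeagre (univ : Set p) := by
  have : CompleteSpace p := hp.completeSpace_coe
  exact not_isMeagre_of_isOpen isOpen_univ univ_nonempty

section UniformBoundedness

variable {X Z : Type*} [NormedAddCommGroup X] [NormedSpace ℝ X] [NormedAddCommGroup Z]
  [NormedSpace ℝ Z] {ιX : X →L[ℝ] VecDist} {ιZ : Z →L[ℝ] VecDist} {r s : ℝ≥0∞}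

/-- The data that have solutions with bounds `M` for all viscosities in `Λ`. -/
def boundedData (ιX : X →L[ℝ] VecDist) (ιZ : Z →L[ℝ] VecDist) (r : ℝ≥0∞) (Λ : Set ℝ) (M : ℝ≥0) :
    Set (dataSpace ιZ) :=
  {u₀ | ∀ ν ∈ Λ, HasBoundedSolution ιX r ν u₀.1.1 M M}

theorem isClosed_boundedData (hFatou : HasFatouTime ιX r) {Λ : Set ℝ} (hΛ : ∀ ν ∈ Λ, 0 < ν)
    (M : ℝ≥0) : IsClosed (boundedData ιX ιZ r Λ M) := by
  refine IsSeqClosed.isClosed fun w w' hw hlim ν hν => ?_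
  refine HasBoundedSolution.of_weak_limit hFatou (hΛ ν hν) (fun φ hφ hφc => ?_) fun j => hw j ν hν
  have hφm : MemLp φ 2 (volume : Measure R3) := hφ.memLp_of_hasCompactSupport hφc
  have e : ∀ u₀ : dataSpace ιZ, pairing u₀.1.1 φ = inner ℝ u₀.1.1 (hφm.toLp φ) := by
    intro u₀
    rw [pairing, integral_inner_eq_inner_toLp (Lp.memLp u₀.1.1) hφm, Lp.toLp_coeFn]
  simp only [e]
  have hc : Continuous fun u₀ : dataSpace ιZ => inner ℝ u₀.1.1 (hφm.toLp φ) := by fun_prop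
  exact (hc.tendsto w').comp hlim

/-- A ball of data with bounded solutions can be moved to the origin: if `u₁ + w(· - y_j)` has
bounded solutions with `|y_j| → ∞`, then so has its translate `u₁(· + y_j) + w`, and these data
converge weakly to `w`. -/
theorem exists_ball_subset_boundedData (hFatou : HasFatouTime ιX r)
    (hX : IsTranslationInvariant ιX) (hZ : IsTranslationInvariant ιZ) {Λ : Set ℝ}
    (hΛ : ∀ ν ∈ Λ, 0 < ν) {M : ℝ≥0} (h : (interior (boundedData ιX ιZ r Λ M)).Nonempty) :
    ∃ ε > 0, ∀ w : dataSpace ιZ, ‖w‖ < ε → w ∈ boundedData ιX ιZ r Λ M := by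
  obtain ⟨u₁, hu₁⟩ := h
  obtain ⟨ε, hε, hball⟩ := Metric.mem_nhds_iff.1 (mem_interior_iff_mem_nhds.1 hu₁)
  refine ⟨ε, hε, fun w hw ν hν => ?_⟩
  let y : ℕ → R3 := fun j => (j : ℝ) • EuclideanSpace.single 0 1
  have hy : Tendsto (fun j => ‖y j‖) atTop atTop := by
    have : (fun j => ‖y j‖) = fun j : ℕ => (j : ℝ) := by
      funext j
      simp [y, norm_smul]
    rw [this]
    exact tendsto_natCast_atTop_atTop
  choose w' hw' hwn using fun j => exists_dataSpace_translate hZ w (-y j)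
  refine HasBoundedSolution.of_weak_limit hFatou (hΛ ν hν)
    (f := fun j x => u₁.1.1 (x + y j) + w.1.1 x) (fun φ hφ hφc => ?_) fun j => ?_
  · have hφm : MemLp φ 2 (volume : Measure R3) := hφ.memLp_of_hasCompactSupport hφc
    have h1 := (tendsto_pairing_translate (Lp.memLp u₁.1.1) hy hφ hφc).add_const
      (pairing w.1.1 φ)
    rw [zero_add] at h1
    refine h1.congr fun j => ?_
    have hm : MemLp (fun x => u₁.1.1 (x + y j)) 2 volume :=
      (Lp.memLp u₁.1.1).comp_measurePreserving (measurePreserving_add_right volume (y j))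
    simp only [pairing, inner_add_left]
    rw [integral_add (integrable_inner_of_memLp hm hφm)
      (integrable_inner_of_memLp (Lp.memLp w.1.1) hφm)]
  · have h1 : u₁ + w' j ∈ boundedData ιX ιZ r Λ M := by
      refine hball ?_
      rw [Metric.mem_ball, dist_eq_norm, add_sub_cancel_left, hwn j]
      exact hw
    refine (h1 ν hν).translate hX (y j) ?_
    have hq := measurePreserving_add_right (volume : Measure R3) (y j)
    have h2 := hq.quasiMeasurePreserving.ae (Lp.coeFn_add u₁.1.1 (w' j).1.1)
    have h3 := hq.quasiMeasurePreserving.ae (hw' j)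
    filter_upwards [h2, h3] with x h4 h5
    have e : ((u₁ + w' j : dataSpace ιZ)).1.1 = u₁.1.1 + (w' j).1.1 := rfl
    rw [e, h4, Pi.add_apply, h5, add_neg_cancel_right]

/-- If a non-meagre set of data is covered by the sets `boundedData ιX ιZ r (Λ n) n`, which are
closed, then one of them has an interior point and thus contains a ball around the origin. -/
theorem exists_ball_of_not_isMeagre (hFatou : HasFatouTime ιX r)
    (hX : IsTranslationInvariant ιX) (hZ : IsTranslationInvariant ιZ) {Λ : ℕ → Set ℝ}
    (hΛ : ∀ n, ∀ ν ∈ Λ n, 0 < ν) {S : Set (dataSpace ιZ)} (hS : ¬IsMeagre S)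
    (hsub : ∀ u₀ ∈ S, ∃ n : ℕ, u₀ ∈ boundedData ιX ιZ r (Λ n) n) :
    ∃ n : ℕ, ∃ ε > 0, ∀ w : dataSpace ιZ, ‖w‖ < ε → w ∈ boundedData ιX ιZ r (Λ n) n := by
  by_contra hcon
  push Not at hcon
  refine hS (IsMeagre.mono (fun u₀ h => mem_iUnion.2 (hsub u₀ h)) (isMeagre_iUnion fun n => ?_))
  refine IsNowhereDense.isMeagre ((isClosed_boundedData hFatou (hΛ n) n).isNowhereDense_iff.2 ?_)
  by_contra hne
  obtain ⟨ε, hε, hb⟩ := exists_ball_subset_boundedData hFatou hX hZ (hΛ n)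
    (nonempty_iff_ne_empty.2 hne)
  obtain ⟨w, hw, hnot⟩ := hcon n ε hε
  exact hnot (hb w hw)

theorem not_isMeagre_univ_dataSpace [CompleteSpace Z] :
    ¬IsMeagre (univ : Set (dataSpace ιZ)) :=
  not_isMeagre_univ_of_isClosed (isClosed_dataSpace ιZ)

end UniformBoundedness

/-- The powers of `k` and `q` produced by the scaling of the `L^r(0, ∞; X)` norm. -/
theorem scaling_exponents {k q ρ σ : ℝ} (hk : 0 < k) (hq : 0 < q) :
    (k ^ 3 * q ^ 2) * ((k * q) ^ 2) ^ (-(3 * σ)) * ((k ^ 3 * q ^ 2) * (k * q) ^ 2) ^ (-ρ) =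
      k⁻¹ ^ (3 * (5 / 3 * ρ + 2 * σ - 1)) * q⁻¹ ^ (2 * (2 * ρ + 3 * σ - 1)) := by
  have hk' : ∀ n : ℕ, k ^ n = Real.exp (n * Real.log k) := fun n => by
    rw [Real.exp_nat_mul, Real.exp_log hk]
  have hq' : ∀ n : ℕ, q ^ n = Real.exp (n * Real.log q) := fun n => by
    rw [Real.exp_nat_mul, Real.exp_log hq]
  have e1 : (k * q) ^ 2 = Real.exp (2 * Real.log k + 2 * Real.log q) := by
    rw [mul_pow, hk', hq', ← Real.exp_add]
    norm_num
  have e2 : k ^ 3 * q ^ 2 = Real.exp (3 * Real.log k + 2 * Real.log q) := by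
    rw [hk', hq', ← Real.exp_add]
    norm_num
  have e3 : k⁻¹ = Real.exp (-Real.log k) := by rw [Real.exp_neg, Real.exp_log hk]
  have e4 : q⁻¹ = Real.exp (-Real.log q) := by rw [Real.exp_neg, Real.exp_log hq]
  rw [e1, e2, e3, e4]
  simp only [← Real.exp_add, ← Real.exp_mul]
  congr 1
  ring

section Estimates

variable {X Z : Type*} [NormedAddCommGroup X] [NormedSpace ℝ X] [NormedAddCommGroup Z]
  [NormedSpace ℝ Z] {ιX : X →L[ℝ] VecDist} {ιZ : Z →L[ℝ] VecDist} {r s : ℝ≥0∞}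

/-- Scaling of bounded solutions for the viscosity `ν'` and data in a ball around the origin, with
free parameters `k`, the ratio of the viscosities, and `q`, the reciprocal of the size of the
solution. These fix the scaling `a u(a c t, c x)` through `a / c = k` and `a c ^ (-3 / 2) = q⁻¹`. -/
theorem exists_scaled_solution {B B' ε ν' σ κ θ : ℝ} (hB : 0 < B)
    (hX : ∀ (a c : ℝ), 0 < a → 0 < c → ∀ (x : X) (f : R3 → R3), Represents (ιX x) f →
      ∃ w : X, Represents (ιX w) (fun x => a • f (c • x)) ∧
        ‖w‖ ≤ B * (a * c ^ (-(3 * σ))) * ‖x‖)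
    (hZ : ∀ (w : dataSpace ιZ) (a c : ℝ), 0 < a → 0 < c →
      ∃ w' : dataSpace ιZ, (w'.1.1 : R3 → R3) =ᵐ[volume] (fun x => a • w.1.1 (c • x)) ∧
        ‖w'‖ ≤ B' * (a * c ^ (-(3 / 2) : ℝ)) * ‖w‖)
    (hκ : 3 * (5 / 3 * r⁻¹.toReal + 2 * σ - 1) = κ) (hθ : 2 * (2 * r⁻¹.toReal + 3 * σ - 1) = θ)
    {M : ℝ≥0}
    (hball : ∀ w : dataSpace ιZ, ‖w‖ < ε → HasBoundedSolution ιX r ν' w.1.1 M M)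
    {k q : ℝ} (hk : 0 < k) (hq : 0 < q) (u₀ : dataSpace ιZ) (hu₀ : B' * q * ‖u₀‖ < ε) :
    ∃ u, IsWeakSolution (ν' * k) u₀.1.1 u ∧
      energyNorm (ν' * k) u ≤ ENNReal.ofReal (2 * M * q⁻¹) ∧
      lrNorm ιX r u ≤ ENNReal.ofReal (B * M * (k⁻¹ ^ κ * q⁻¹ ^ θ)) := by
  -- the solution of `a / c = k`, `a c ^ (-3 / 2) = q⁻¹`
  obtain ⟨c, hc⟩ : ∃ c, c = (k * q) ^ 2 := ⟨_, rfl⟩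
  obtain ⟨a, ha⟩ : ∃ a, a = k ^ 3 * q ^ 2 := ⟨_, rfl⟩
  have hcpos : 0 < c := hc ▸ by positivity
  have hapos : 0 < a := ha ▸ by positivity
  have hc32 : c ^ (3 / 2 : ℝ) = (k * q) ^ 3 := by
    rw [hc, ← Real.rpow_natCast, ← Real.rpow_natCast, ← Real.rpow_mul (by positivity)]
    norm_num
  obtain ⟨w, hw, hwn⟩ := hZ u₀ a⁻¹ c⁻¹ (inv_pos.2 hapos) (inv_pos.2 hcpos)
  have hwε : ‖w‖ < ε := by
    refine hwn.trans_lt ?_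
    have e1 : a⁻¹ * c⁻¹ ^ (-(3 / 2) : ℝ) = q := by
      rw [Real.inv_rpow hcpos.le, ← Real.rpow_neg hcpos.le, neg_neg, hc32, ha]
      field_simp
    rwa [e1]
  have hu : (u₀.1.1 : R3 → R3) =ᵐ[volume] fun x => a • w.1.1 (c • x) := by
    have h1 := (quasiMeasurePreserving_affine hcpos 0).ae hw
    filter_upwards [h1] with x hx
    rw [add_zero] at hx
    rw [hx, smul_smul, smul_smul, mul_inv_cancel₀ hapos.ne', inv_mul_cancel₀ hcpos.ne',
      one_smul, one_smul]
  obtain ⟨u, h1, h2, h3⟩ := (hball w hwε).rescale hB hX hapos hcpos hu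
  have eν : ν' * a / c = ν' * k := by
    rw [ha, hc]
    field_simp
  rw [eν] at h1 h2
  refine ⟨u, h1, h2.trans_eq ?_, h3.trans_eq ?_⟩
  · congr 1
    rw [Real.rpow_neg hcpos.le, hc32, ha]
    field_simp
  · congr 1
    rw [← hκ, ← hθ, ← scaling_exponents hk hq, ← ha, ← hc]
    ring

/-- Bounded solutions for the viscosity `ν'` and all data in a ball around the origin give, by
scaling, the a priori estimates for all viscosities `ν` and all data. -/
theorem exists_estimate_of_ball (hXhom : IsHomogeneousSpace ιX s)
    (hZhom : IsHomogeneousSpace ιZ 2) (M : ℝ≥0) {ε : ℝ} (hε : 0 < ε) {κ θ : ℝ}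
    (hκ : 3 * (5 / 3 * r⁻¹.toReal + 2 * s⁻¹.toReal - 1) = κ)
    (hθ : 2 * (2 * r⁻¹.toReal + 3 * s⁻¹.toReal - 1) = θ) :
    ∃ C : ℝ, 0 < C ∧ ∀ ν' : ℝ, 0 < ν' →
      (∀ w : dataSpace ιZ, ‖w‖ < ε → HasBoundedSolution ιX r ν' w.1.1 M M) →
      ∀ ν : ℝ, 0 < ν → ∀ u₀ : dataSpace ιZ, ∃ u, IsWeakSolution ν u₀.1.1 u ∧
        energyNorm ν u ≤ ENNReal.ofReal (C * max ‖u₀.1.1‖ ‖u₀.1.2‖) ∧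
        lrNorm ιX r u ≤ ENNReal.ofReal
          (C * (ν' / ν) ^ κ * max (‖u₀.1.1‖ ^ θ) (‖u₀.1.2‖ ^ θ)) := by
  obtain ⟨B, hB, hXd⟩ := hXhom.exists_dilate
  obtain ⟨B', hB', hZd⟩ := exists_dataSpace_dilate hZhom
  obtain ⟨δ, hδdef⟩ : ∃ δ : ℝ, δ = ε / (2 * B') := ⟨_, rfl⟩
  have hδ : 0 < δ := hδdef ▸ by positivity
  have hscale := fun (ν' : ℝ)
      (hball : ∀ w : dataSpace ιZ, ‖w‖ < ε → HasBoundedSolution ιX r ν' w.1.1 M M)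
      (k : ℝ) (hk : 0 < k) (q : ℝ) (hq : 0 < q) (u₀ : dataSpace ιZ) (hu₀ : B' * q * ‖u₀‖ < ε) =>
    exists_scaled_solution (r := r) (ε := ε) (ν' := ν') hB hXd hZd hκ hθ (M := M) hball
      (k := k) (q := q) hk hq u₀ hu₀
  refine ⟨2 * M / δ + B * M * δ⁻¹ ^ θ + 1, by positivity, fun ν' hν' hball ν hν u₀ => ?_⟩
  have hC1 : 2 * M / δ ≤ 2 * M / δ + B * M * δ⁻¹ ^ θ + 1 := by
    have : 0 ≤ B * M * δ⁻¹ ^ θ := by positivity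
    linarith
  have hC2 : B * M * δ⁻¹ ^ θ ≤ 2 * M / δ + B * M * δ⁻¹ ^ θ + 1 := by
    have : 0 ≤ 2 * M / δ := by positivity
    linarith
  generalize 2 * M / δ + B * M * δ⁻¹ ^ θ + 1 = C at hC1 hC2 ⊢
  obtain ⟨N, hN⟩ : ∃ N, N = max ‖u₀.1.1‖ ‖u₀.1.2‖ := ⟨_, rfl⟩
  have hu₀N : ‖u₀‖ = N := hN.symm
  rw [← hN]
  rcases (hu₀N ▸ norm_nonneg u₀ : 0 ≤ N).eq_or_lt with hN0 | hNpos
  · have h0 : u₀ = 0 := norm_eq_zero.1 (hu₀N.trans hN0.symm)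
    have h1 : (u₀.1.1 : R3 → R3) =ᵐ[volume] 0 := by
      rw [h0]
      exact Lp.coeFn_zero _ _ _
    refine ⟨_, isWeakSolution_zero ν h1, ?_, ?_⟩
    · rw [energyNorm_zero]
      exact bot_le
    · rw [lrNorm_zero]
      exact bot_le
  -- the viscosity and the size of the datum fix the two scaling parameters
  obtain ⟨u, h1, h2, h3⟩ := hscale ν' hball (ν / ν') (div_pos hν hν') (δ / N) (div_pos hδ hNpos) u₀
    (by
      have e2 : B' * (δ / N) * N = ε / 2 := by
        rw [hδdef]
        field_simp
      rw [hu₀N, e2]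
      linarith)
  rw [mul_div_cancel₀ _ hν'.ne'] at h1 h2
  rw [inv_div] at h2
  rw [inv_div, inv_div] at h3
  refine ⟨u, h1, h2.trans (ENNReal.ofReal_le_ofReal ?_), h3.trans (ENNReal.ofReal_le_ofReal ?_)⟩
  · calc 2 * M * (N / δ) = (2 * M / δ) * N := by ring
      _ ≤ C * N := mul_le_mul_of_nonneg_right hC1 hNpos.le
  · have e4 : N ^ θ ≤ max (‖u₀.1.1‖ ^ θ) (‖u₀.1.2‖ ^ θ) := by
      rcases max_choice ‖u₀.1.1‖ ‖u₀.1.2‖ with h | h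
      · rw [hN, h]
        exact le_max_left _ _
      · rw [hN, h]
        exact le_max_right _ _
    have hκ : 0 ≤ (ν' / ν) ^ κ := Real.rpow_nonneg (div_pos hν' hν).le _
    have hC0 : 0 ≤ C := le_trans (by positivity) hC1
    calc B * M * ((ν' / ν) ^ κ * (N / δ) ^ θ) = (B * M * δ⁻¹ ^ θ) * (ν' / ν) ^ κ * N ^ θ := by
          rw [div_eq_inv_mul N δ, Real.mul_rpow (by positivity) hNpos.le]
          ring
      _ ≤ C * (ν' / ν) ^ κ * max (‖u₀.1.1‖ ^ θ) (‖u₀.1.2‖ ^ θ) :=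
          mul_le_mul (mul_le_mul_of_nonneg_right hC2 hκ) e4 (Real.rpow_nonneg hNpos.le _)
            (mul_nonneg hC0 hκ)

end Estimates

/-! ### The implications between the claims -/

section Implications

variable {X Z : Type*} [NormedAddCommGroup X] [NormedSpace ℝ X] [NormedAddCommGroup Z]
  [NormedSpace ℝ Z] {ιX : X →L[ℝ] VecDist} {ιZ : Z →L[ℝ] VecDist} {r s : ℝ≥0∞}

/-- The factor `ν' ^ κ` of a fixed viscosity `ν'` can be absorbed in the constant. -/
theorem aprioriEstimate_of_viscosity {ν' C : ℝ} (hν' : 0 < ν') (hC : 0 < C)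
    (h : ∀ ν : ℝ, 0 < ν → ∀ u₀ : dataSpace ιZ, ∃ u, IsWeakSolution ν u₀.1.1 u ∧
      energyNorm ν u ≤ ENNReal.ofReal (C * max ‖u₀.1.1‖ ‖u₀.1.2‖) ∧
      lrNorm ιX r u ≤ ENNReal.ofReal
        (C * (ν' / ν) ^ (3 * (5 / 3 * r⁻¹.toReal + 2 * s⁻¹.toReal - 1)) *
          max (‖u₀.1.1‖ ^ (2 * (2 * r⁻¹.toReal + 3 * s⁻¹.toReal - 1)))
            (‖u₀.1.2‖ ^ (2 * (2 * r⁻¹.toReal + 3 * s⁻¹.toReal - 1))))) :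
    AprioriEstimate ιX ιZ r s := by
  set κ := 3 * (5 / 3 * r⁻¹.toReal + 2 * s⁻¹.toReal - 1) with hκ
  have hpow : 0 < ν' ^ κ := Real.rpow_pos_of_pos hν' κ
  refine ⟨C * max 1 (ν' ^ κ), by positivity, fun ν hν u₀ => ?_⟩
  obtain ⟨u, h1, h2, h3⟩ := h ν hν u₀
  refine ⟨u, h1, h2.trans (ENNReal.ofReal_le_ofReal ?_), h3.trans (ENNReal.ofReal_le_ofReal ?_)⟩
  · gcongr
    exact le_mul_of_one_le_right hC.le (le_max_left _ _)
  · have e : -3 * (5 / 3 * r⁻¹.toReal + 2 * s⁻¹.toReal - 1) = -κ := by rw [hκ]; ring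
    rw [e, Real.div_rpow hν'.le hν.le, div_eq_mul_inv, ← Real.rpow_neg hν.le, ← mul_assoc]
    gcongr
    exact le_max_right _ _

theorem SolvableNonMeagre.aprioriEstimate (hXtrans : IsTranslationInvariant ιX)
    (hZtrans : IsTranslationInvariant ιZ) (hXhom : IsHomogeneousSpace ιX s)
    (hZhom : IsHomogeneousSpace ιZ 2) (hFatou : HasFatouTime ιX r)
    (h : SolvableNonMeagre ιX ιZ r) : AprioriEstimate ιX ιZ r s := by
  obtain ⟨ν', hν', hS⟩ := h
  obtain ⟨n, ε, hε, hball⟩ := exists_ball_of_not_isMeagre hFatou hXtrans hZtrans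
    (Λ := fun _ => {ν'}) (fun _ ν hν => (mem_singleton_iff.1 hν) ▸ hν') hS (by
      rintro u₀ ⟨u, hu, hr⟩
      have hfin : energyNorm ν' u + lrNorm ιX r u ≠ ⊤ :=
        (ENNReal.add_lt_top.2 ⟨ENNReal.add_lt_top.2 ⟨hu.memL2.2,
          ENNReal.mul_lt_top ENNReal.ofReal_lt_top hu.memH1⟩, hr⟩).ne
      obtain ⟨n, hn⟩ := ENNReal.exists_nat_gt hfin
      refine ⟨n, fun ν hν => ?_⟩
      rw [mem_singleton_iff.1 hν]
      exact hu.hasBoundedSolution (by exact_mod_cast hn))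
  obtain ⟨C, hC, hest⟩ := exists_estimate_of_ball hXhom hZhom (n : ℝ≥0) hε rfl rfl
  exact aprioriEstimate_of_viscosity hν' hC (hest ν' hν' fun w hw => hball w hw ν' rfl)

theorem AprioriEstimate.solvableNonMeagre [CompleteSpace Z] (h : AprioriEstimate ιX ιZ r s) :
    SolvableNonMeagre ιX ιZ r := by
  obtain ⟨C, hC, h⟩ := h
  refine ⟨1, one_pos, ?_⟩
  have : {u₀ : dataSpace ιZ | ∃ u, IsWeakSolution 1 u₀.1.1 u ∧ lrNorm ιX r u < ⊤} = univ := by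
    refine eq_univ_of_forall fun u₀ => ?_
    obtain ⟨u, h1, -, h3⟩ := h 1 one_pos u₀
    exact ⟨u, h1, h3.trans_lt ENNReal.ofReal_lt_top⟩
  rw [this]
  exact not_isMeagre_univ_dataSpace

/-- A nonzero datum has no solutions with bounded viscosity and energy that are arbitrarily small
in `L^r(0, ∞; X)`. -/
theorem false_of_small_solutions (hι : Function.Injective ιZ) (hr : r ≠ 0) {u₀ : dataSpace ιZ}
    (hu₀ : u₀ ≠ 0) {K : ℝ} {a : ℝ → ℝ} (ha : Tendsto a (𝓝[>] 0) (𝓝 0))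
    (h : ∀ᶠ τ in 𝓝[>] 0, ∃ (ν : ℝ) (u : ℝ → R3 → R3), 0 ≤ ν ∧ ν ≤ 1 ∧ IsWeakSolution ν u₀.1.1 u ∧
      energyNorm ν u ≤ ENNReal.ofReal K ∧ lrNorm ιX r u ≤ ENNReal.ofReal (a τ)) : False := by
  refine hu₀ (dataSpace_eq_zero hι (ae_eq_zero_of_small_solutions ιX hr (Lp.memLp u₀.1.1) u₀.2.1
    (M := K.toNNReal) (V := 1) fun ε hε => ?_))
  have h0 : Tendsto (fun τ => ENNReal.ofReal (a τ)) (𝓝[>] 0) (𝓝 0) := by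
    have h1 := (ENNReal.continuous_ofReal.tendsto 0).comp ha
    rwa [ENNReal.ofReal_zero] at h1
  obtain ⟨τ, ⟨ν, u, h1, h2, h3, h4, h5⟩, h6⟩ := (h.and (h0.eventually_lt_const hε)).exists
  exact ⟨ν, u, h1, by simpa using h2, h3, le_self_add.trans h4, h5.trans_lt h6⟩

theorem tendsto_const_mul_rpow_zero {p : ℝ} (hp : 0 < p) (A B : ℝ) :
    Tendsto (fun τ : ℝ => A * τ ^ p * B) (𝓝[>] 0) (𝓝 0) := by
  have h1 := ((Real.continuousAt_rpow_const 0 p (Or.inr hp.le)).tendsto).mono_left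
    (nhdsWithin_le_nhds (s := Ioi 0))
  rw [Real.zero_rpow hp.ne'] at h1
  simpa using (h1.const_mul A).mul_const B

theorem AprioriEstimate.one_le (hι : Function.Injective ιZ) (hr : r ≠ 0)
    (hdata : ∃ u₀ : dataSpace ιZ, u₀ ≠ 0) (h : AprioriEstimate ιX ιZ r s) :
    1 ≤ 5 / 3 * r⁻¹.toReal + 2 * s⁻¹.toReal := by
  by_contra hlt
  push Not at hlt
  obtain ⟨u₀, hu₀⟩ := hdata
  obtain ⟨C, hC, h⟩ := h
  have hp : 0 < -3 * (5 / 3 * r⁻¹.toReal + 2 * s⁻¹.toReal - 1) := by linarith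
  -- the exponent of `ν` is positive, so the estimate degenerates to zero as
  -- the viscosity tends to zero
  refine false_of_small_solutions (ιX := ιX) (K := C * max ‖u₀.1.1‖ ‖u₀.1.2‖) hι hr hu₀
    (tendsto_const_mul_rpow_zero hp C
      (max (‖u₀.1.1‖ ^ (2 * (2 * r⁻¹.toReal + 3 * s⁻¹.toReal - 1)))
        (‖u₀.1.2‖ ^ (2 * (2 * r⁻¹.toReal + 3 * s⁻¹.toReal - 1))))) ?_
  filter_upwards [Ioc_mem_nhdsGT (one_pos (α := ℝ))] with ν hν
  obtain ⟨u, h1, h2, h3⟩ := h ν hν.1 u₀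
  exact ⟨ν, u, hν.1.le, hν.2, h1, h2, h3⟩

theorem UniformNonMeagre.uniformAprioriEstimate (hXtrans : IsTranslationInvariant ιX)
    (hZtrans : IsTranslationInvariant ιZ) (hXhom : IsHomogeneousSpace ιX s)
    (hZhom : IsHomogeneousSpace ιZ 2) (hFatou : HasFatouTime ιX r)
    (h : UniformNonMeagre ιX ιZ r) : UniformAprioriEstimate ιX ιZ r s := by
  obtain ⟨n, ε, hε, hball⟩ := exists_ball_of_not_isMeagre hFatou hXtrans hZtrans
    (Λ := fun n => Ioc 0 (1 / ((n : ℝ) + 1))) (fun _ ν hν => hν.1) h (by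
      intro u₀ hu₀
      obtain ⟨K, hK1, hK2⟩ := ENNReal.lt_iff_exists_nnreal_btwn.1 (mem_ofPred_eq ▸ hu₀ :)
      obtain ⟨δ, hδ, hδK⟩ := mem_nhdsGT_iff_exists_Ioc_subset.1
        (eventually_lt_of_limsup_lt hK1)
      obtain ⟨m, hm⟩ := exists_nat_one_div_lt (mem_Ioi.1 hδ)
      obtain ⟨k, hk⟩ := exists_nat_ge K
      refine ⟨max m k, fun ν hν => ?_⟩
      have hνδ : ν ∈ Ioc 0 δ := by
        refine ⟨hν.1, hν.2.trans (le_trans ?_ hm.le)⟩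
        gcongr
        exact le_max_left _ _
      have h1 := hδK hνδ
      simp only [mem_ofPred_eq, iInf_lt_iff] at h1
      obtain ⟨u, hu, huK⟩ := h1
      have hKn : K ≤ ((max m k : ℕ) : ℝ≥0) := hk.trans (by exact_mod_cast le_max_right m k)
      exact (hu.hasBoundedSolution huK).mono hKn hKn)
  obtain ⟨C, hC, hest⟩ := exists_estimate_of_ball hXhom hZhom (n : ℝ≥0) hε rfl rfl
  exact ⟨1 / ((n : ℝ) + 1), C, by positivity, hC, fun ν hν ν' hν' hle u₀ =>
    hest ν' hν' (fun w hw => hball w hw ν' ⟨hν', hle⟩) ν hν u₀⟩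

theorem UniformAprioriEstimate.uniformNonMeagre [CompleteSpace Z]
    (h : UniformAprioriEstimate ιX ιZ r s) : UniformNonMeagre ιX ιZ r := by
  obtain ⟨ν₀, C, hν₀, hC, h⟩ := h
  rw [UniformNonMeagre]
  convert not_isMeagre_univ_dataSpace (ιZ := ιZ) using 2
  refine eq_univ_of_forall fun u₀ => ?_
  rw [mem_ofPred_eq]
  refine lt_of_le_of_lt (b := ENNReal.ofReal (C * max ‖u₀.1.1‖ ‖u₀.1.2‖) + ENNReal.ofReal
    (C * 1 * max (‖u₀.1.1‖ ^ (2 * (2 * r⁻¹.toReal + 3 * s⁻¹.toReal - 1)))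
      (‖u₀.1.2‖ ^ (2 * (2 * r⁻¹.toReal + 3 * s⁻¹.toReal - 1)))))
    (limsup_le_of_le (by isBoundedDefault) ?_)
    (ENNReal.add_lt_top.2 ⟨ENNReal.ofReal_lt_top, ENNReal.ofReal_lt_top⟩)
  filter_upwards [Ioc_mem_nhdsGT hν₀] with ν hν
  obtain ⟨u, h1, h2, h3⟩ := h ν hν.1 ν hν.1 hν.2 u₀
  rw [div_self hν.1.ne', Real.one_rpow] at h3
  exact iInf₂_le_of_le u h1 (add_le_add h2 h3)

theorem UniformAprioriEstimate.aprioriEstimate (h : UniformAprioriEstimate ιX ιZ r s) :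
    AprioriEstimate ιX ιZ r s := by
  obtain ⟨ν', C, hν', hC, h⟩ := h
  exact aprioriEstimate_of_viscosity hν' hC fun ν hν u₀ => h ν hν ν' hν' le_rfl u₀

theorem UniformAprioriEstimate.eq_one (hι : Function.Injective ιZ) (hr : r ≠ 0)
    (hdata : ∃ u₀ : dataSpace ιZ, u₀ ≠ 0) (h : UniformAprioriEstimate ιX ιZ r s) :
    5 / 3 * r⁻¹.toReal + 2 * s⁻¹.toReal = 1 := by
  refine le_antisymm ?_ (h.aprioriEstimate.one_le hι hr hdata)
  by_contra hlt
  push Not at hlt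
  obtain ⟨u₀, hu₀⟩ := hdata
  obtain ⟨ν₀, C, hν₀, hC, h⟩ := h
  have hp : 0 < 3 * (5 / 3 * r⁻¹.toReal + 2 * s⁻¹.toReal - 1) := by linarith
  -- at viscosity one the estimate degenerates to zero with the parameter `ν'`
  refine false_of_small_solutions (ιX := ιX) (K := C * max ‖u₀.1.1‖ ‖u₀.1.2‖) hι hr hu₀
    (tendsto_const_mul_rpow_zero hp C
      (max (‖u₀.1.1‖ ^ (2 * (2 * r⁻¹.toReal + 3 * s⁻¹.toReal - 1)))
        (‖u₀.1.2‖ ^ (2 * (2 * r⁻¹.toReal + 3 * s⁻¹.toReal - 1))))) ?_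
  filter_upwards [Ioc_mem_nhdsGT hν₀] with ν' hν'
  obtain ⟨u, h1, h2, h3⟩ := h 1 one_pos ν' hν'.1 hν'.2 u₀
  rw [div_one] at h3
  exact ⟨1, u, zero_le_one, le_rfl, h1, h2, h3⟩

end Implications

end NavierStokes

end

open NavierStokes in
theorem theorem1p2 {X : Type*} {Z : Type*}
    [NormedAddCommGroup X] [NormedSpace ℝ X] [CompleteSpace X] [Nontrivial X]
    [NormedAddCommGroup Z] [NormedSpace ℝ Z] [CompleteSpace Z]
    (ιX : X →L[ℝ] VecDist) (hιX : Function.Injective ιX)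
    (ιZ : Z →L[ℝ] VecDist) (hιZ : Function.Injective ιZ)
    (r s : ℝ≥0∞) (hr : 4 / 3 < r) (hs : 4 / 3 < s)
    (hrs : 1 < 2 * r⁻¹.toReal + 3 * s⁻¹.toReal)
    (hrs' : 2 * r⁻¹.toReal + 3 * s⁻¹.toReal < 3 / 2)
    (hXtrans : IsTranslationInvariant ιX) (hZtrans : IsTranslationInvariant ιZ)
    (hXhom : IsHomogeneousSpace ιX s) (hZhom : IsHomogeneousSpace ιZ 2)
    (hXFatou : HasFatouTime ιX r) (hZFatou : HasFatouL2sigma ιZ)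
    (hdata : ∃ u₀ : dataSpace ιZ, u₀ ≠ 0) :
    (SolvableNonMeagre ιX ιZ r → 1 ≤ 5 / 3 * r⁻¹.toReal + 2 * s⁻¹.toReal) ∧
    (SolvableNonMeagre ιX ιZ r ↔ AprioriEstimate ιX ιZ r s) ∧
    (UniformNonMeagre ιX ιZ r → AprioriEstimate ιX ιZ r s) ∧
    (UniformNonMeagre ιX ιZ r ↔ UniformAprioriEstimate ιX ιZ r s) ∧
    (UniformAprioriEstimate ιX ιZ r s → 5 / 3 * r⁻¹.toReal + 2 * s⁻¹.toReal = 1) := by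
  have hr0 : r ≠ 0 := (lt_of_le_of_lt bot_le hr).ne'
  have h12 : SolvableNonMeagre ιX ιZ r → AprioriEstimate ιX ιZ r s := fun h =>
    h.aprioriEstimate hXtrans hZtrans hXhom hZhom hXFatou
  have h45 : UniformNonMeagre ιX ιZ r → UniformAprioriEstimate ιX ιZ r s := fun h =>
    h.uniformAprioriEstimate hXtrans hZtrans hXhom hZhom hXFatou
  exact ⟨fun h => (h12 h).one_le hιZ hr0 hdata, ⟨h12, fun h => h.solvableNonMeagre⟩,
    fun h => (h45 h).aprioriEstimate, ⟨h45, fun h => h.uniformNonMeagre⟩,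
    fun h => h.eq_one hιZ hr0 hdata⟩
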